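/- **Setting.** Let $X$ be one of the following simply laced affine Cartan data, with vertex set $I=\{0,1,\dots,m\}$ and diagram automorphism $\sigma$: * (A) $X=D_{2n}^{(1)}$, $n\ge 2$, $m=2n$; (B) $X=D_{2n+1}^{(1)}$, $n\ge2$, $m=2n+1$; in both cases $\sigma: 0\mapsto m-1\mapsto 1\mapsto m\mapsto 0$ and $i\leftrightarrow m-i$ for $2\le i\le m-2$; * (C) $X=D_{2n+1}^{(1)}$, $n\ge2$; (D) $X=A_{2n+1}^{(1)}$, $n\ge 1$; in both cases $m=2n+1$ and $\sigma:i\leftrightarrow m-i$ for all $i$. Let $Q=\bigoplus_{i\in I}\mathbb Z\alpha_i$, let $\Delta=\Delta^{re}\sqcup(\mathbb Z\setminus\{0\})\delta$ be the affine root system of $X$, let $\Delta_0^+$ be the set of positive roots of the finite subsystem on $I\setminus\{0\}$, and let $\sigma$ act on $Q$ by $\alpha_i\mapsto\alpha_{\sigma(i)}$. For $\beta\in\Delta$: if the orbit of $\beta$ is $\{\beta,\sigma(\beta)\}$ with two elements and $\beta+\sigma(\beta)\in\Delta^{re}$, set $O(\beta)=O(\sigma(\beta))=O(\beta+\sigma(\beta))=2(\beta+\sigma(\beta))$;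 in all other cases $O(\beta)$ is the sum of the elements of the $\sigma$-orbit of $\beta$. Let $\underline I$ be the set of $\sigma$-orbits in $I$, let $\delta_\eta=1$ if the $\alpha_i$ $(i\in\eta)$ are pairwise orthogonal and $\delta_\eta=2$ otherwise, and let $\underline X$ be the Cartan datum on $\underline I$ with $(\underline\alpha_\eta,\underline\alpha_\eta)=2\delta_\eta|\eta|$ and $(\underline\alpha_\eta,\underline\alpha_{\eta'})=-\delta_\eta\delta_{\eta'}\,\#\{(i,j)\in\eta\times\eta' : (\alpha_i,\alpha_j)\ne0\}$ for $\eta\neq\eta'$. It is of type $A_{2n-2}^{(2)}$, $C_{n-1}^{(1)}$, $A_{2n-1}^{(2)}$, $C_n^{(1)}$ in the cases (A), (B), (C), (D), where $C_1^{(1)}$ means $A_1^{(1)}$. Let $\underline Q=\bigoplus_\eta\mathbb Z\underline\alpha_\eta$, let $\underline\Delta$ be the root system of $\underline X$ and $\underline\delta$ its null root. Let $\iota:\underline Q\to Q$ be the injective linear map with $\underline\alpha_\eta\mapsto O(\alpha_i)$ for $i\in\eta$; it identifies $\underline Q$ with the submodule $(Q^\sigma)'$ of $Q$ spanned by the $O(\alpha_i)$.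 We have $\iota(\underline\delta)=\delta$ in the cases (A), (B), (C) and $\iota(\underline\delta)=2\delta$ in the case (D). Let $\eta_0$ be the orbit of $0$ and $\underline\Delta_0=\{b\in\underline Q : \iota(b)=O(\beta)$ for some $\beta\in\Delta$ supported on $I\setminus\eta_0\}$; this is a finite root system, of type $B_{n-1}$ in the case (A), and $C_{n-1},C_n,C_n$ in the cases (B), (C), (D). Let $\underline\Delta_{0,s}^+$ and $\underline\Delta_{0,l}^+$ be the sets of its positive short and positive long roots (all roots of $B_1$ are called short, all roots of $C_1$ long). To each type $x\in\{s,s',2s',2s'',l,l',l'',l'''\}$ attach the level $e_x=0,1,1,3,0,1,2,3$, respectively, and the set $T_x=\underline\Delta_{0,s}^+$ for $s,s'$; $T_x=2\underline\Delta_{0,s}^+$ for $2s',2s''$; $T_x=\underline\Delta_{0,l}^+$ for $l,l',l'',l'''$. Put $$\Sigma_x^+=\{\alpha\in\Delta_0^+ : O(\alpha)\in e_x\delta+\iota(T_x)\},\qquad \Sigma_0^+=\{\alpha\in\Delta_0^+ : O(\alpha)\in\mathbb Z\delta\}.$$ For $k\ge0$ let $\Sigma_x(k)$ be the set of all $\beta=\sigma^i(a\delta+\alpha)$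 with $i\ge 0$, $a\ge0$, $\alpha\in\Sigma_x^+$ and $O(\beta)\in k\delta+\iota(T_x)$. For $k\ge1$ let $\Sigma'_x(k)$ be the set of all $\beta=\sigma^i(a\delta-\alpha)$ with $i\ge 0$, $a\ge1$, $\alpha\in\Sigma_x^+$ and $O(\beta)\in k\delta-\iota(T_x)$. (Thus $k$ is the coefficient of $\delta$ in $O(\beta)$.) Put $\underline\Sigma_x(k)=k\underline\delta+T_x$ and $\underline\Sigma'_x(k)=k\underline\delta-T_x$. Call real roots $\beta,\beta'$ equivalent if $O(\beta)=O(\beta')$. Let $\widehat\Delta^{re,+}$ be the set of equivalence classes in $\Delta^{re,+}\setminus\{m\delta\pm\alpha : m\ge0,\ \alpha\in\Sigma_0^+\}$, and let $\widehat\Sigma_x(k),\widehat\Sigma'_x(k)\subseteq\widehat\Delta^{re,+}$ be the sets of classes of the elements of $\Sigma_x(k)$, $\Sigma_x'(k)$. Say that $(x,k)$, $k\in\mathbb Z$, *occurs* in the following cases: * (A): $x=s$; $x=l$, $k\equiv0\ (2)$; $x=l'$, $k\equiv1\ (2)$; $x=2s'$, $k\equiv1\ (4)$; $x=2s''$, $k\equiv3\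 (4)$. * (B): $x=s$, $k\equiv0\ (2)$; $x=s'$, $k\equiv1\ (2)$; $x=l,l',l'',l'''$ with $k\equiv0,1,2,3\ (4)$, respectively. * (C): $x=s$, $k\equiv0\ (2)$; $x=s'$, $k\equiv1\ (2)$; $x=l$, $k\equiv0\ (4)$; $x=l''$, $k\equiv2\ (4)$. * (D): $x=s$, $k\equiv0\ (2)$; $x=l$, $k\equiv0\ (4)$; $x=l''$, $k\equiv2\ (4)$. **Proposition 5.12.** (i) In the cases (A), (B), (C), for each $\beta\in\Delta^+$ one has $O(\beta)\in\iota(\underline\Delta^+)$. In the case (D), for each $\beta\in\Delta^+$, either $O(\beta)\in\iota(\underline\Delta^+)$ or $O(\beta)=k\delta$ with $k>0$ odd; moreover one can write $O(\beta)=k\delta+\iota(b)$ with $k\ge0$ and $b\in\bigoplus_{\eta\ne\eta_0}\mathbb Z\underline\alpha_\eta$, and $k\underline\delta+b\in\underline\Delta^+$ for these $k$ and $b$. (ii) In all four cases, the sets $\widehat\Sigma_x(k)$ ($k\ge0$, $(x,k)$ occurs) and $\widehat\Sigma'_x(k)$ ($k\ge1$, $(x,-k)$ occurs) are pairwise disjoint,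 and their union is $\widehat\Delta^{re,+}$. In the cases (A), (B), (C) the map $f=\iota^{-1}\circ O$ is well defined on $\widehat\Delta^{re,+}$ and is a bijection $\widehat\Delta^{re,+}\to\underline\Delta^{re,+}$. It restricts to bijections $\widehat\Sigma_x(m)\to\underline\Sigma_x(m)$ for $m\ge0$ if $(x,m)$ occurs, and $\widehat\Sigma'_x(m)\to\underline\Sigma'_x(m)$ for $m\ge1$ if $(x,-m)$ occurs. (iii) In the case (D), for every positive real root $\beta$ not of the form $m\delta\pm\alpha$ with $m\ge 0$, $\alpha\in\Sigma_0^+$, one has $O(\beta)=2m\delta+\iota(b)$ with $m\ge0$ and $b\in\underline\Delta_0$. The map $f(\beta)=m\underline\delta+b$ satisfies $\iota(f(\beta))=O(\beta)$ and induces a bijection $\widehat\Delta^{re,+}\to\underline\Delta^{re,+}$. It restricts to bijections $\widehat\Sigma_x(2m)\to\underline\Sigma_x(m)$ for $m\ge0$ if $(x,2m)$ occurs, and $\widehat\Sigma'_x(2m)\to\underline\Sigma'_x(m)$ for $m\ge1$ if $(x,-2m)$ occurs; also to bijections $\widehat\Sigma_l(2m)\cup\widehat\Sigma_{l''}(2m)\to\underline\Sigma_l(m)$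 for all $m\ge0$, and $\widehat\Sigma'_l(2m)\cup\widehat\Sigma'_{l''}(2m)\to\underline\Sigma'_l(m)$ for all $m\ge1$. -/

import Mathlib

/-! Root systems of symmetric Cartan data and the folding by a diagram automorphism. -/

namespace OrbitFolding

set_option linter.unusedSectionVars false

/-! ### Cartan data

A Cartan datum on a finite vertex set `I` is given by its symmetric bilinear form on simple roots,
`B i j = (α_i, α_j)`.  The root lattice `Q = ⨁ ℤ α_i` is `I → ℤ` (coordinates in the simple roots).
The componentwise order on `I → ℤ` is the usual one: `0 ≤ x` says that `x` lies in `Q_+`. -/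

section Datum

variable {I : Type} [Fintype I] [DecidableEq I]

/-- The simple root `α_i`. -/
def simpleRoot (i : I) : I → ℤ := Pi.single i 1

/-- The bilinear form on the root lattice with `(α_i, α_j) = B i j`. -/
def pairing (B : I → I → ℤ) (x y : I → ℤ) : ℤ := ∑ i, ∑ j, x i * y j * B i j

/-- Real roots: the orbit of the simple roots under the Weyl group generated by the
simple reflections `s_i x = x - k α_i`, where `k = 2 (x, α_i) / (α_i, α_i)`. -/
inductive IsRealRoot (B : I → I → ℤ) : (I → ℤ) → Prop
  | simple (i : I) : IsRealRoot B (simpleRoot i)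
  | reflect (x : I → ℤ) (i : I) (k : ℤ) (hx : IsRealRoot B x)
      (hk : k * B i i = 2 * pairing B x (simpleRoot i)) :
      IsRealRoot B (x - k • simpleRoot i)

/-- Roots of an affine root system with null root `δ`: the real roots, and the imaginary roots,
which are the nonzero integral multiples of `δ`. -/
def IsRoot (B : I → I → ℤ) (δ x : I → ℤ) : Prop :=
  IsRealRoot B x ∨ ∃ k : ℤ, k ≠ 0 ∧ x = k • δ

/-- Positive real roots. -/
def posRealRoots (B : I → I → ℤ) : Set (I → ℤ) := {x | IsRealRoot B x ∧ 0 ≤ x}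

/-- Positive roots. -/
def posRoots (B : I → I → ℤ) (δ : I → ℤ) : Set (I → ℤ) := {x | IsRoot B δ x ∧ 0 ≤ x}

/-! ### The orbit map -/

/-- The action of `σ` on the root lattice, `α_i ↦ α_{σ i}`. -/
def act (σ : Equiv.Perm I) (x : I → ℤ) : I → ℤ := fun i => x (σ.symm i)

/-- The sum of the elements of the `σ`-orbit of `x`. -/
noncomputable def orbitSum (σ : Equiv.Perm I) (x : I → ℤ) : I → ℤ :=
  ∑ k ∈ Finset.range (Function.minimalPeriod (act σ) x), (act σ)^[k] x

/-- `β` is a root whose `σ`-orbit is `{β, σ β}` (two elements) and `β + σ β` is a real root.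
(Imaginary roots are fixed by `σ`, so only real `β` can occur.) -/
def IsSplit (B : I → I → ℤ) (σ : Equiv.Perm I) (β : I → ℤ) : Prop :=
  IsRealRoot B β ∧ Function.minimalPeriod (act σ) β = 2 ∧ IsRealRoot B (β + act σ β)

open Classical in
/-- The orbit map `β ↦ O(β)`: if the orbit of `β` is `{β, σ β}` with `β + σ β` a real root, then
`O(β) = O(σ β) = O(β + σ β) = 2 (β + σ β)`; otherwise `O(β)` is the sum over the orbit of `β`. -/
noncomputable def orb (B : I → I → ℤ) (σ : Equiv.Perm I) (β : I → ℤ) : I → ℤ :=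
  if IsSplit B σ β then (2 : ℤ) • (β + act σ β)
  else if ∃ γ, IsSplit B σ γ ∧ β = γ + act σ γ then (2 : ℤ) • β
  else orbitSum σ β

/-! ### The folded Cartan datum -/

/-- The set of `σ`-orbits in the vertex set. -/
def Orbits (σ : Equiv.Perm I) : Type := Quotient (Equiv.Perm.SameCycle.setoid σ)

/-- The orbit of a vertex. -/
def toOrbit (σ : Equiv.Perm I) (i : I) : Orbits σ := Quotient.mk _ i

/-- A vertex in the orbit `η`. -/
noncomputable def rep (σ : Equiv.Perm I) (η : Orbits σ) : I :=
  @Quotient.out I (Equiv.Perm.SameCycle.setoid σ) η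

noncomputable instance (σ : Equiv.Perm I) : DecidableEq (Orbits σ) := Classical.decEq _

noncomputable instance (σ : Equiv.Perm I) : Fintype (Orbits σ) :=
  @Fintype.ofFinite _ (Quotient.finite (Equiv.Perm.SameCycle.setoid σ))

/-- The vertices lying in an orbit `η`. -/
noncomputable def members (σ : Equiv.Perm I) (η : Orbits σ) : Finset I :=
  Finset.univ.filter fun i => toOrbit σ i = η

open Classical in
/-- `δ_η = 1` if the simple roots in the orbit `η` are pairwise orthogonal, and `2` otherwise. -/
noncomputable def orbitMult (B : I → I → ℤ) (σ : Equiv.Perm I) (η : Orbits σ) : ℤ :=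
  if ∀ i ∈ members σ η, ∀ j ∈ members σ η, i ≠ j → B i j = 0 then 1 else 2

/-- The folded Cartan datum on the set of orbits. -/
noncomputable def foldForm (B : I → I → ℤ) (σ : Equiv.Perm I) (η η' : Orbits σ) : ℤ :=
  if η = η' then 2 * orbitMult B σ η * (members σ η).card
  else - (orbitMult B σ η * orbitMult B σ η' *
    ((members σ η ×ˢ members σ η').filter fun p => B p.1 p.2 ≠ 0).card)

/-- `α̃_η = O(α_i)` for `i ∈ η` (independent of `i`, see `orb_simpleRoot_eq`). -/
noncomputable def tildeRoot (B : I → I → ℤ) (σ : Equiv.Perm I) (η : Orbits σ) : I → ℤ :=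
  orb B σ (simpleRoot (rep σ η))

/-- The identification of the folded root lattice with the span `(Q^σ)'` of the `α̃_η` in `Q`:
the linear map with `α_η ↦ α̃_η`.  It is injective, see `emb_injective`. -/
noncomputable def emb (B : I → I → ℤ) (σ : Equiv.Perm I) (b : Orbits σ → ℤ) : I → ℤ :=
  ∑ η, b η • tildeRoot B σ η

theorem act_simpleRoot (σ : Equiv.Perm I) (i : I) :
    act σ (simpleRoot i) = simpleRoot (σ i) := by
  funext j
  simp [act, simpleRoot, Pi.single_apply, Equiv.symm_apply_eq]

theorem iterate_act_simpleRoot (σ : Equiv.Perm I) (i : I) (k : ℕ) :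
    (act σ)^[k] (simpleRoot i) = simpleRoot ((σ ^ k) i) := by
  induction k with
  | zero => simp
  | succ k ih => rw [Function.iterate_succ_apply', ih, act_simpleRoot, pow_succ']; rfl

theorem iterate_act (σ : Equiv.Perm I) (x : I → ℤ) (k : ℕ) :
    (act σ)^[k] x = fun i => x ((σ ^ k).symm i) := by
  induction k with
  | zero => rfl
  | succ k ih => rw [Function.iterate_succ_apply', ih, pow_succ']; rfl

theorem mem_periodicPts_act (σ : Equiv.Perm I) (x : I → ℤ) :
    x ∈ Function.periodicPts (act σ) := by
  refine Function.mk_mem_periodicPts (orderOf_pos σ) ?_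
  rw [Function.IsPeriodicPt, Function.IsFixedPt, iterate_act, pow_orderOf_eq_one]
  rfl

theorem orbitSum_act (σ : Equiv.Perm I) (x : I → ℤ) :
    orbitSum σ (act σ x) = orbitSum σ x := by
  have h := Function.isPeriodicPt_minimalPeriod (act σ) x
  rw [Function.IsPeriodicPt, Function.IsFixedPt] at h
  unfold orbitSum
  rw [Function.minimalPeriod_apply (mem_periodicPts_act σ x)]
  have h1 := Finset.sum_range_succ (fun k => (act σ)^[k] x) (Function.minimalPeriod (act σ) x)
  rw [Finset.sum_range_succ', h] at h1
  simpa [Function.iterate_succ_apply] using h1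

theorem act_act_of_period_two {σ : Equiv.Perm I} {x : I → ℤ}
    (h : Function.minimalPeriod (act σ) x = 2) : act σ (act σ x) = x := by
  have h2 := Function.isPeriodicPt_minimalPeriod (act σ) x
  rw [h] at h2
  exact h2

/-- The orbit map is a positive multiple of the orbit sum. -/
theorem exists_orb_eq (B : I → I → ℤ) (σ : Equiv.Perm I) (β : I → ℤ) :
    ∃ c : ℤ, 0 < c ∧ orb B σ β = c • orbitSum σ β := by
  unfold orb
  split_ifs with h1 h2
  · refine ⟨2, by norm_num, ?_⟩
    rw [orbitSum, h1.2.1]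
    simp [Finset.sum_range_succ]
  · refine ⟨2, by norm_num, ?_⟩
    obtain ⟨γ, hγ, rfl⟩ := h2
    have hfix : Function.IsFixedPt (act σ) (γ + act σ γ) := by
      have h := act_act_of_period_two hγ.2.1
      change act σ γ + act σ (act σ γ) = _
      rw [h, add_comm]
    rw [orbitSum, Function.minimalPeriod_eq_one_iff_isFixedPt.2 hfix]
    simp
  · exact ⟨1, by norm_num, by simp⟩

theorem orbitSum_simpleRoot_apply (σ : Equiv.Perm I) (i j : I) :
    (σ.SameCycle i j → 0 < orbitSum σ (simpleRoot i) j) ∧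
      (¬ σ.SameCycle i j → orbitSum σ (simpleRoot i) j = 0) := by
  unfold orbitSum
  rw [Finset.sum_apply]
  constructor
  · intro h
    obtain ⟨k, hk⟩ := h.exists_nat_pow_eq
    have hper := mem_periodicPts_act σ (simpleRoot i)
    have hpos := Function.minimalPeriod_pos_of_mem_periodicPts hper
    refine Finset.sum_pos' (fun k _ => ?_)
      ⟨k % Function.minimalPeriod (act σ) (simpleRoot i),
        Finset.mem_range.2 (Nat.mod_lt _ hpos), ?_⟩
    · rw [iterate_act_simpleRoot]
      exact (Pi.single_nonneg.2 zero_le_one : (0 : I → ℤ) ≤ Pi.single _ 1) j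
    · rw [Function.iterate_mod_minimalPeriod_eq, iterate_act_simpleRoot, hk]
      simp [simpleRoot]
  · intro h
    refine Finset.sum_eq_zero fun k _ => ?_
    rw [iterate_act_simpleRoot, simpleRoot, Pi.single_apply, if_neg]
    rintro rfl
    exact h ⟨k, by simp⟩

theorem orb_simpleRoot_apply (B : I → I → ℤ) (σ : Equiv.Perm I) (i : I) :
    orb B σ (simpleRoot (σ i)) = orb B σ (simpleRoot i) := by
  have hper := mem_periodicPts_act σ (simpleRoot i)
  have hm := Function.minimalPeriod_apply hper
  rw [act_simpleRoot] at hm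
  have hspl : IsSplit B σ (simpleRoot (σ i)) ↔ IsSplit B σ (simpleRoot i) := by
    unfold IsSplit
    rw [hm]
    constructor
    · rintro ⟨_, h2, h3⟩
      refine ⟨.simple i, h2, ?_⟩
      rwa [← act_simpleRoot, act_act_of_period_two h2, add_comm] at h3
    · rintro ⟨_, h2, h3⟩
      refine ⟨.simple _, h2, ?_⟩
      rwa [← act_simpleRoot, act_act_of_period_two h2, add_comm]
  have hfix : ∀ j : I, ¬ ∃ γ, IsSplit B σ γ ∧ simpleRoot j = γ + act σ γ := by
    rintro j ⟨γ, hγ, h⟩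
    have h2 := act_act_of_period_two hγ.2.1
    have hj : act σ (simpleRoot j) = simpleRoot j := by
      rw [h]
      change act σ γ + act σ (act σ γ) = _
      rw [h2, add_comm]
    rw [act_simpleRoot] at hj
    have hj' : σ j = j := by
      by_contra hne
      have := congrFun hj (σ j)
      simp [simpleRoot, hne] at this
    have := congrFun h j
    simp only [simpleRoot, Pi.single_eq_same, Pi.add_apply, act,
      (Equiv.symm_apply_eq σ).2 hj'.symm] at this
    omega
  unfold orb
  by_cases hs : IsSplit B σ (simpleRoot i)
  · rw [if_pos hs, if_pos (hspl.2 hs), ← act_simpleRoot, act_act_of_period_two hs.2.1, add_comm]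
  · rw [if_neg hs, if_neg (fun h => hs (hspl.1 h)), if_neg (hfix _), if_neg (hfix _),
      ← act_simpleRoot, orbitSum_act]

/-- `α̃_η` is `O(α_i)` for every `i ∈ η`. -/
theorem orb_simpleRoot_eq (B : I → I → ℤ) (σ : Equiv.Perm I) (i : I) :
    tildeRoot B σ (toOrbit σ i) = orb B σ (simpleRoot i) := by
  have h : σ.SameCycle (rep σ (toOrbit σ i)) i :=
    @Quotient.mk_out I (Equiv.Perm.SameCycle.setoid σ) i
  obtain ⟨k, hk⟩ := h.exists_nat_pow_eq
  rw [tildeRoot]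
  generalize rep σ (toOrbit σ i) = j at hk
  clear h
  subst hk
  induction k with
  | zero => rfl
  | succ k ih => rw [pow_succ', Equiv.Perm.mul_apply, orb_simpleRoot_apply, ← ih]

theorem emb_injective (B : I → I → ℤ) (σ : Equiv.Perm I) :
    Function.Injective (emb B σ) := by
  have key : ∀ i j : I, (toOrbit σ i = toOrbit σ j → 0 < tildeRoot B σ (toOrbit σ i) j) ∧
      (toOrbit σ i ≠ toOrbit σ j → tildeRoot B σ (toOrbit σ i) j = 0) := by
    intro i j
    have hq : toOrbit σ i = toOrbit σ j ↔ σ.SameCycle i j :=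
      @Quotient.eq I (Equiv.Perm.SameCycle.setoid σ) i j
    obtain ⟨c, hc, h⟩ := exists_orb_eq B σ (simpleRoot i)
    rw [orb_simpleRoot_eq, h, Ne, hq]
    refine ⟨fun hs => ?_, fun hs => ?_⟩
    · exact mul_pos hc ((orbitSum_simpleRoot_apply σ i j).1 hs)
    · simp [(orbitSum_simpleRoot_apply σ i j).2 hs]
  have hval : ∀ (b : Orbits σ → ℤ) (j : I),
      emb B σ b j = b (toOrbit σ j) * tildeRoot B σ (toOrbit σ j) j := by
    intro b j
    unfold emb
    rw [Finset.sum_apply, Finset.sum_eq_single (toOrbit σ j)]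
    · rfl
    · intro η _ hη
      obtain ⟨i, rfl⟩ := Quotient.exists_rep η
      change b (toOrbit σ i) * tildeRoot B σ (toOrbit σ i) j = 0
      rw [(key i j).2 hη, mul_zero]
    · simp
  intro b b' h
  funext η
  obtain ⟨j, rfl⟩ := Quotient.exists_rep η
  have h1 := congrFun h j
  rw [hval, hval] at h1
  exact mul_right_cancel₀ ((key j j).1 rfl).ne' h1

end Datum

/-! ### The four cases

* `A`: `X = D_{2n}^{(1)}`, `σ` of order 4, folded type `A_{2n-2}^{(2)}`, `n ≥ 2`;
* `B`: `X = D_{2n+1}^{(1)}`, `σ` of order 4, folded type `C_{n-1}^{(1)}`, `n ≥ 2`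
  (`A_1^{(1)}` if `n = 2`);
* `C`: `X = D_{2n+1}^{(1)}`, `σ` of order 2, folded type `A_{2n-1}^{(2)}`, `n ≥ 2`;
* `D`: `X = A_{2n+1}^{(1)}`, `σ` of order 2, folded type `C_n^{(1)}`, `n ≥ 1`
  (`A_1^{(1)}` if `n = 1`).

The vertices are `0, 1, …, rk`, where `rk` is the rank of the underlying finite type. -/

/-- The four cases. -/
inductive FoldCase
  | A | B | C | D

/-- Rank of the finite root system: `2n` in case `A` and `2n+1` otherwise. -/
def rk : FoldCase → ℕ → ℕ
  | .A, n => 2 * n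
  | _, n => 2 * n + 1

/-- The vertex set `{0, 1, …, rk}`. -/
abbrev Vertex (c : FoldCase) (n : ℕ) : Type := Fin (rk c n + 1)

/-- Edges `i — j` with `i < j` of the Dynkin diagram `D_m^{(1)}`:
`0 — 2`, `1 — 2 — ⋯ — (m-1)` and `(m-2) — m`. -/
def edgeD (m i j : ℕ) : Prop :=
  (i = 0 ∧ j = 2) ∨ (1 ≤ i ∧ j = i + 1 ∧ j + 1 ≤ m) ∨ (i + 2 = m ∧ j = m)

/-- Edges `i — j` with `i < j` of the cyclic diagram `A_m^{(1)}`. -/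
def edgeA (m i j : ℕ) : Prop := j = i + 1 ∨ (i = 0 ∧ j = m)

/-- Edges `i — j`, with `i < j`, of the diagram `X`. -/
def edge : FoldCase → ℕ → ℕ → ℕ → Prop
  | .D, n => edgeA (rk .D n)
  | c, n => edgeD (rk c n)

open Classical in
/-- The simply laced Cartan datum `X`. -/
noncomputable def form (c : FoldCase) (n : ℕ) (i j : Vertex c n) : ℤ :=
  if i = j then 2 else if edge c n (min i.val j.val) (max i.val j.val) then -1 else 0

/-- The diagram automorphism.  With `m = rk`: in cases `A`, `B` it is
`0 ↦ m-1 ↦ 1 ↦ m ↦ 0` and `i ↔ m - i` for `2 ≤ i ≤ m-2`; in cases `C`, `D` it is `i ↔ m - i`. -/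
def sigma (c : FoldCase) (n : ℕ) : Equiv.Perm (Vertex c n) :=
  match c with
  | .A | .B => (Equiv.swap 0 1).trans Fin.revPerm
  | .C | .D => Fin.revPerm

/-- The null root `δ` of `X`. -/
def delta (c : FoldCase) (n : ℕ) (i : Vertex c n) : ℤ :=
  match c with
  | .D => 1
  | _ => if i.val ≤ 1 ∨ rk c n ≤ i.val + 1 then 1 else 2

/-- The root lattice `Q` of `X`. -/
abbrev Lat (c : FoldCase) (n : ℕ) : Type := Vertex c n → ℤ

/-- The root lattice of the folded datum. -/
abbrev FoldLat (c : FoldCase) (n : ℕ) : Type := Orbits (sigma c n) → ℤ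

/-- The folded Cartan datum. -/
noncomputable def uform (c : FoldCase) (n : ℕ) : Orbits (sigma c n) → Orbits (sigma c n) → ℤ :=
  foldForm (form c n) (sigma c n)

/-- The vertices of `X` whose orbits have mark `1` in the null root of the folded datum
(all other orbits have mark `2`). -/
def markOne : FoldCase → ℕ → ℕ → Prop
  | .A, _, i => i = 0
  | .C, n, i => i = 0 ∨ i = 1 ∨ i = n
  | _, n, i => i = 0 ∨ i = n

open Classical in
/-- The null root of the folded datum.  Under the identification `iota` below it is `δ` in
cases `A`, `B`, `C` and `2δ` in case `D`. -/
noncomputable def udelta (c : FoldCase) (n : ℕ) : FoldLat c n := fun η =>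
  if ∃ i : Vertex c n, toOrbit (sigma c n) i = η ∧ markOne c n i.val then 1 else 2

/-- The orbit map `O`. -/
noncomputable def O (c : FoldCase) (n : ℕ) (β : Lat c n) : Lat c n :=
  orb (form c n) (sigma c n) β

/-- The identification of the folded root lattice with the submodule of `Q` spanned by
the `O(α_i)`. -/
noncomputable def iota (c : FoldCase) (n : ℕ) (b : FoldLat c n) : Lat c n :=
  emb (form c n) (sigma c n) b

/-! ### Finite root systems -/

/-- `Δ_0^+`: the positive roots of the finite subsystem on the vertices `≠ 0`. -/
def posFin (c : FoldCase) (n : ℕ) : Set (Lat c n) :=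
  {α | IsRealRoot (form c n) α ∧ 0 ≤ α ∧ α 0 = 0}

/-- The finite subsystem on the vertices outside the `σ`-orbit of `0`. -/
def finSub (c : FoldCase) (n : ℕ) : Set (Lat c n) :=
  {β | IsRealRoot (form c n) β ∧ ∀ i, toOrbit (sigma c n) i = toOrbit (sigma c n) 0 → β i = 0}

/-- The finite folded root system `{O(β) | β ∈ finSub}`, in the folded root lattice. -/
def foldFin (c : FoldCase) (n : ℕ) : Set (FoldLat c n) :=
  {b | ∃ β ∈ finSub c n, iota c n b = O c n β}

/-- The value of `(b, b)` on short roots `b` of the finite folded root system, which is of type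
`B_{n-1}` in case `A` and of type `C_{n-1}`, `C_n`, `C_n` in cases `B`, `C`, `D`; long roots have
twice this value.  In rank `1` this follows the convention that all roots of `B_1` are short and
all roots of `C_1` are long. -/
def shortNorm : FoldCase → ℤ
  | .A => 2
  | _ => 4

/-- Positive short roots of the finite folded root system. -/
def shortPos (c : FoldCase) (n : ℕ) : Set (FoldLat c n) :=
  {b | b ∈ foldFin c n ∧ 0 ≤ b ∧ pairing (uform c n) b b = shortNorm c}

/-- Positive long roots of the finite folded root system. -/
def longPos (c : FoldCase) (n : ℕ) : Set (FoldLat c n) :=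
  {b | b ∈ foldFin c n ∧ 0 ≤ b ∧ pairing (uform c n) b b = 2 * shortNorm c}

/-! ### The types `x` -/

/-- The types of roots: in the order of the constructors
`s`, `s′`, `2s′`, `2s″`, `l`, `l′`, `l″`, `l‴`. -/
inductive Kind
  | s | s1 | ds1 | ds2 | l | l1 | l2 | l3

/-- The coefficient of `δ` in `O(α)` for `α` of the given type. -/
def Kind.level : Kind → ℤ
  | .s => 0
  | .s1 => 1
  | .ds1 => 1
  | .ds2 => 3
  | .l => 0
  | .l1 => 1
  | .l2 => 2
  | .l3 => 3

/-- The finite part of `O(α)` for `α` of type `x`: a positive short root for `s`, `s′`, the double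
of a positive short root for `2s′`, `2s″`, and a positive long root for `l`, `l′`, `l″`, `l‴`. -/
def target (c : FoldCase) (n : ℕ) : Kind → Set (FoldLat c n)
  | .s | .s1 => shortPos c n
  | .ds1 | .ds2 => {b | ∃ a ∈ shortPos c n, b = (2 : ℤ) • a}
  | .l | .l1 | .l2 | .l3 => longPos c n

/-- `Σ_x^+`: the `α ∈ Δ_0^+` with `O(α) = level(x) δ + b` for some `b` in `target x`. -/
def sigmaPos (c : FoldCase) (n : ℕ) (x : Kind) : Set (Lat c n) :=
  {α | α ∈ posFin c n ∧ ∃ b ∈ target c n x, O c n α = x.level • delta c n + iota c n b}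

/-- `Σ_0^+`: the `α ∈ Δ_0^+` such that `O(α)` is a multiple of `δ`. -/
def sigmaZero (c : FoldCase) (n : ℕ) : Set (Lat c n) :=
  {α | α ∈ posFin c n ∧ ∃ k : ℤ, O c n α = k • delta c n}

/-! ### Affine sets and equivalence classes -/

/-- `Σ_x(k)`: the elements `β` of `⋃_i σ^i {a δ + α | α ∈ Σ_x^+, a ≥ 0}` such that
`O(β) = k δ + b` with `b` in `target x`; so `k` is the coefficient of `δ` in `O(β)`. -/
def Sig (c : FoldCase) (n : ℕ) (x : Kind) (k : ℕ) : Set (Lat c n) :=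
  {β | (∃ (a i : ℕ), ∃ α ∈ sigmaPos c n x,
      β = (act (sigma c n))^[i] ((a : ℤ) • delta c n + α)) ∧
    ∃ b ∈ target c n x, O c n β = (k : ℤ) • delta c n + iota c n b}

/-- `Σ_x′(k)`: the elements `β` of `⋃_i σ^i {a δ - α | α ∈ Σ_x^+, a ≥ 1}` such that
`O(β) = k δ - b` with `b` in `target x`. -/
def SigNeg (c : FoldCase) (n : ℕ) (x : Kind) (k : ℕ) : Set (Lat c n) :=
  {β | (∃ (a i : ℕ), 1 ≤ a ∧ ∃ α ∈ sigmaPos c n x,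
      β = (act (sigma c n))^[i] ((a : ℤ) • delta c n - α)) ∧
    ∃ b ∈ target c n x, O c n β = (k : ℤ) • delta c n - iota c n b}

/-- The elements `m δ + b`, with `b` in `target x`, of the folded root lattice. -/
def USig (c : FoldCase) (n : ℕ) (x : Kind) (m : ℕ) : Set (FoldLat c n) :=
  {y | ∃ b ∈ target c n x, y = (m : ℤ) • udelta c n + b}

/-- The elements `m δ - b`, with `b` in `target x`, of the folded root lattice. -/
def USigNeg (c : FoldCase) (n : ℕ) (x : Kind) (m : ℕ) : Set (FoldLat c n) :=
  {y | ∃ b ∈ target c n x, y = (m : ℤ) • udelta c n - b}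

/-- The positive real roots of `X` not of the form `m δ ± α` with `m ≥ 0`, `α ∈ Σ_0^+`. -/
def Dom (c : FoldCase) (n : ℕ) : Set (Lat c n) :=
  {β | β ∈ posRealRoots (form c n) ∧ ¬ ∃ m : ℕ, ∃ α ∈ sigmaZero c n,
    β = (m : ℤ) • delta c n + α ∨ β = (m : ℤ) • delta c n - α}

/-- The set of equivalence classes in `Dom`, where `β ∼ β₁` if `O(β) = O(β₁)`. -/
def Hat (c : FoldCase) (n : ℕ) : Type :=
  Quotient (Setoid.ker fun β : Dom c n => O c n β.1)

/-- The equivalence class of `β`. -/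
noncomputable def cls (c : FoldCase) (n : ℕ) (β : Dom c n) : Hat c n :=
  Quotient.mk (Setoid.ker fun β : Dom c n => O c n β.1) β

/-- The set of classes of the elements of `Σ_x(k)`. -/
def HatSig (c : FoldCase) (n : ℕ) (x : Kind) (k : ℕ) : Set (Hat c n) :=
  {C | ∃ β : Dom c n, β.1 ∈ Sig c n x k ∧ cls c n β = C}

/-- The set of classes of the elements of `Σ_x′(k)`. -/
def HatSigNeg (c : FoldCase) (n : ℕ) (x : Kind) (k : ℕ) : Set (Hat c n) :=
  {C | ∃ β : Dom c n, β.1 ∈ SigNeg c n x k ∧ cls c n β = C}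

/-- The types `x` occurring in each case, with the residues of the coefficient `k`. -/
def Occurs : FoldCase → Kind → ℤ → Prop
  | .A, .s, _ => True
  | .A, .l, k => k ≡ 0 [ZMOD 2]
  | .A, .l1, k => k ≡ 1 [ZMOD 2]
  | .A, .ds1, k => k ≡ 1 [ZMOD 4]
  | .A, .ds2, k => k ≡ 3 [ZMOD 4]
  | .B, .s, k => k ≡ 0 [ZMOD 2]
  | .B, .s1, k => k ≡ 1 [ZMOD 2]
  | .B, .l, k => k ≡ 0 [ZMOD 4]
  | .B, .l1, k => k ≡ 1 [ZMOD 4]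
  | .B, .l2, k => k ≡ 2 [ZMOD 4]
  | .B, .l3, k => k ≡ 3 [ZMOD 4]
  | .C, .s, k => k ≡ 0 [ZMOD 2]
  | .C, .s1, k => k ≡ 1 [ZMOD 2]
  | .C, .l, k => k ≡ 0 [ZMOD 4]
  | .C, .l2, k => k ≡ 2 [ZMOD 4]
  | .D, .s, k => k ≡ 0 [ZMOD 2]
  | .D, .l, k => k ≡ 0 [ZMOD 4]
  | .D, .l2, k => k ≡ 2 [ZMOD 4]
  | _, _, _ => False

/-- The indices of the blocks: `inl (x, k)` for the classes in `Σ_x(k)`, and `inr (x, k)`, with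
`k ≥ 1` and the residue condition on `-k`, for the classes in `Σ_x′(k)`. -/
def blockIndex (c : FoldCase) : Set ((Kind × ℕ) ⊕ (Kind × ℕ)) :=
  {p | Sum.elim (fun q => Occurs c q.1 q.2) (fun q => 1 ≤ q.2 ∧ Occurs c q.1 (-(q.2 : ℤ))) p}

/-- The blocks. -/
def block (c : FoldCase) (n : ℕ) : (Kind × ℕ) ⊕ (Kind × ℕ) → Set (Hat c n) :=
  Sum.elim (fun q => HatSig c n q.1 q.2) (fun q => HatSigNeg c n q.1 q.2)

end OrbitFolding

open OrbitFolding

/-! The affine form is positive semidefinite with radical spanned by δ, and this makes the real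
roots exactly the lattice vectors of norm 2 (`IsFoldable.isRealRoot_iff`). Hence every isometry of
the lattice that commutes with σ permutes the real roots and commutes with the orbit map O, which is
built from periods, sums and the property of being a real root. The isometries used are the products
of reflections along an orthogonal σ-orbit. For the orbit of a vertex i these reflections are along
the α_j, or along the single root α_i + α_{σ i} when the orbit is a pair of adjacent vertices. On
σ-fixed vectors such a product is the simple reflection of the folded datum, transported by ι, and ι
is an isometry for the folded form (`IsFoldable.pairing_foldForm`).

A height descent (`IsFoldable.descent`) brings each real root with non-isotropic orbit sum, up to
sign, to some α_i or to some α_i + α_{σ i}. Both have as image a folded simple root, so O(β) is a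
folded real root; conversely every folded real root is such an image. A root with isotropic orbit
sum is sent into ℤδ, and these are exactly the roots excluded by Σ_0^+ (`mem_Dom_iff`). As classes
are the fibres of O, the bijection from classes to positive folded real roots follows
(`fold_bijOn`).

The finer statements need the coefficient of δ. The folded simple root at the orbit of 0 is a
multiple of δ minus a multiple e of O(θ), with θ a root supported off that orbit (`exists_theta`),
where e is 2 in the case A and 1 otherwise. Therefore every folded real root is kδ + f O(γ) with γ
in the finite subsystem and f equal to 1 or e (`IsFoldable.exists_finite_part`). The norm of O(γ),
the factor f and the residue of k determine the type (`exists_occurs`); parity arguments rule out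
the residues that do not occur.

Conversely, for each occurring type and each finite part one needs a root at the base level
(`exists_real_of_occurs`). The finite folded Weyl group is transitive on images of a given norm, so
one root per type suffices: it comes from the finite subsystem, from α_0, from δ - α_0, from a
reflected neighbour of 0, or from splitting a σ-fixed root. A rotation by σ removes its coefficient
at 0 (`IsFoldable.exists_apply_eq_zero`), and adding aδ moves its image by P a δ, where P divides
the difference between the base level and any occurring level. Disjointness of the blocks holds
because the coefficient at the vertex 0 recovers k, positivity recovers the sign, and the norm then
recovers the type. In the case D all levels of non-isotropic images are even, which matches ι of the
folded null root being 2δ. -/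

namespace OrbitFolding

set_option linter.unusedSectionVars false

/-! ### The bilinear form -/

section Pairing

variable {I : Type} [Fintype I] [DecidableEq I]

theorem pairing_add_left (B : I → I → ℤ) (x y z : I → ℤ) :
    pairing B (x + y) z = pairing B x z + pairing B y z := by
  simp only [pairing, Pi.add_apply, add_mul, Finset.sum_add_distrib]

theorem pairing_add_right (B : I → I → ℤ) (x y z : I → ℤ) :
    pairing B x (y + z) = pairing B x y + pairing B x z := by
  simp only [pairing, Pi.add_apply, add_mul, mul_add, Finset.sum_add_distrib]

theorem pairing_smul_left (B : I → I → ℤ) (k : ℤ) (x y : I → ℤ) :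
    pairing B (k • x) y = k * pairing B x y := by
  simp only [pairing, Pi.smul_apply, smul_eq_mul, Finset.mul_sum, mul_assoc]

theorem pairing_smul_right (B : I → I → ℤ) (k : ℤ) (x y : I → ℤ) :
    pairing B x (k • y) = k * pairing B x y := by
  simp only [pairing, Pi.smul_apply, smul_eq_mul, Finset.mul_sum]
  exact Finset.sum_congr rfl fun i _ => Finset.sum_congr rfl fun j _ => by ring

theorem pairing_neg_left (B : I → I → ℤ) (x y : I → ℤ) :
    pairing B (-x) y = -pairing B x y := by
  have := pairing_smul_left B (-1) x y
  simpa using this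

theorem pairing_neg_right (B : I → I → ℤ) (x y : I → ℤ) :
    pairing B x (-y) = -pairing B x y := by
  have := pairing_smul_right B (-1) x y
  simpa using this

theorem pairing_sub_left (B : I → I → ℤ) (x y z : I → ℤ) :
    pairing B (x - y) z = pairing B x z - pairing B y z := by
  rw [sub_eq_add_neg, pairing_add_left, pairing_neg_left, sub_eq_add_neg]

theorem pairing_sub_right (B : I → I → ℤ) (x y z : I → ℤ) :
    pairing B x (y - z) = pairing B x y - pairing B x z := by
  rw [sub_eq_add_neg, pairing_add_right, pairing_neg_right, sub_eq_add_neg]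

theorem pairing_zero_left (B : I → I → ℤ) (x : I → ℤ) : pairing B 0 x = 0 := by
  simp [pairing]

theorem pairing_zero_right (B : I → I → ℤ) (x : I → ℤ) : pairing B x 0 = 0 := by
  simp [pairing]

theorem pairing_sum_left {ι : Type*} (B : I → I → ℤ) (s : Finset ι) (f : ι → I → ℤ)
    (x : I → ℤ) : pairing B (∑ k ∈ s, f k) x = ∑ k ∈ s, pairing B (f k) x := by
  classical
  induction s using Finset.induction_on with
  | empty => simp [pairing_zero_left]
  | insert a s ha ih => rw [Finset.sum_insert ha, Finset.sum_insert ha, pairing_add_left, ih]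

theorem pairing_sum_right {ι : Type*} (B : I → I → ℤ) (s : Finset ι) (f : ι → I → ℤ)
    (x : I → ℤ) : pairing B x (∑ k ∈ s, f k) = ∑ k ∈ s, pairing B x (f k) := by
  classical
  induction s using Finset.induction_on with
  | empty => simp [pairing_zero_right]
  | insert a s ha ih => rw [Finset.sum_insert ha, Finset.sum_insert ha, pairing_add_right, ih]

theorem pairing_simpleRoot_simpleRoot (B : I → I → ℤ) (i j : I) :
    pairing B (simpleRoot i) (simpleRoot j) = B i j := by
  simp [pairing, simpleRoot, Pi.single_apply]

theorem pairing_simpleRoot_right (B : I → I → ℤ) (x : I → ℤ) (j : I) :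
    pairing B x (simpleRoot j) = ∑ i, x i * B i j := by
  simp [pairing, simpleRoot, Pi.single_apply]

theorem pairing_eq_sum_right (B : I → I → ℤ) (x y : I → ℤ) :
    pairing B x y = ∑ j, y j * pairing B x (simpleRoot j) := by
  simp only [pairing_simpleRoot_right, Finset.mul_sum]
  rw [pairing, Finset.sum_comm]
  exact Finset.sum_congr rfl fun i _ => Finset.sum_congr rfl fun j _ => by ring

theorem IsRealRoot.neg {B : I → I → ℤ} {x : I → ℤ} (hx : IsRealRoot B x) :
    IsRealRoot B (-x) := by
  induction hx with
  | simple i =>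
    have := IsRealRoot.reflect (B := B) _ i 2 (.simple i)
      (by rw [pairing_simpleRoot_simpleRoot])
    convert this using 1
    rw [two_smul]; abel
  | reflect x i k _ hk ih =>
    have : -(x - k • simpleRoot i) = -x - (-k) • simpleRoot i := by rw [neg_smul]; abel
    rw [this]
    exact .reflect _ _ _ ih (by rw [pairing_neg_left]; linarith)

theorem act_add (σ : Equiv.Perm I) (x y : I → ℤ) : act σ (x + y) = act σ x + act σ y := rfl

theorem act_neg (σ : Equiv.Perm I) (x : I → ℤ) : act σ (-x) = -act σ x := rfl

theorem act_sub (σ : Equiv.Perm I) (x y : I → ℤ) : act σ (x - y) = act σ x - act σ y := rfl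

theorem act_zero (σ : Equiv.Perm I) : act σ (0 : I → ℤ) = 0 := rfl

theorem act_smul (σ : Equiv.Perm I) (k : ℤ) (x : I → ℤ) : act σ (k • x) = k • act σ x := rfl

theorem act_sum {ι : Type*} (σ : Equiv.Perm I) (s : Finset ι) (f : ι → I → ℤ) :
    act σ (∑ k ∈ s, f k) = ∑ k ∈ s, act σ (f k) := by
  funext i
  simp [act, Finset.sum_apply]

theorem act_injective (σ : Equiv.Perm I) : Function.Injective (act σ) := by
  intro x y h
  funext i
  have := congrFun h (σ i)
  simpa [act] using this

theorem iterate_act_nonneg {σ : Equiv.Perm I} {x : I → ℤ} (h : 0 ≤ x) (k : ℕ) :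
    0 ≤ (act σ)^[k] x := by
  rw [iterate_act]; exact fun i => h _

end Pairing

/-- A symmetric simply laced affine Cartan datum `B` with null root `δ` and a diagram automorphism
`σ` each of whose vertex orbits is orthogonal or a pair of adjacent vertices. -/
structure IsFoldable {I : Type} [Fintype I] [DecidableEq I]
    (B : I → I → ℤ) (δ : I → ℤ) (σ : Equiv.Perm I) (o : I) : Prop where
  symm : ∀ i j, B i j = B j i
  diag : ∀ i, B i i = 2
  off : ∀ i j, i ≠ j → B i j = 0 ∨ B i j = -1
  inv : ∀ i j, B (σ i) (σ j) = B i j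
  null : ∀ i, ∑ j, B i j * δ j = 0
  pos : ∀ i, 0 < δ i
  fix : ∀ i, δ (σ i) = δ i
  conn : ∀ x : I → ℤ, (∀ i j, B i j ≠ 0 → x i * δ j = x j * δ i) → ∀ i, x i = x o * δ i
  dich : ∀ i, (∀ j, σ.SameCycle i j → i ≠ j → B i j = 0) ∨ (σ (σ i) = i ∧ B i (σ i) = -1)
  proper : ∀ i, ∃ j, ¬ σ.SameCycle i j

/-! ### Positivity of the affine form, and real roots as vectors of norm 2. -/

namespace IsFoldable

variable {I : Type} [Fintype I] [DecidableEq I]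
  {B : I → I → ℤ} {δ : I → ℤ} {σ : Equiv.Perm I} {o : I}

theorem comm (h : IsFoldable B δ σ o) (x y : I → ℤ) : pairing B x y = pairing B y x := by
  unfold pairing
  rw [Finset.sum_comm]
  exact Finset.sum_congr rfl fun i _ => Finset.sum_congr rfl fun j _ => by
    rw [h.symm j i]; ring

theorem pairing_delta_right (h : IsFoldable B δ σ o) (x : I → ℤ) : pairing B x δ = 0 := by
  have : pairing B x δ = ∑ i, x i * ∑ j, B i j * δ j := by
    unfold pairing
    simp only [Finset.mul_sum]
    exact Finset.sum_congr rfl fun i _ => Finset.sum_congr rfl fun j _ => by ring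
  rw [this]
  simp [h.null]

theorem pairing_delta_left (h : IsFoldable B δ σ o) (x : I → ℤ) : pairing B δ x = 0 := by
  rw [h.comm, h.pairing_delta_right]

theorem act_delta (h : IsFoldable B δ σ o) : act σ δ = δ := by
  funext i
  have := h.fix (σ.symm i)
  simp only [Equiv.apply_symm_apply] at this
  simp [act, this]

theorem pairing_act (h : IsFoldable B δ σ o) (x y : I → ℤ) :
    pairing B (act σ x) (act σ y) = pairing B x y := by
  unfold pairing act
  rw [← Equiv.sum_comp σ]
  refine Finset.sum_congr rfl fun i _ => ?_
  rw [← Equiv.sum_comp σ]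
  refine Finset.sum_congr rfl fun j _ => ?_
  simp [h.inv]

theorem off_nonpos (h : IsFoldable B δ σ o) {i j : I} (hij : i ≠ j) : B i j ≤ 0 := by
  rcases h.off i j hij with h | h <;> omega

/-- Because δ lies in the kernel of the form, the diagonal terms can be absorbed into squares of
differences of the ratios x_i / δ_i. Off-diagonal entries are nonpositive, so every summand is
nonnegative. -/
theorem two_mul_pairing_self (h : IsFoldable B δ σ o) (x : I → ℤ) :
    (2 * pairing B x x : ℚ) =
      ∑ i, ∑ j, -(B i j * (δ i * δ j) * (x i / δ i - x j / δ j) ^ 2 : ℚ) := by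
  have hd : ∀ i, (δ i : ℚ) ≠ 0 := fun i => by exact_mod_cast (h.pos i).ne'
  have h1 : ∀ i j, -(B i j * (δ i * δ j) * (x i / δ i - x j / δ j) ^ 2 : ℚ) =
      2 * (x i * x j * B i j) - (x i) ^ 2 / δ i * (B i j * δ j)
        - (x j) ^ 2 / δ j * (B j i * δ i) := by
    intro i j
    rw [h.symm j i]
    field_simp [hd i, hd j]
    ring
  have hn : ∀ i, ∑ j, (B i j * δ j : ℚ) = 0 := fun i => by exact_mod_cast h.null i
  simp only [h1, Finset.sum_sub_distrib]
  have h2 : ∑ i, ∑ j, ((x i) ^ 2 / δ i * (B i j * δ j) : ℚ) = 0 := by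
    simp [← Finset.mul_sum, hn]
  have h3 : ∑ i, ∑ j, ((x j) ^ 2 / δ j * (B j i * δ i) : ℚ) = 0 := by
    rw [Finset.sum_comm]; exact h2
  rw [h2, h3, pairing]
  push_cast
  simp only [Finset.mul_sum, sub_zero]

theorem term_nonneg (h : IsFoldable B δ σ o) (x : I → ℤ) (i j : I) :
    (0 : ℚ) ≤ -(B i j * (δ i * δ j) * (x i / δ i - x j / δ j) ^ 2 : ℚ) := by
  by_cases hij : i = j
  · subst hij; simp
  · have h1 : (B i j : ℚ) ≤ 0 := by exact_mod_cast h.off_nonpos hij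
    have h2 : (0 : ℚ) < δ i * δ j := by exact_mod_cast mul_pos (h.pos i) (h.pos j)
    have h3 : (B i j * (δ i * δ j) : ℚ) ≤ 0 := mul_nonpos_of_nonpos_of_nonneg h1 h2.le
    have := mul_nonpos_of_nonpos_of_nonneg h3 (sq_nonneg (x i / δ i - x j / δ j : ℚ))
    linarith

theorem pairing_self_nonneg (h : IsFoldable B δ σ o) (x : I → ℤ) : 0 ≤ pairing B x x := by
  have h1 := h.two_mul_pairing_self x
  have h2 : (0 : ℚ) ≤ 2 * pairing B x x := by
    rw [h1]
    exact Finset.sum_nonneg fun i _ => Finset.sum_nonneg fun j _ => h.term_nonneg x i j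
  have h3 : (0 : ℚ) ≤ pairing B x x := by linarith
  exact_mod_cast h3

/-- All squares in `two_mul_pairing_self` vanish, so the ratios x_i / δ_i agree along edges and
connectedness makes them constant. -/
theorem eq_smul_delta (h : IsFoldable B δ σ o) {x : I → ℤ} (hx : pairing B x x = 0) :
    x = x o • δ := by
  have h1 := h.two_mul_pairing_self x
  rw [hx] at h1
  have h2 : ∀ i j, -(B i j * (δ i * δ j) * (x i / δ i - x j / δ j) ^ 2 : ℚ) = 0 := by
    intro i j
    have h3 := (Finset.sum_eq_zero_iff_of_nonneg fun i _ =>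
      Finset.sum_nonneg fun j _ => h.term_nonneg x i j).1 (h1.symm.trans (by simp)) i
      (Finset.mem_univ _)
    exact (Finset.sum_eq_zero_iff_of_nonneg fun j _ => h.term_nonneg x i j).1 h3 j
      (Finset.mem_univ _)
  funext i
  rw [Pi.smul_apply, smul_eq_mul]
  refine h.conn x (fun i j hij => ?_) i
  have hdi : (δ i : ℚ) ≠ 0 := by exact_mod_cast (h.pos i).ne'
  have hdj : (δ j : ℚ) ≠ 0 := by exact_mod_cast (h.pos j).ne'
  have hB : (B i j : ℚ) ≠ 0 := by exact_mod_cast hij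
  have h3 := h2 i j
  rw [neg_eq_zero, mul_eq_zero, or_iff_right (mul_ne_zero hB (mul_ne_zero hdi hdj)),
    pow_eq_zero_iff two_ne_zero, sub_eq_zero, div_eq_div_iff hdi hdj] at h3
  exact_mod_cast h3

/-- Modulo 2 the terms for (i, j) and (j, i) cancel, and the diagonal terms carry the factor 2;
interchanging the two indices is the required involution. -/
theorem even_pairing_self (h : IsFoldable B δ σ o) (x : I → ℤ) : Even (pairing B x x) := by
  rw [← ZMod.intCast_eq_zero_iff_even, pairing, ← Finset.sum_product']
  push_cast
  have h2 : (2 : ZMod 2) = 0 := rfl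
  refine Finset.sum_involution (fun p _ => (p.2, p.1)) ?_ ?_ ?_ ?_
  · rintro ⟨i, j⟩ _
    simp only
    rw [h.symm j i]
    linear_combination (x i * x j * B i j : ZMod 2) * h2
  · rintro ⟨i, j⟩ _ hne heq
    simp only [Prod.mk.injEq] at heq
    obtain ⟨rfl, -⟩ := heq
    apply hne
    rw [h.diag]
    push_cast
    rw [h2, mul_zero]
  · simp
  · simp

/-- Splitting x into positive and negative parts, the cross term is nonpositive since the supports
are disjoint, so the norms of the two parts add up to at most 2. One part is then isotropic, hence a
multiple of δ, which has full support or is zero. -/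
theorem nonneg_or_nonpos (h : IsFoldable B δ σ o) {x : I → ℤ} (hx : pairing B x x = 2) :
    0 ≤ x ∨ x ≤ 0 := by
  have hd : pairing B x x = pairing B (x⁺) (x⁺) + pairing B (x⁻) (x⁻)
      - 2 * pairing B (x⁺) (x⁻) := by
    conv_lhs => rw [← posPart_sub_negPart x]
    rw [pairing_sub_left, pairing_sub_right, pairing_sub_right, h.comm (x⁻) (x⁺)]
    ring
  have hm : pairing B (x⁺) (x⁻) ≤ 0 := by
    refine Finset.sum_nonpos fun i _ => Finset.sum_nonpos fun j _ => ?_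
    have h1 : 0 ≤ (x⁺) i := posPart_nonneg x i
    have h2 : 0 ≤ (x⁻) j := negPart_nonneg x j
    by_cases hij : i = j
    · subst hij
      have : (x⁺) i * (x⁻) i = 0 := by
        rw [Pi.posPart_apply, Pi.negPart_apply]
        rcases le_total 0 (x i) with h | h
        · rw [negPart_eq_zero.2 h, mul_zero]
        · rw [posPart_eq_zero.2 h, zero_mul]
      rw [this, zero_mul]
    · exact mul_nonpos_of_nonneg_of_nonpos (mul_nonneg h1 h2) (h.off_nonpos hij)
  -- Both norms are even and nonnegative with sum at most 2.
  have key : pairing B (x⁺) (x⁺) = 0 ∨ pairing B (x⁻) (x⁻) = 0 := by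
    obtain ⟨a, ha⟩ := h.even_pairing_self (x⁺)
    obtain ⟨b, hb⟩ := h.even_pairing_self (x⁻)
    have h1 := h.pairing_self_nonneg (x⁺)
    have h2 := h.pairing_self_nonneg (x⁻)
    omega
  have full : ∀ y : I → ℤ, 0 ≤ y → pairing B y y = 0 → y = 0 ∨ ∀ i, 0 < y i := by
    intro y hy hyy
    have h1 := h.eq_smul_delta hyy
    have h0 : 0 ≤ y o := hy o
    rcases h0.eq_or_lt with h0 | h0
    · left; rw [h1, ← h0, zero_smul]
    · right; intro i; rw [h1]; exact mul_pos h0 (h.pos i)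
  rcases key with hk | hk
  · rcases full _ (posPart_nonneg x) hk with h1 | h1
    · right; exact posPart_eq_zero.1 h1
    · left; intro i
      have := h1 i
      rw [Pi.posPart_apply] at this
      exact (posPart_pos_iff.1 this).le
  · rcases full _ (negPart_nonneg x) hk with h1 | h1
    · left; exact negPart_eq_zero.1 h1
    · right; intro i
      have := h1 i
      rw [Pi.negPart_apply] at this
      exact (negPart_pos_iff.1 this).le

theorem isRealRoot_sub_smul (h : IsFoldable B δ σ o) {x : I → ℤ} (hx : IsRealRoot B x) (i : I) :
    IsRealRoot B (x - pairing B x (simpleRoot i) • simpleRoot i) :=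
  .reflect x i _ hx (by rw [h.diag]; ring)

theorem pairing_self_of_isRealRoot (h : IsFoldable B δ σ o) {x : I → ℤ} (hx : IsRealRoot B x) :
    pairing B x x = 2 := by
  induction hx with
  | simple i => rw [pairing_simpleRoot_simpleRoot, h.diag]
  | reflect x i k _ hk ih =>
    rw [h.diag] at hk
    rw [pairing_sub_left, pairing_sub_right, pairing_sub_right, pairing_smul_left,
      pairing_smul_right, pairing_smul_left, pairing_smul_right, pairing_simpleRoot_simpleRoot,
      h.diag, h.comm (simpleRoot i) x, ih]
    linear_combination k * hk

/-- The norm is the sum of the x_i (x, α_i), so some term of it is positive. -/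
theorem exists_pairing_pos {x : I → ℤ} (hx : 0 ≤ x) (h2 : 0 < pairing B x x) :
    ∃ i, 0 < x i ∧ 0 < pairing B x (simpleRoot i) := by
  by_contra hne
  push Not at hne
  rw [pairing_eq_sum_right] at h2
  refine absurd h2 (not_lt.2 (Finset.sum_nonpos fun i _ => ?_))
  rcases (hx i).eq_or_lt with h0 | h0
  · rw [Pi.zero_apply] at h0
    rw [← h0, zero_mul]
  · exact mul_nonpos_of_nonneg_of_nonpos h0.le (hne i h0)

/-- Induction on the height: a simple reflection at a vertex with (x, α_i) > 0 lowers the height and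
keeps the norm, and the result is again of one sign. A sign change can only happen when x is α_i
itself. -/
theorem isRealRoot_of_nonneg (h : IsFoldable B δ σ o) (N : ℕ) : ∀ x : I → ℤ, 0 ≤ x →
    pairing B x x = 2 → ∑ i, x i ≤ N → IsRealRoot B x := by
  induction N using Nat.strong_induction_on with
  | _ N ih =>
  intro x hx h2 hN
  obtain ⟨i, hi, hp⟩ := exists_pairing_pos (B := B) hx (by rw [h2]; norm_num)
  set k := pairing B x (simpleRoot i)
  set y := x - k • simpleRoot i with hy
  have hyy : pairing B y y = 2 := by
    rw [hy, pairing_sub_left, pairing_sub_right, pairing_sub_right, pairing_smul_left,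
      pairing_smul_right, pairing_smul_left, pairing_smul_right, pairing_simpleRoot_simpleRoot,
      h.diag, h.comm (simpleRoot i) x, h2]
    change 2 - k * k - (k * k - k * (k * 2)) = 2
    ring
  have hxy : x = y - (pairing B y (simpleRoot i)) • simpleRoot i := by
    have : pairing B y (simpleRoot i) = - k := by
      rw [hy, pairing_sub_left, pairing_smul_left, pairing_simpleRoot_simpleRoot, h.diag]
      change k - k * 2 = -k
      ring
    rw [this, hy, neg_smul]; abel
  rcases h.nonneg_or_nonpos hyy with h0 | h0
  · have hsum : ∑ j, y j = ∑ j, x j - k := by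
      simp [hy, Finset.sum_sub_distrib, simpleRoot, ← Finset.mul_sum]
    have h0s : 0 ≤ ∑ j, y j := Finset.sum_nonneg fun j _ => h0 j
    rw [hxy]
    refine h.isRealRoot_sub_smul (ih (∑ j, y j).toNat (by omega) y h0 hyy (by omega)) i
  -- The reflection alters only the coordinate i, so the other coordinates of x are both nonnegative
  -- and nonpositive.
  · have hxi : x = x i • simpleRoot i := by
      funext j
      by_cases hj : j = i
      · subst hj; simp [simpleRoot]
      · have h1 := h0 j
        have h3 := hx j
        simp only [hy, simpleRoot, Pi.sub_apply, Pi.smul_apply, Pi.zero_apply, ne_eq, hj,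
          not_false_eq_true, Pi.single_eq_of_ne, smul_zero, sub_zero] at h1 h3 ⊢
        omega
    have h4 : x i * (x i * 2) = 2 := by
      rw [hxi, pairing_smul_left, pairing_smul_right, pairing_simpleRoot_simpleRoot, h.diag] at h2
      exact h2
    have h5 : x i = 1 := by nlinarith
    rw [hxi, h5, one_smul]
    exact .simple i

/-- This replaces the inductive definition by a condition visibly invariant under all isometries,
under σ, and under translation by multiples of δ. -/
theorem isRealRoot_iff (h : IsFoldable B δ σ o) {x : I → ℤ} :
    IsRealRoot B x ↔ pairing B x x = 2 := by
  refine ⟨h.pairing_self_of_isRealRoot, fun h2 => ?_⟩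
  rcases h.nonneg_or_nonpos h2 with h0 | h0
  · exact h.isRealRoot_of_nonneg (∑ i, x i).toNat x h0 h2 (by omega)
  · have h1 : 0 ≤ -x := neg_nonneg.2 h0
    have h3 := h.isRealRoot_of_nonneg (∑ i, (-x) i).toNat (-x) h1
      (by rw [pairing_neg_left, pairing_neg_right, neg_neg, h2]) (by omega)
    simpa using h3.neg

end IsFoldable

end OrbitFolding

namespace OrbitFolding

set_option linter.unusedSectionVars false

/-! ### Equivariant maps and orbit sums -/

section Orbit

variable {I : Type} [Fintype I] [DecidableEq I] {σ : Equiv.Perm I}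

theorem iterate_act_add (x y : I → ℤ) (k : ℕ) :
    (act σ)^[k] (x + y) = (act σ)^[k] x + (act σ)^[k] y := by
  simp only [iterate_act]; rfl

theorem act_orbitSum (x : I → ℤ) : act σ (orbitSum σ x) = orbitSum σ x := by
  conv_rhs => rw [← orbitSum_act]
  unfold orbitSum
  rw [Function.minimalPeriod_apply (mem_periodicPts_act σ x), act_sum]
  refine Finset.sum_congr rfl fun k _ => ?_
  rw [← Function.iterate_succ_apply' (act σ), ← Function.iterate_succ_apply (act σ)]

theorem minimalPeriod_act_pos (x : I → ℤ) : 0 < Function.minimalPeriod (act σ) x :=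
  Function.minimalPeriod_pos_of_mem_periodicPts (mem_periodicPts_act σ x)

/-- The automorphism permutes the terms of an orbit cyclically. The version with a general function
f is needed for sums whose terms depend quadratically on the orbit element. -/
theorem sum_orbit_act {M : Type*} [AddCommGroup M] (f : (I → ℤ) → M) (x : I → ℤ) :
    ∑ k ∈ Finset.range (Function.minimalPeriod (act σ) x), f (act σ ((act σ)^[k] x)) =
      ∑ k ∈ Finset.range (Function.minimalPeriod (act σ) x), f ((act σ)^[k] x) := by
  have h1 := Finset.sum_range_succ (fun k => f ((act σ)^[k] x)) (Function.minimalPeriod (act σ) x)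
  rw [Finset.sum_range_succ', Function.iterate_minimalPeriod] at h1
  simpa [Function.iterate_succ_apply'] using h1

theorem orbitSum_nonneg {x : I → ℤ} (h : 0 ≤ x) : 0 ≤ orbitSum σ x :=
  Finset.sum_nonneg fun k _ => iterate_act_nonneg h k

theorem orbitSum_of_act_eq {x : I → ℤ} (h : act σ x = x) : orbitSum σ x = x := by
  rw [orbitSum, Function.minimalPeriod_eq_one_iff_isFixedPt.2 h]
  simp

theorem sum_act (x : I → ℤ) : ∑ i, act σ x i = ∑ i, x i :=
  Equiv.sum_comp σ.symm x

theorem sum_iterate_act (x : I → ℤ) (k : ℕ) : ∑ i, (act σ)^[k] x i = ∑ i, x i := by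
  rw [iterate_act]
  exact Equiv.sum_comp (σ ^ k).symm x

variable {w : (I → ℤ) ≃+ (I → ℤ)}

theorem iterate_act_equivariant (hw : ∀ x, w (act σ x) = act σ (w x)) (k : ℕ) (x : I → ℤ) :
    (act σ)^[k] (w x) = w ((act σ)^[k] x) := by
  induction k with
  | zero => rfl
  | succ k ih => rw [Function.iterate_succ_apply', Function.iterate_succ_apply', ih, hw]

theorem minimalPeriod_equivariant (hw : ∀ x, w (act σ x) = act σ (w x)) (x : I → ℤ) :
    Function.minimalPeriod (act σ) (w x) = Function.minimalPeriod (act σ) x := by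
  rw [Function.minimalPeriod_eq_minimalPeriod_iff]
  intro n
  simp only [Function.IsPeriodicPt, Function.IsFixedPt, iterate_act_equivariant hw]
  exact w.injective.eq_iff

theorem orbitSum_equivariant (hw : ∀ x, w (act σ x) = act σ (w x)) (x : I → ℤ) :
    orbitSum σ (w x) = w (orbitSum σ x) := by
  unfold orbitSum
  rw [minimalPeriod_equivariant hw, map_sum]
  exact Finset.sum_congr rfl fun k _ => iterate_act_equivariant hw k x

theorem isSplit_equivariant {B : I → I → ℤ} (hw : ∀ x, w (act σ x) = act σ (w x))
    (hB : ∀ x, IsRealRoot B (w x) ↔ IsRealRoot B x) (x : I → ℤ) :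
    IsSplit B σ (w x) ↔ IsSplit B σ x := by
  unfold IsSplit
  rw [minimalPeriod_equivariant hw, hB, ← hw, ← map_add, hB]

/-- A root that is the sum of a pair of roots exchanged by `σ`. -/
def IsSum (B : I → I → ℤ) (σ : Equiv.Perm I) (β : I → ℤ) : Prop :=
  ∃ γ, IsSplit B σ γ ∧ β = γ + act σ γ

theorem isSum_equivariant {B : I → I → ℤ} (hw : ∀ x, w (act σ x) = act σ (w x))
    (hB : ∀ x, IsRealRoot B (w x) ↔ IsRealRoot B x) (x : I → ℤ) :
    IsSum B σ (w x) ↔ IsSum B σ x := by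
  constructor
  · rintro ⟨γ, hγ, h⟩
    obtain ⟨γ, rfl⟩ := w.surjective γ
    rw [isSplit_equivariant hw hB] at hγ
    rw [← hw, ← map_add, w.injective.eq_iff] at h
    exact ⟨γ, hγ, h⟩
  · rintro ⟨γ, hγ, rfl⟩
    exact ⟨w γ, (isSplit_equivariant hw hB γ).2 hγ, by rw [map_add, hw]⟩

theorem IsSum.act_eq {B : I → I → ℤ} {β : I → ℤ} (h : IsSum B σ β) : act σ β = β := by
  obtain ⟨γ, hγ, rfl⟩ := h
  rw [act_add, act_act_of_period_two hγ.2.1, add_comm]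

theorem IsSplit.orb_eq {B : I → I → ℤ} {β : I → ℤ} (h : IsSplit B σ β) :
    orb B σ β = (2 : ℤ) • (β + act σ β) := if_pos h

theorem IsSplit.act_ne {B : I → I → ℤ} {β : I → ℤ} (h : IsSplit B σ β) : act σ β ≠ β := by
  intro hβ
  have := h.2.1
  rw [Function.minimalPeriod_eq_one_iff_isFixedPt.2 hβ] at this
  omega

theorem IsSum.orb_eq {B : I → I → ℤ} {β : I → ℤ} (h : IsSum B σ β) :
    orb B σ β = (2 : ℤ) • β := by
  rw [orb, if_neg fun hs => hs.act_ne h.act_eq]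
  exact if_pos h

theorem orb_eq_orbitSum {B : I → I → ℤ} {β : I → ℤ} (h1 : ¬ IsSplit B σ β)
    (h2 : ¬ IsSum B σ β) : orb B σ β = orbitSum σ β := by
  rw [orb, if_neg h1]
  exact if_neg h2

/-- Split roots, sums of split pairs, periods and orbit sums are all transported by w. It is applied
to reflections along orbits, to negation and to σ. -/
theorem orb_equivariant {B : I → I → ℤ} (hw : ∀ x, w (act σ x) = act σ (w x))
    (hB : ∀ x, IsRealRoot B (w x) ↔ IsRealRoot B x) (x : I → ℤ) :
    orb B σ (w x) = w (orb B σ x) := by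
  have h1 := isSplit_equivariant hw hB x
  have h2 := isSum_equivariant hw hB x
  by_cases hs : IsSplit B σ x
  · rw [(h1.2 hs).orb_eq, hs.orb_eq, map_zsmul, map_add, hw]
  · by_cases ht : IsSum B σ x
    · rw [(h2.2 ht).orb_eq, ht.orb_eq, map_zsmul]
    · rw [orb_eq_orbitSum (fun h => hs (h1.1 h)) (fun h => ht (h2.1 h)), orb_eq_orbitSum hs ht,
        orbitSum_equivariant hw]

theorem IsSplit.isSum {B : I → I → ℤ} {β : I → ℤ} (h : IsSplit B σ β) :
    IsSum B σ (β + act σ β) := ⟨β, h, rfl⟩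

theorem orb_sum_eq {B : I → I → ℤ} {β : I → ℤ} (h : IsSplit B σ β) :
    orb B σ (β + act σ β) = orb B σ β := by
  rw [h.isSum.orb_eq, h.orb_eq]

theorem act_orb (B : I → I → ℤ) (x : I → ℤ) : act σ (orb B σ x) = orb B σ x := by
  obtain ⟨c, -, h⟩ := exists_orb_eq B σ x
  rw [h, act_smul, act_orbitSum]

theorem orb_nonneg (B : I → I → ℤ) {x : I → ℤ} (h : 0 ≤ x) : 0 ≤ orb B σ x := by
  obtain ⟨c, hc, h1⟩ := exists_orb_eq B σ x
  rw [h1]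
  exact smul_nonneg hc.le (orbitSum_nonneg h)

end Orbit

/-! ### Reflections along orthogonal orbits -/

/-- The `σ`-orbit of `θ` consists of pairwise orthogonal vectors of norm `2`. -/
def IsOrthOrbit {I : Type} [Fintype I] (B : I → I → ℤ) (σ : Equiv.Perm I) (θ : I → ℤ) : Prop :=
  pairing B θ θ = 2 ∧ ∀ k, 0 < k → k < Function.minimalPeriod (act σ) θ →
    pairing B θ ((act σ)^[k] θ) = 0

/-- The product of the reflections along the elements of the `σ`-orbit of `θ`. -/
noncomputable def orbitRefl {I : Type} [Fintype I] (B : I → I → ℤ) (σ : Equiv.Perm I)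
    (θ x : I → ℤ) : I → ℤ :=
  x - ∑ k ∈ Finset.range (Function.minimalPeriod (act σ) θ),
    pairing B x ((act σ)^[k] θ) • (act σ)^[k] θ

/-- The positive root attached to the orbit of a vertex: the simple root, or the sum of the two
simple roots if the orbit is not orthogonal. -/
noncomputable def orbitRoot {I : Type} [DecidableEq I] (B : I → I → ℤ) (σ : Equiv.Perm I)
    (i : I) : I → ℤ :=
  if B i (σ i) = -1 then simpleRoot i + simpleRoot (σ i) else simpleRoot i

namespace IsFoldable

variable {I : Type} [Fintype I] [DecidableEq I]
  {B : I → I → ℤ} {δ : I → ℤ} {σ : Equiv.Perm I} {o : I}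

theorem pairing_iterate_act (h : IsFoldable B δ σ o) (x y : I → ℤ) (k : ℕ) :
    pairing B ((act σ)^[k] x) ((act σ)^[k] y) = pairing B x y := by
  induction k with
  | zero => rfl
  | succ k ih => rw [Function.iterate_succ_apply', Function.iterate_succ_apply', h.pairing_act, ih]

theorem pairing_orbit (h : IsFoldable B δ σ o) {θ : I → ℤ} (hθ : IsOrthOrbit B σ θ) {j k : ℕ}
    (hj : j < Function.minimalPeriod (act σ) θ) (hk : k < Function.minimalPeriod (act σ) θ) :
    pairing B ((act σ)^[j] θ) ((act σ)^[k] θ) = if j = k then 2 else 0 := by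
  wlog hjk : j ≤ k generalizing j k
  · rw [h.comm, this hk hj (by omega)]
    simp only [eq_comm]
  obtain ⟨d, rfl⟩ := Nat.exists_eq_add_of_le hjk
  rw [Function.iterate_add_apply, h.pairing_iterate_act]
  rcases Nat.eq_zero_or_pos d with rfl | hd
  · simpa using hθ.1
  · rw [hθ.2 d hd (by omega), if_neg (by omega)]

theorem orbitRefl_add (_ : IsFoldable B δ σ o) (θ x y : I → ℤ) :
    orbitRefl B σ θ (x + y) = orbitRefl B σ θ x + orbitRefl B σ θ y := by
  simp only [orbitRefl, pairing_add_left, add_smul, Finset.sum_add_distrib]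
  abel

theorem pairing_orbitRefl_orbit (h : IsFoldable B δ σ o) {θ : I → ℤ} (hθ : IsOrthOrbit B σ θ)
    (x : I → ℤ) {j : ℕ} (hj : j < Function.minimalPeriod (act σ) θ) :
    pairing B (orbitRefl B σ θ x) ((act σ)^[j] θ) = -pairing B x ((act σ)^[j] θ) := by
  rw [orbitRefl, pairing_sub_left, pairing_sum_left, Finset.sum_eq_single j]
  · rw [pairing_smul_left, h.pairing_orbit hθ hj hj, if_pos rfl]; ring
  · intro k hk hkj
    rw [pairing_smul_left, h.pairing_orbit hθ (Finset.mem_range.1 hk) hj, if_neg hkj, mul_zero]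
  · intro hj'; exact absurd (Finset.mem_range.2 hj) hj'

theorem orbitRefl_orbitRefl (h : IsFoldable B δ σ o) {θ : I → ℤ} (hθ : IsOrthOrbit B σ θ)
    (x : I → ℤ) : orbitRefl B σ θ (orbitRefl B σ θ x) = x := by
  have h1 : ∑ k ∈ Finset.range (Function.minimalPeriod (act σ) θ),
      pairing B (orbitRefl B σ θ x) ((act σ)^[k] θ) • (act σ)^[k] θ =
      -∑ k ∈ Finset.range (Function.minimalPeriod (act σ) θ),
      pairing B x ((act σ)^[k] θ) • (act σ)^[k] θ := by
    rw [← Finset.sum_neg_distrib]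
    refine Finset.sum_congr rfl fun k hk => ?_
    rw [h.pairing_orbitRefl_orbit hθ x (Finset.mem_range.1 hk), neg_smul]
  rw [orbitRefl, h1, orbitRefl]
  abel

theorem pairing_orbitRefl (h : IsFoldable B δ σ o) {θ : I → ℤ} (hθ : IsOrthOrbit B σ θ)
    (x y : I → ℤ) :
    pairing B (orbitRefl B σ θ x) (orbitRefl B σ θ y) = pairing B x y := by
  conv_lhs => arg 3; rw [orbitRefl]
  rw [pairing_sub_right, pairing_sum_right]
  conv_lhs => lhs; rw [orbitRefl, pairing_sub_left, pairing_sum_left]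
  rw [sub_sub, ← Finset.sum_add_distrib, Finset.sum_eq_zero, sub_zero]
  intro k hk
  rw [pairing_smul_left, pairing_smul_right,
    h.pairing_orbitRefl_orbit hθ x (Finset.mem_range.1 hk), h.comm _ y]
  ring

theorem orbitRefl_act (h : IsFoldable B δ σ o) (θ x : I → ℤ) :
    orbitRefl B σ θ (act σ x) = act σ (orbitRefl B σ θ x) := by
  rw [orbitRefl, orbitRefl, act_sub, act_sum,
    ← sum_orbit_act (fun y => pairing B (act σ x) y • y) θ]
  simp only [act_smul, h.pairing_act]

/-- The reflection along an orthogonal orbit as an automorphism of the lattice. -/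
noncomputable def reflEquiv (h : IsFoldable B δ σ o) {θ : I → ℤ} (hθ : IsOrthOrbit B σ θ) :
    (I → ℤ) ≃+ (I → ℤ) where
  toFun := orbitRefl B σ θ
  invFun := orbitRefl B σ θ
  left_inv := h.orbitRefl_orbitRefl hθ
  right_inv := h.orbitRefl_orbitRefl hθ
  map_add' := h.orbitRefl_add θ

/-- Preservation of the norm is enough, so the product of reflections never has to be written in
terms of simple reflections. -/
theorem isRealRoot_orbitRefl (h : IsFoldable B δ σ o) {θ : I → ℤ} (hθ : IsOrthOrbit B σ θ)
    (x : I → ℤ) : IsRealRoot B (orbitRefl B σ θ x) ↔ IsRealRoot B x := by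
  rw [h.isRealRoot_iff, h.isRealRoot_iff, h.pairing_orbitRefl hθ]

theorem orbitSum_orbitRefl (h : IsFoldable B δ σ o) {θ : I → ℤ} (hθ : IsOrthOrbit B σ θ)
    (x : I → ℤ) : orbitSum σ (orbitRefl B σ θ x) = orbitRefl B σ θ (orbitSum σ x) :=
  orbitSum_equivariant (w := h.reflEquiv hθ) (h.orbitRefl_act θ) x

theorem minimalPeriod_orbitRefl (h : IsFoldable B δ σ o) {θ : I → ℤ} (hθ : IsOrthOrbit B σ θ)
    (x : I → ℤ) : Function.minimalPeriod (act σ) (orbitRefl B σ θ x) =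
      Function.minimalPeriod (act σ) x :=
  minimalPeriod_equivariant (w := h.reflEquiv hθ) (h.orbitRefl_act θ) x

theorem isSplit_orbitRefl (h : IsFoldable B δ σ o) {θ : I → ℤ} (hθ : IsOrthOrbit B σ θ)
    (x : I → ℤ) : IsSplit B σ (orbitRefl B σ θ x) ↔ IsSplit B σ x :=
  isSplit_equivariant (w := h.reflEquiv hθ) (h.orbitRefl_act θ) (h.isRealRoot_orbitRefl hθ) x

theorem isSum_orbitRefl (h : IsFoldable B δ σ o) {θ : I → ℤ} (hθ : IsOrthOrbit B σ θ)
    (x : I → ℤ) : IsSum B σ (orbitRefl B σ θ x) ↔ IsSum B σ x :=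
  isSum_equivariant (w := h.reflEquiv hθ) (h.orbitRefl_act θ) (h.isRealRoot_orbitRefl hθ) x

theorem orb_orbitRefl (h : IsFoldable B δ σ o) {θ : I → ℤ} (hθ : IsOrthOrbit B σ θ)
    (x : I → ℤ) : orb B σ (orbitRefl B σ θ x) = orbitRefl B σ θ (orb B σ x) :=
  orb_equivariant (w := h.reflEquiv hθ) (h.orbitRefl_act θ) (h.isRealRoot_orbitRefl hθ) x

theorem isRealRoot_neg_iff (_ : IsFoldable B δ σ o) (x : I → ℤ) :
    IsRealRoot B (-x) ↔ IsRealRoot B x :=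
  ⟨fun hx => by simpa using hx.neg, IsRealRoot.neg⟩

theorem isRealRoot_act_iff (h : IsFoldable B δ σ o) (x : I → ℤ) :
    IsRealRoot B (act σ x) ↔ IsRealRoot B x := by
  rw [h.isRealRoot_iff, h.isRealRoot_iff, h.pairing_act]

theorem orbitSum_neg (x : I → ℤ) : orbitSum σ (-x) = -orbitSum σ x :=
  orbitSum_equivariant (w := AddEquiv.neg (I → ℤ)) (act_neg σ) x

theorem minimalPeriod_neg (x : I → ℤ) :
    Function.minimalPeriod (act σ) (-x) = Function.minimalPeriod (act σ) x :=
  minimalPeriod_equivariant (w := AddEquiv.neg (I → ℤ)) (act_neg σ) x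

theorem isSplit_neg (h : IsFoldable B δ σ o) (x : I → ℤ) :
    IsSplit B σ (-x) ↔ IsSplit B σ x :=
  isSplit_equivariant (w := AddEquiv.neg (I → ℤ)) (act_neg σ) h.isRealRoot_neg_iff x

theorem isSum_neg (h : IsFoldable B δ σ o) (x : I → ℤ) : IsSum B σ (-x) ↔ IsSum B σ x :=
  isSum_equivariant (w := AddEquiv.neg (I → ℤ)) (act_neg σ) h.isRealRoot_neg_iff x

theorem orb_neg (h : IsFoldable B δ σ o) (x : I → ℤ) : orb B σ (-x) = -orb B σ x :=
  orb_equivariant (w := AddEquiv.neg (I → ℤ)) (act_neg σ) h.isRealRoot_neg_iff x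

/-- The diagram automorphism as an automorphism of the lattice. -/
noncomputable def actEquiv (σ : Equiv.Perm I) : (I → ℤ) ≃+ (I → ℤ) :=
  AddEquiv.ofBijective (⟨⟨act σ, act_zero σ⟩, act_add σ⟩ : (I → ℤ) →+ (I → ℤ))
    ⟨act_injective σ, fun x => ⟨act σ.symm x, by funext i; simp [act]⟩⟩

theorem orb_act (h : IsFoldable B δ σ o) (x : I → ℤ) : orb B σ (act σ x) = orb B σ x := by
  have := orb_equivariant (σ := σ) (w := actEquiv σ) (fun _ => rfl) h.isRealRoot_act_iff x
  exact this.trans (act_orb B x)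

theorem orb_iterate_act (h : IsFoldable B δ σ o) (x : I → ℤ) (k : ℕ) :
    orb B σ ((act σ)^[k] x) = orb B σ x := by
  induction k with
  | zero => rfl
  | succ k ih => rw [Function.iterate_succ_apply', h.orb_act, ih]

/-- A fixed vector pairs equally with all elements of an orbit, so the reflections combine into one
along the orbit sum. -/
theorem orbitRefl_of_act_eq (h : IsFoldable B δ σ o) (θ : I → ℤ) {v : I → ℤ} (hv : act σ v = v) :
    orbitRefl B σ θ v = v - pairing B v θ • orbitSum σ θ := by
  rw [orbitRefl, orbitSum, Finset.smul_sum]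
  congr 1
  refine Finset.sum_congr rfl fun k _ => ?_
  have : (act σ)^[k] v = v := Function.iterate_fixed hv k
  conv_lhs => rw [← this, h.pairing_iterate_act]

theorem pairing_orbitSum_of_act_eq (h : IsFoldable B δ σ o) (x : I → ℤ) {v : I → ℤ}
    (hv : act σ v = v) :
    pairing B v (orbitSum σ x) = Function.minimalPeriod (act σ) x * pairing B v x := by
  rw [orbitSum, pairing_sum_right]
  rw [Finset.sum_congr rfl (g := fun _ => pairing B v x)]
  · simp
  · intro k _
    have : (act σ)^[k] v = v := Function.iterate_fixed hv k
    conv_lhs => rw [← this, h.pairing_iterate_act]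

/-! ### Translation by the null root -/

theorem act_add_delta (h : IsFoldable B δ σ o) (x : I → ℤ) (a : ℤ) :
    act σ (x + a • δ) = act σ x + a • δ := by
  rw [act_add, act_smul, h.act_delta]

theorem iterate_act_add_delta (h : IsFoldable B δ σ o) (x : I → ℤ) (a : ℤ) (k : ℕ) :
    (act σ)^[k] (x + a • δ) = (act σ)^[k] x + a • δ := by
  rw [iterate_act_add]
  congr 1
  refine Function.iterate_fixed ?_ k
  rw [act_smul, h.act_delta]

theorem minimalPeriod_add_delta (h : IsFoldable B δ σ o) (x : I → ℤ) (a : ℤ) :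
    Function.minimalPeriod (act σ) (x + a • δ) = Function.minimalPeriod (act σ) x := by
  rw [Function.minimalPeriod_eq_minimalPeriod_iff]
  intro n
  simp only [Function.IsPeriodicPt, Function.IsFixedPt, h.iterate_act_add_delta]
  exact add_left_inj _

theorem orbitSum_add_delta (h : IsFoldable B δ σ o) (x : I → ℤ) (a : ℤ) :
    orbitSum σ (x + a • δ) = orbitSum σ x + (Function.minimalPeriod (act σ) x * a) • δ := by
  unfold orbitSum
  simp only [h.minimalPeriod_add_delta, h.iterate_act_add_delta, Finset.sum_add_distrib]
  simp [mul_smul]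

theorem isRealRoot_add_delta (h : IsFoldable B δ σ o) (x : I → ℤ) (a : ℤ) :
    IsRealRoot B (x + a • δ) ↔ IsRealRoot B x := by
  rw [h.isRealRoot_iff, h.isRealRoot_iff, pairing_add_left, pairing_add_right,
    pairing_smul_right, h.pairing_delta_right, pairing_smul_left, h.pairing_delta_left]
  simp

theorem isSplit_add_delta (h : IsFoldable B δ σ o) (x : I → ℤ) (a : ℤ) :
    IsSplit B σ (x + a • δ) ↔ IsSplit B σ x := by
  unfold IsSplit
  have : x + a • δ + act σ (x + a • δ) = x + act σ x + (2 * a) • δ := by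
    rw [h.act_add_delta, two_mul, add_smul]; abel
  rw [this, h.isRealRoot_add_delta, h.isRealRoot_add_delta, h.minimalPeriod_add_delta]

/-! ### Simple roots -/

theorem act_simpleRoot_pair {i : I} (h2 : σ (σ i) = i) :
    act σ (simpleRoot i + simpleRoot (σ i)) = simpleRoot i + simpleRoot (σ i) := by
  rw [act_add, act_simpleRoot, act_simpleRoot, h2, add_comm]

theorem sigma_ne (h : IsFoldable B δ σ o) {i : I} (hi : B i (σ i) = -1) : σ i ≠ i := by
  intro h1
  rw [h1, h.diag] at hi
  omega

theorem sigma_sigma (h : IsFoldable B δ σ o) {i : I} (hi : B i (σ i) = -1) : σ (σ i) = i := by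
  rcases h.dich i with h1 | h1
  · have := h1 (σ i) ⟨1, by simp⟩ (h.sigma_ne hi).symm
    omega
  · exact h1.1

theorem orthogonal_of_ne (h : IsFoldable B δ σ o) {i : I} (hi : B i (σ i) ≠ -1) (j : I)
    (hj : σ.SameCycle i j) (hij : i ≠ j) : B i j = 0 := by
  rcases h.dich i with h1 | h1
  · exact h1 j hj hij
  · exact absurd h1.2 hi

theorem sameCycle_pair {i j : I} (h2 : σ (σ i) = i) (hj : σ.SameCycle i j) : j = i ∨ j = σ i := by
  obtain ⟨n, rfl⟩ := hj.exists_nat_pow_eq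
  induction n with
  | zero => simp
  | succ n ih =>
    rw [pow_succ', Equiv.Perm.mul_apply]
    rcases ih ⟨n, by simp⟩ with h | h <;> rw [h]
    · exact Or.inr rfl
    · exact Or.inl h2

theorem form_sigma_of_sameCycle (h : IsFoldable B δ σ o) {i j : I} (hij : σ.SameCycle i j) :
    B j (σ j) = B i (σ i) := by
  obtain ⟨n, rfl⟩ := hij.exists_nat_pow_eq
  clear hij
  induction n with
  | zero => rfl
  | succ n ih => rw [pow_succ', Equiv.Perm.mul_apply, h.inv, ih]

/-- The norm of α_i + σ α_i is 4 + 2 B i (σ i), which equals 2 exactly when the two vertices are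
adjacent; a fixed vertex would give 8. -/
theorem isSplit_simpleRoot_iff (h : IsFoldable B δ σ o) (i : I) :
    IsSplit B σ (simpleRoot i) ↔ B i (σ i) = -1 := by
  have key : pairing B (simpleRoot i + act σ (simpleRoot i))
      (simpleRoot i + act σ (simpleRoot i)) = 4 + 2 * B i (σ i) := by
    rw [act_simpleRoot]
    simp only [pairing_add_left, pairing_add_right, pairing_simpleRoot_simpleRoot, h.diag,
      h.symm (σ i) i]
    ring
  constructor
  · rintro ⟨-, -, h3⟩
    rw [h.isRealRoot_iff, key] at h3
    omega
  · intro hi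
    refine ⟨.simple i, ?_, by rw [h.isRealRoot_iff, key]; omega⟩
    refine Function.minimalPeriod_eq_prime ?_ ?_
    · change act σ (act σ (simpleRoot i)) = simpleRoot i
      rw [act_simpleRoot, act_simpleRoot, h.sigma_sigma hi]
    · change ¬ act σ (simpleRoot i) = simpleRoot i
      rw [act_simpleRoot]
      intro h1
      have := congrFun h1 i
      simp [simpleRoot, (h.sigma_ne hi).symm] at this

/-- A vector γ + σ γ has even height, while a simple root has height 1. -/
theorem not_isSum_simpleRoot (i : I) : ¬ IsSum B σ (simpleRoot i) := by
  rintro ⟨γ, -, h⟩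
  have h1 : ∑ j, simpleRoot i j = ∑ j, (γ + act σ γ) j := by rw [h]
  simp only [Pi.add_apply, Finset.sum_add_distrib, sum_act] at h1
  simp [simpleRoot] at h1
  omega

theorem orb_simpleRoot_of_eq (h : IsFoldable B δ σ o) {i : I} (hi : B i (σ i) = -1) :
    orb B σ (simpleRoot i) = (2 : ℤ) • (simpleRoot i + simpleRoot (σ i)) := by
  rw [((h.isSplit_simpleRoot_iff i).2 hi).orb_eq, act_simpleRoot]

theorem orb_simpleRoot_of_ne (h : IsFoldable B δ σ o) {i : I} (hi : B i (σ i) ≠ -1) :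
    orb B σ (simpleRoot i) = orbitSum σ (simpleRoot i) :=
  orb_eq_orbitSum (fun h1 => hi ((h.isSplit_simpleRoot_iff i).1 h1)) (not_isSum_simpleRoot i)

theorem isOrthOrbit_simpleRoot (h : IsFoldable B δ σ o) {i : I} (hi : B i (σ i) ≠ -1) :
    IsOrthOrbit B σ (simpleRoot i) := by
  refine ⟨by rw [pairing_simpleRoot_simpleRoot, h.diag], fun k hk hkp => ?_⟩
  rw [iterate_act_simpleRoot, pairing_simpleRoot_simpleRoot]
  refine h.orthogonal_of_ne hi _ ⟨k, by simp⟩ fun he => ?_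
  refine Function.not_isPeriodicPt_of_pos_of_lt_minimalPeriod hk.ne' hkp ?_
  rw [Function.IsPeriodicPt, Function.IsFixedPt, iterate_act_simpleRoot, ← he]

theorem isOrthOrbit_of_act_eq {θ : I → ℤ} (hθ : act σ θ = θ) (h2 : pairing B θ θ = 2) :
    IsOrthOrbit B σ θ := by
  refine ⟨h2, fun k hk hkp => ?_⟩
  rw [Function.minimalPeriod_eq_one_iff_isFixedPt.2 hθ] at hkp
  omega

theorem isRealRoot_simpleRoot_pair (h : IsFoldable B δ σ o) {i : I} (hi : B i (σ i) = -1) :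
    IsRealRoot B (simpleRoot i + simpleRoot (σ i)) := by
  have := ((h.isSplit_simpleRoot_iff i).2 hi).2.2
  rwa [act_simpleRoot] at this

theorem isOrthOrbit_orbitRoot (h : IsFoldable B δ σ o) (i : I) :
    IsOrthOrbit B σ (orbitRoot B σ i) := by
  unfold orbitRoot
  split_ifs with hi
  · exact isOrthOrbit_of_act_eq (act_simpleRoot_pair (h.sigma_sigma hi))
      (h.pairing_self_of_isRealRoot (h.isRealRoot_simpleRoot_pair hi))
  · exact h.isOrthOrbit_simpleRoot hi

theorem exists_orb_simpleRoot (h : IsFoldable B δ σ o) (i : I) :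
    ∃ c : ℤ, 0 < c ∧ orb B σ (simpleRoot i) = c • orbitSum σ (orbitRoot B σ i) := by
  unfold orbitRoot
  split_ifs with hi
  · exact ⟨2, by norm_num, by
      rw [h.orb_simpleRoot_of_eq hi, orbitSum_of_act_eq (act_simpleRoot_pair (h.sigma_sigma hi))]⟩
  · exact ⟨1, one_pos, by rw [h.orb_simpleRoot_of_ne hi, one_smul]⟩

theorem orbitRoot_nonneg (i : I) : 0 ≤ orbitRoot B σ i := by
  have h1 : ∀ j : I, (0 : I → ℤ) ≤ simpleRoot j := fun j => Pi.single_nonneg.2 zero_le_one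
  unfold orbitRoot
  split_ifs
  · exact add_nonneg (h1 _) (h1 _)
  · exact h1 _

theorem orbitRoot_apply_of_not_sameCycle {i j : I} (hj : ¬ σ.SameCycle i j) :
    orbitRoot B σ i j = 0 := by
  have h1 : j ≠ i := by rintro rfl; exact hj (Equiv.Perm.SameCycle.refl _ _)
  have h2 : j ≠ σ i := by rintro rfl; exact hj ⟨1, by simp⟩
  unfold orbitRoot
  split_ifs <;> simp [simpleRoot, h1, h2]

theorem iterate_act_orbitRoot_apply {i j : I} (hj : ¬ σ.SameCycle i j) (k : ℕ) :
    (act σ)^[k] (orbitRoot B σ i) j = 0 := by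
  rw [iterate_act]
  refine orbitRoot_apply_of_not_sameCycle fun h => hj (h.trans ⟨k, ?_⟩)
  simp

theorem orbitRefl_orbitRoot_apply {i j : I} (hj : ¬ σ.SameCycle i j) (x : I → ℤ) :
    orbitRefl B σ (orbitRoot B σ i) x j = x j := by
  rw [orbitRefl, Pi.sub_apply, Finset.sum_apply, Finset.sum_eq_zero, sub_zero]
  intro k _
  rw [Pi.smul_apply, iterate_act_orbitRoot_apply hj, smul_zero]

/-! ### Descent of real roots by reflections along vertex orbits. -/

theorem pairing_orbitRoot_pos (h : IsFoldable B δ σ o) {v : I → ℤ} (hv : act σ v = v) {i : I}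
    (hi : 0 < pairing B v (simpleRoot i)) : 0 < pairing B v (orbitRoot B σ i) := by
  unfold orbitRoot
  split_ifs
  · have : pairing B v (simpleRoot (σ i)) = pairing B v (simpleRoot i) := by
      rw [← act_simpleRoot]
      conv_lhs => rw [← hv]
      rw [h.pairing_act]
    rw [pairing_add_right, this]
    omega
  · exact hi

theorem sum_orbitRefl (θ x : I → ℤ) :
    ∑ i, orbitRefl B σ θ x i = ∑ i, x i - pairing B x (orbitSum σ θ) * ∑ i, θ i := by
  simp only [orbitRefl, Pi.sub_apply, Finset.sum_apply, Finset.sum_sub_distrib, Pi.smul_apply,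
    smul_eq_mul]
  rw [Finset.sum_comm, orbitSum, pairing_sum_right, Finset.sum_mul]
  congr 1
  refine Finset.sum_congr rfl fun k _ => ?_
  rw [← Finset.mul_sum, sum_iterate_act]

/-- For a pair of adjacent vertices this is the list of positive roots of A_2. For an orthogonal
orbit, (β, α_j) = 2 β_j, so the norm of β - α_j is 4 - 4 β_j; nonnegativity forces it to vanish, and
β - α_j is a multiple of δ that vanishes at a vertex outside the orbit. -/
theorem eq_of_supported (h : IsFoldable B δ σ o) {β : I → ℤ} (hβ : IsRealRoot B β) (h0 : 0 ≤ β)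
    {i : I} (hs : ∀ j, ¬ σ.SameCycle i j → β j = 0) :
    (∃ j, σ.SameCycle i j ∧ β = simpleRoot j) ∨
      (B i (σ i) = -1 ∧ β = simpleRoot i + simpleRoot (σ i)) := by
  have h2 := h.pairing_self_of_isRealRoot hβ
  by_cases hi : B i (σ i) = -1
  · have hne := h.sigma_ne hi
    have hβ' : β = β i • simpleRoot i + β (σ i) • simpleRoot (σ i) := by
      funext j
      by_cases hj : σ.SameCycle i j
      · rcases sameCycle_pair (h.sigma_sigma hi) hj with rfl | rfl
        · simp [simpleRoot, hne.symm]
        · simp [simpleRoot, hne]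
      · have h1 : j ≠ i := by rintro rfl; exact hj (Equiv.Perm.SameCycle.refl _ _)
        have h2 : j ≠ σ i := by rintro rfl; exact hj ⟨1, by simp⟩
        simp [simpleRoot, h1, h2, hs j hj]
    have hx : 0 ≤ β i := h0 i
    have hy : 0 ≤ β (σ i) := h0 (σ i)
    generalize β i = x at hβ' hx
    generalize β (σ i) = y at hβ' hy
    subst hβ'
    simp only [pairing_add_left, pairing_add_right, pairing_smul_left, pairing_smul_right,
      pairing_simpleRoot_simpleRoot, h.diag, h.symm (σ i) i, hi] at h2
    have hx1 : x ≤ 1 := by nlinarith [sq_nonneg (2 * y - x)]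
    have hy1 : y ≤ 1 := by nlinarith [sq_nonneg (2 * x - y)]
    interval_cases x <;> interval_cases y
    · omega
    · exact Or.inl ⟨σ i, ⟨1, by simp⟩, by simp⟩
    · exact Or.inl ⟨i, Equiv.Perm.SameCycle.refl _ _, by simp⟩
    · exact Or.inr ⟨hi, by simp⟩
  · left
    have hex : ∃ j, 0 < β j := by
      by_contra hne
      push Not at hne
      have : β = 0 := le_antisymm hne h0
      rw [this, pairing_zero_left] at h2
      omega
    obtain ⟨j, hj⟩ := hex
    have hij : σ.SameCycle i j := by
      by_contra hne
      rw [hs j hne] at hj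
      omega
    have hp : pairing B β (simpleRoot j) = 2 * β j := by
      rw [pairing_simpleRoot_right, Finset.sum_eq_single j, h.diag, mul_comm]
      · intro l _ hl
        by_cases hil : σ.SameCycle i l
        · have hj' : B j (σ j) ≠ -1 := by rwa [h.form_sigma_of_sameCycle hij]
          rw [h.symm, h.orthogonal_of_ne hj' l (hij.symm.trans hil) hl.symm, mul_zero]
        · rw [hs l hil, zero_mul]
      · simp
    have hq : pairing B (β - simpleRoot j) (β - simpleRoot j) = 4 - 4 * β j := by
      rw [pairing_sub_left, pairing_sub_right, pairing_sub_right, h.comm (simpleRoot j) β, h2, hp,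
        pairing_simpleRoot_simpleRoot, h.diag]
      ring
    have hq0 := h.pairing_self_nonneg (β - simpleRoot j)
    have hq1 := h.eq_smul_delta (x := β - simpleRoot j) (by omega)
    obtain ⟨l, hl⟩ := h.proper i
    have hlj : l ≠ j := by rintro rfl; exact hl hij
    have hk := congrFun hq1 l
    simp only [Pi.sub_apply, hs l hl, simpleRoot, ne_eq, hlj, not_false_eq_true,
      Pi.single_eq_of_ne, sub_zero, Pi.smul_apply, smul_eq_mul] at hk
    have hk0 := (mul_eq_zero.1 hk.symm).resolve_right (h.pos l).ne'
    refine ⟨j, hij, sub_eq_zero.1 ?_⟩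
    rw [hq1, Pi.sub_apply, simpleRoot, hk0, zero_smul]

/-- Both sides equal the pairing of the two orbit sums. -/
theorem pairing_orbitSum_comm (h : IsFoldable B δ σ o) (x y : I → ℤ) :
    Function.minimalPeriod (act σ) x * pairing B x (orbitSum σ y) =
      Function.minimalPeriod (act σ) y * pairing B (orbitSum σ x) y := by
  rw [← h.pairing_orbitSum_of_act_eq y (act_orbitSum x), h.comm (orbitSum σ x),
    h.pairing_orbitSum_of_act_eq x (act_orbitSum y), h.comm x]

/-- The orbit sum of β is nonnegative of positive norm, hence pairs positively with some α_i, and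
the reflection along the orbit of i lowers the height of β. If positivity is lost, β is supported on
that orbit and `eq_of_supported` lists the possibilities. The norm of the orbit sum is invariant, so
the hypothesis survives the induction. -/
theorem descent_nonneg (h : IsFoldable B δ σ o) {J : I → Prop} (hJ : ∀ i, J i → J (σ i))
    {P : (I → ℤ) → Prop} (h1 : ∀ i, J i → P (simpleRoot i))
    (h2 : ∀ i, J i → B i (σ i) = -1 → P (simpleRoot i + simpleRoot (σ i)))
    (h3 : ∀ i, J i → ∀ β, IsRealRoot B β → P (orbitRefl B σ (orbitRoot B σ i) β) → P β) (N : ℕ) :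
    ∀ β, IsRealRoot B β → 0 ≤ β → (∀ i, ¬ J i → β i = 0) →
      pairing B (orbitSum σ β) (orbitSum σ β) ≠ 0 → ∑ i, β i ≤ N → P β := by
  have hJk : ∀ (i : I) (k : ℕ), J i → J ((σ ^ k) i) := by
    intro i k hi
    induction k with
    | zero => exact hi
    | succ k ih => rw [pow_succ']; exact hJ _ ih
  induction N using Nat.strong_induction_on with
  | _ N ih =>
  intro β hβ h0 hsupp hS hN
  obtain ⟨i, hi0, hi⟩ := exists_pairing_pos (B := B) (orbitSum_nonneg (σ := σ) h0)
    (lt_of_le_of_ne (h.pairing_self_nonneg _) hS.symm)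
  have hJi : J i := by
    by_contra hne
    rw [orbitSum, Finset.sum_apply, Finset.sum_eq_zero] at hi0
    · omega
    · intro k _
      rw [iterate_act]
      refine hsupp _ fun hk => hne ?_
      have := hJk _ k hk
      rwa [Equiv.apply_symm_apply] at this
  have hth := h.isOrthOrbit_orbitRoot i
  have h3i := h3 i hJi β hβ
  obtain ⟨θ, hθ⟩ : ∃ θ, θ = orbitRoot B σ i := ⟨_, rfl⟩
  rw [← hθ] at hth h3i
  -- Positivity is known for the orbit sum of β against θ; up to the periods, which are positive, it
  -- can be moved to β against the orbit sum of θ.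
  have hpos : 0 < pairing B β (orbitSum σ θ) := by
    have e := h.pairing_orbitSum_comm β θ
    have e1 := h.pairing_orbitRoot_pos (act_orbitSum β) hi
    have e2 : (0 : ℤ) < Function.minimalPeriod (act σ) θ := by
      exact_mod_cast minimalPeriod_act_pos θ
    have e3 : (0 : ℤ) < Function.minimalPeriod (act σ) β := by
      exact_mod_cast minimalPeriod_act_pos β
    have e4 := mul_pos e2 e1
    rw [← hθ, ← e] at e4
    exact pos_of_mul_pos_right e4 e3.le
  have hht : 0 < ∑ j, θ j := by
    have hn : 0 ≤ θ := hθ ▸ orbitRoot_nonneg i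
    refine lt_of_le_of_ne (Finset.sum_nonneg fun j _ => hn j) fun he => ?_
    have := (Finset.sum_eq_zero_iff_of_nonneg fun j _ => hn j).1 he.symm
    have hz : θ = 0 := funext fun j => this j (Finset.mem_univ _)
    have := hth.1
    rw [hz, pairing_zero_left] at this
    omega
  have hreal := (h.isRealRoot_orbitRefl hth β).2 hβ
  rcases h.nonneg_or_nonpos (h.pairing_self_of_isRealRoot hreal) with hn | hn
  · refine h3i ?_
    have hsum := sum_orbitRefl (B := B) (σ := σ) θ β
    have hn' : 0 ≤ ∑ j, orbitRefl B σ θ β j := Finset.sum_nonneg fun j _ => hn j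
    have := mul_pos hpos hht
    refine ih (∑ j, orbitRefl B σ θ β j).toNat (by omega) _ hreal hn (fun j hj => ?_) ?_ (by omega)
    · rw [hθ, orbitRefl_orbitRoot_apply, hsupp j hj]
      rintro hij
      obtain ⟨n, rfl⟩ := hij.exists_nat_pow_eq
      exact hj (hJk i n hJi)
    · rwa [h.orbitSum_orbitRefl hth, h.pairing_orbitRefl hth]
  -- Outside the orbit of i the reflection changes nothing, so those coordinates of β are of both
  -- signs.
  · have hs : ∀ j, ¬ σ.SameCycle i j → β j = 0 := by
      intro j hj
      have := hn j
      rw [hθ, orbitRefl_orbitRoot_apply hj] at this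
      exact le_antisymm this (h0 j)
    rcases h.eq_of_supported hβ h0 hs with ⟨j, hj, rfl⟩ | ⟨hi', rfl⟩
    · obtain ⟨n, rfl⟩ := hj.exists_nat_pow_eq
      exact h1 _ (hJk i n hJi)
    · exact h2 i hJi hi'

/-- Induction principle for real roots supported on a `σ`-stable set of vertices whose orbit sum is
not isotropic. -/
theorem descent (h : IsFoldable B δ σ o) {J : I → Prop} (hJ : ∀ i, J i → J (σ i))
    {P : (I → ℤ) → Prop} (h1 : ∀ i, J i → P (simpleRoot i))
    (h2 : ∀ i, J i → B i (σ i) = -1 → P (simpleRoot i + simpleRoot (σ i)))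
    (h3 : ∀ i, J i → ∀ β, IsRealRoot B β → P (orbitRefl B σ (orbitRoot B σ i) β) → P β)
    (h4 : ∀ β, IsRealRoot B β → P β → P (-β)) {β : I → ℤ} (hβ : IsRealRoot B β)
    (hsupp : ∀ i, ¬ J i → β i = 0) (hS : pairing B (orbitSum σ β) (orbitSum σ β) ≠ 0) : P β := by
  rcases h.nonneg_or_nonpos (h.pairing_self_of_isRealRoot hβ) with h0 | h0
  · exact h.descent_nonneg hJ h1 h2 h3 (∑ i, β i).toNat β hβ h0 hsupp hS (by omega)
  · have := h.descent_nonneg hJ h1 h2 h3 (∑ i, (-β) i).toNat (-β) hβ.neg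
      (neg_nonneg.2 h0) (fun i hi => by rw [Pi.neg_apply, hsupp i hi, neg_zero])
      (by rwa [orbitSum_neg, pairing_neg_left, pairing_neg_right, neg_neg]) (by omega)
    simpa using h4 _ hβ.neg this

end IsFoldable

end OrbitFolding

namespace OrbitFolding

set_option linter.unusedSectionVars false

/-! ### The folded lattice -/

section Fold

variable {I : Type} [Fintype I] [DecidableEq I] {σ : Equiv.Perm I}

theorem toOrbit_eq_iff {i j : I} : toOrbit σ i = toOrbit σ j ↔ σ.SameCycle i j :=
  @Quotient.eq I (Equiv.Perm.SameCycle.setoid σ) i j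

theorem exists_toOrbit_eq (η : Orbits σ) : ∃ i, toOrbit σ i = η :=
  Quotient.exists_rep η

theorem toOrbit_sigma (i : I) : toOrbit σ (σ i) = toOrbit σ i :=
  (toOrbit_eq_iff.2 ⟨1, by simp⟩ : toOrbit σ i = toOrbit σ (σ i)).symm

theorem simpleRoot_injective : Function.Injective (simpleRoot : I → I → ℤ) := by
  intro i j hij
  by_contra hne
  have := congrFun hij i
  simp [simpleRoot, hne] at this

theorem members_toOrbit (i : I) : members σ (toOrbit σ i) =
    (Finset.range (Function.minimalPeriod (act σ) (simpleRoot i))).image fun k => (σ ^ k) i := by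
  ext j
  simp only [members, Finset.mem_filter, Finset.mem_univ, true_and, Finset.mem_image,
    Finset.mem_range]
  constructor
  · intro hj
    obtain ⟨n, rfl⟩ := (toOrbit_eq_iff.1 hj.symm).exists_nat_pow_eq
    refine ⟨n % Function.minimalPeriod (act σ) (simpleRoot i),
      Nat.mod_lt _ (minimalPeriod_act_pos _), simpleRoot_injective ?_⟩
    rw [← iterate_act_simpleRoot, ← iterate_act_simpleRoot, Function.iterate_mod_minimalPeriod_eq]
  · rintro ⟨k, -, rfl⟩
    exact (toOrbit_eq_iff.2 ⟨k, by simp⟩ : toOrbit σ i = _).symm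

theorem injOn_pow_apply (i : I) : Set.InjOn (fun k => (σ ^ k) i)
    (Finset.range (Function.minimalPeriod (act σ) (simpleRoot i)) : Set ℕ) := by
  intro a ha b hb hab
  refine Function.iterate_injOn_Iio_minimalPeriod (f := act σ) (x := simpleRoot i)
    (by simpa using ha) (by simpa using hb) ?_
  simp only [iterate_act_simpleRoot]
  exact congrArg simpleRoot hab

theorem orbitSum_simpleRoot (i : I) :
    orbitSum σ (simpleRoot i) = ∑ j ∈ members σ (toOrbit σ i), simpleRoot j := by
  rw [members_toOrbit, Finset.sum_image (injOn_pow_apply i), orbitSum]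
  simp only [iterate_act_simpleRoot]

theorem card_members (i : I) : (members σ (toOrbit σ i)).card =
    Function.minimalPeriod (act σ) (simpleRoot i) := by
  rw [members_toOrbit, Finset.card_image_of_injOn (injOn_pow_apply i), Finset.card_range]

theorem emb_add (B : I → I → ℤ) (x y : Orbits σ → ℤ) :
    emb B σ (x + y) = emb B σ x + emb B σ y := by
  simp only [emb, Pi.add_apply, add_smul, Finset.sum_add_distrib]

theorem emb_sub (B : I → I → ℤ) (x y : Orbits σ → ℤ) :
    emb B σ (x - y) = emb B σ x - emb B σ y := by
  simp only [emb, Pi.sub_apply, sub_smul, Finset.sum_sub_distrib]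

theorem emb_neg (B : I → I → ℤ) (x : Orbits σ → ℤ) : emb B σ (-x) = -emb B σ x := by
  simp only [emb, Pi.neg_apply, neg_smul, Finset.sum_neg_distrib]

theorem emb_smul (B : I → I → ℤ) (k : ℤ) (x : Orbits σ → ℤ) :
    emb B σ (k • x) = k • emb B σ x := by
  simp only [emb, Pi.smul_apply, smul_eq_mul, mul_smul, Finset.smul_sum]

theorem emb_zero (B : I → I → ℤ) : emb B σ 0 = 0 := by simp [emb]

theorem emb_simpleRoot (B : I → I → ℤ) (i : I) :
    emb B σ (simpleRoot (toOrbit σ i)) = orb B σ (simpleRoot i) := by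
  rw [← orb_simpleRoot_eq, emb, Finset.sum_eq_single (toOrbit σ i)]
  · simp [simpleRoot]
  · intro η _ hη; simp [simpleRoot, hη]
  · simp

theorem act_emb (B : I → I → ℤ) (x : Orbits σ → ℤ) : act σ (emb B σ x) = emb B σ x := by
  rw [emb, act_sum]
  refine Finset.sum_congr rfl fun η _ => ?_
  rw [act_smul, tildeRoot, act_orb]

theorem orb_simpleRoot_apply_pos (B : I → I → ℤ) {i j : I} (hij : σ.SameCycle i j) :
    0 < orb B σ (simpleRoot i) j := by
  obtain ⟨c, hc, h⟩ := exists_orb_eq B σ (simpleRoot i)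
  rw [h]
  exact mul_pos hc ((orbitSum_simpleRoot_apply σ i j).1 hij)

theorem orb_simpleRoot_apply_eq_zero (B : I → I → ℤ) {i j : I} (hij : ¬ σ.SameCycle i j) :
    orb B σ (simpleRoot i) j = 0 := by
  obtain ⟨c, hc, h⟩ := exists_orb_eq B σ (simpleRoot i)
  rw [h, Pi.smul_apply, (orbitSum_simpleRoot_apply σ i j).2 hij, smul_zero]

theorem emb_apply (B : I → I → ℤ) (x : Orbits σ → ℤ) (j : I) :
    emb B σ x j = x (toOrbit σ j) * orb B σ (simpleRoot j) j := by
  rw [emb, Finset.sum_apply, Finset.sum_eq_single (toOrbit σ j), orb_simpleRoot_eq]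
  · rfl
  · intro η _ hη
    obtain ⟨i, rfl⟩ := exists_toOrbit_eq η
    rw [orb_simpleRoot_eq, Pi.smul_apply, orb_simpleRoot_apply_eq_zero, smul_zero]
    exact fun h => hη (toOrbit_eq_iff.2 h)
  · simp

/-- Each coordinate of the image is a coordinate of x times a positive number, since distinct orbits
have disjoint supports. -/
theorem emb_nonneg_iff (B : I → I → ℤ) (x : Orbits σ → ℤ) : 0 ≤ emb B σ x ↔ 0 ≤ x := by
  constructor
  · intro h η
    obtain ⟨i, rfl⟩ := exists_toOrbit_eq η
    have h1 := h i
    rw [emb_apply] at h1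
    exact nonneg_of_mul_nonneg_left h1
      (orb_simpleRoot_apply_pos B (Equiv.Perm.SameCycle.refl σ i))
  · intro h i
    rw [emb_apply]
    exact mul_nonneg (h _) (orb_simpleRoot_apply_pos B (Equiv.Perm.SameCycle.refl σ i)).le

end Fold

namespace IsFoldable

variable {I : Type} [Fintype I] [DecidableEq I]
  {B : I → I → ℤ} {δ : I → ℤ} {σ : Equiv.Perm I} {o : I}

theorem orbitMult_toOrbit (h : IsFoldable B δ σ o) (i : I) :
    orbitMult B σ (toOrbit σ i) = if B i (σ i) = -1 then 2 else 1 := by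
  unfold orbitMult
  simp only [members, Finset.mem_filter, Finset.mem_univ, true_and]
  by_cases hi : B i (σ i) = -1
  · rw [if_neg, if_pos hi]
    intro h1
    have := h1 i rfl (σ i) (toOrbit_sigma i) (h.sigma_ne hi).symm
    omega
  · rw [if_pos, if_neg hi]
    intro j hj l hl hjl
    rw [eq_comm, toOrbit_eq_iff] at hj hl
    refine h.orthogonal_of_ne ?_ l (hj.symm.trans hl) hjl
    rwa [h.form_sigma_of_sameCycle hj]

theorem orb_simpleRoot (h : IsFoldable B δ σ o) (i : I) :
    orb B σ (simpleRoot i) = orbitMult B σ (toOrbit σ i) • orbitSum σ (simpleRoot i) := by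
  rw [h.orbitMult_toOrbit]
  split_ifs with hi
  · rw [h.orb_simpleRoot_of_eq hi, orbitSum, ((h.isSplit_simpleRoot_iff i).2 hi).2.1]
    simp [Finset.sum_range_succ, act_simpleRoot]
  · rw [h.orb_simpleRoot_of_ne hi, one_smul]

theorem pairing_orbitSum_self (h : IsFoldable B δ σ o) {θ : I → ℤ} (hθ : IsOrthOrbit B σ θ) :
    pairing B (orbitSum σ θ) θ = 2 := by
  rw [orbitSum, pairing_sum_left, Finset.sum_eq_single 0]
  · exact hθ.1
  · intro k hk hk0
    rw [h.comm]
    exact hθ.2 k (Nat.pos_of_ne_zero hk0) (Finset.mem_range.1 hk)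
  · intro h0
    exact absurd (Finset.mem_range.2 (minimalPeriod_act_pos θ)) h0

theorem pairing_orbitSum_orbitSum (h : IsFoldable B δ σ o) {θ : I → ℤ}
    (hθ : IsOrthOrbit B σ θ) :
    pairing B (orbitSum σ θ) (orbitSum σ θ) = 2 * Function.minimalPeriod (act σ) θ := by
  rw [h.pairing_orbitSum_of_act_eq θ (act_orbitSum θ), h.pairing_orbitSum_self hθ, mul_comm]

/-- On the diagonal, a split orbit gives 2² · 2 = 8 and an orthogonal one gives twice its
cardinality. Off the diagonal, all entries between distinct orbits are 0 or -1, so the pairing of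
orbit sums counts edges. -/
theorem foldForm_eq (h : IsFoldable B δ σ o) (i j : I) :
    foldForm B σ (toOrbit σ i) (toOrbit σ j) =
      pairing B (orb B σ (simpleRoot i)) (orb B σ (simpleRoot j)) := by
  by_cases hij : toOrbit σ i = toOrbit σ j
  · rw [← orb_simpleRoot_eq, ← orb_simpleRoot_eq, ← hij, orb_simpleRoot_eq, foldForm, if_pos rfl,
      card_members, h.orb_simpleRoot, pairing_smul_left, pairing_smul_right, h.orbitMult_toOrbit]
    split_ifs with hi
    · have hs := (h.isSplit_simpleRoot_iff i).2 hi
      have h1 : orbitSum σ (simpleRoot i) = simpleRoot i + act σ (simpleRoot i) := by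
        simp [orbitSum, hs.2.1, Finset.sum_range_succ]
      rw [h1, h.pairing_self_of_isRealRoot hs.2.2, hs.2.1]
      norm_num
    · rw [h.pairing_orbitSum_orbitSum (h.isOrthOrbit_simpleRoot hi)]
      ring
  · rw [foldForm, if_neg hij, h.orb_simpleRoot, h.orb_simpleRoot, pairing_smul_left,
      pairing_smul_right, orbitSum_simpleRoot, orbitSum_simpleRoot, pairing_sum_left]
    simp only [pairing_sum_right, pairing_simpleRoot_simpleRoot]
    rw [Finset.card_filter, ← Finset.sum_product', Nat.cast_sum, ← mul_assoc, ← mul_neg,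
      ← Finset.sum_neg_distrib]
    congr 1
    refine Finset.sum_congr rfl fun p hp => ?_
    have hne : p.1 ≠ p.2 := by
      intro he
      simp only [members, Finset.mem_product, Finset.mem_filter, Finset.mem_univ,
        true_and] at hp
      exact hij (by rw [← hp.1, ← hp.2, he])
    rcases h.off _ _ hne with h1 | h1 <;> simp [h1]

/-- The embedding is an isometry, which allows norms and reflection coefficients of the folded
lattice to be computed in the original one. -/
theorem pairing_foldForm (h : IsFoldable B δ σ o) (x y : Orbits σ → ℤ) :
    pairing (foldForm B σ) x y = pairing B (emb B σ x) (emb B σ y) := by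
  unfold emb
  rw [pairing_sum_left, pairing]
  refine Finset.sum_congr rfl fun η _ => ?_
  rw [pairing_sum_right]
  refine Finset.sum_congr rfl fun η' _ => ?_
  obtain ⟨i, rfl⟩ := exists_toOrbit_eq η
  obtain ⟨j, rfl⟩ := exists_toOrbit_eq η'
  rw [pairing_smul_left, pairing_smul_right, orb_simpleRoot_eq, orb_simpleRoot_eq, h.foldForm_eq]
  ring

/-! ### Folded reflections -/

/-- The vector O(α_i) is a positive multiple of the orbit sum of the orbit root, and a reflection
depends only on the line it negates. -/
theorem sub_smul_orb_simpleRoot (h : IsFoldable B δ σ o) {v : I → ℤ} (hv : act σ v = v) {i : I}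
    {k : ℤ} (hk : k * pairing B (orb B σ (simpleRoot i)) (orb B σ (simpleRoot i)) =
      2 * pairing B v (orb B σ (simpleRoot i))) :
    v - k • orb B σ (simpleRoot i) = orbitRefl B σ (orbitRoot B σ i) v := by
  obtain ⟨c, hc, h1⟩ := h.exists_orb_simpleRoot i
  have hth := h.isOrthOrbit_orbitRoot i
  have hp : (0 : ℤ) < Function.minimalPeriod (act σ) (orbitRoot B σ i) := by
    exact_mod_cast minimalPeriod_act_pos _
  rw [h1, pairing_smul_left, pairing_smul_right, pairing_smul_right,
    h.pairing_orbitSum_orbitSum hth, h.pairing_orbitSum_of_act_eq _ hv] at hk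
  rw [h.orbitRefl_of_act_eq _ hv, h1, smul_smul]
  have h2 : (2 * c * Function.minimalPeriod (act σ) (orbitRoot B σ i)) *
      (k * c - pairing B v (orbitRoot B σ i)) = 0 := by linear_combination hk
  have h3 := (mul_eq_zero.1 h2).resolve_left (by positivity)
  rw [sub_eq_zero.1 h3]

/-- Integrality of the reflection coefficient. In the non-orthogonal case O(α_i) is twice the orbit
root, but a fixed v pairs equally with α_i and α_{σ i}, which supplies the missing factor 2. -/
theorem exists_orbitRefl_eq (h : IsFoldable B δ σ o) {v : I → ℤ} (hv : act σ v = v) (i : I) :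
    ∃ k : ℤ, k * pairing B (orb B σ (simpleRoot i)) (orb B σ (simpleRoot i)) =
      2 * pairing B v (orb B σ (simpleRoot i)) := by
  have hth := h.isOrthOrbit_orbitRoot i
  obtain ⟨c, h1, d, hd⟩ : ∃ c : ℤ, orb B σ (simpleRoot i) = c • orbitSum σ (orbitRoot B σ i) ∧
      c ∣ pairing B v (orbitRoot B σ i) := by
    unfold orbitRoot
    split_ifs with hi
    · refine ⟨2, ?_, pairing B v (simpleRoot i), ?_⟩
      · rw [h.orb_simpleRoot_of_eq hi,
          orbitSum_of_act_eq (act_simpleRoot_pair (h.sigma_sigma hi))]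
      · rw [pairing_add_right, ← act_simpleRoot]
        have := h.pairing_act v (simpleRoot i)
        rw [hv] at this
        rw [this]; ring
    · exact ⟨1, by rw [h.orb_simpleRoot_of_ne hi, one_smul], one_dvd _⟩
  refine ⟨d, ?_⟩
  rw [h1, pairing_smul_left, pairing_smul_right, pairing_smul_right,
    h.pairing_orbitSum_orbitSum hth, h.pairing_orbitSum_of_act_eq _ hv, hd]
  ring

theorem emb_reflect (h : IsFoldable B δ σ o) (y : Orbits σ → ℤ) (i : I) {k : ℤ}
    (hk : k * foldForm B σ (toOrbit σ i) (toOrbit σ i) =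
      2 * pairing (foldForm B σ) y (simpleRoot (toOrbit σ i))) :
    emb B σ (y - k • simpleRoot (toOrbit σ i)) =
      orbitRefl B σ (orbitRoot B σ i) (emb B σ y) := by
  rw [h.foldForm_eq, h.pairing_foldForm, emb_simpleRoot] at hk
  rw [emb_sub, emb_smul, emb_simpleRoot, h.sub_smul_orb_simpleRoot (act_emb B y) hk]

/-- Folded simple reflections lift to isometries that permute the real roots and commute with the
orbit map, so a preimage is carried along. -/
theorem exists_orb_eq_emb (h : IsFoldable B δ σ o) {y : Orbits σ → ℤ}
    (hy : IsRealRoot (foldForm B σ) y) : ∃ β, IsRealRoot B β ∧ emb B σ y = orb B σ β := by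
  induction hy with
  | simple η =>
    obtain ⟨i, rfl⟩ := exists_toOrbit_eq η
    exact ⟨_, .simple i, emb_simpleRoot B i⟩
  | reflect y η k _ hk ih =>
    obtain ⟨i, rfl⟩ := exists_toOrbit_eq η
    obtain ⟨β, hβ, h1⟩ := ih
    have hth := h.isOrthOrbit_orbitRoot i
    exact ⟨_, (h.isRealRoot_orbitRefl hth β).2 hβ, by
      rw [h.emb_reflect y i hk, h1, h.orb_orbitRefl hth]⟩

/-- By descent the root is conjugate, up to sign, to a simple root or to a sum of two adjacent
simple roots. The latter has the same image as either summand. -/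
theorem exists_emb_eq_orb (h : IsFoldable B δ σ o) {β : I → ℤ} (hβ : IsRealRoot B β)
    (hS : pairing B (orbitSum σ β) (orbitSum σ β) ≠ 0) :
    ∃ y, IsRealRoot (foldForm B σ) y ∧ emb B σ y = orb B σ β := by
  refine h.descent (J := fun _ => True) (fun _ _ => trivial)
    (P := fun β => ∃ y, IsRealRoot (foldForm B σ) y ∧ emb B σ y = orb B σ β)
    ?_ ?_ ?_ ?_ hβ (fun _ hi => absurd trivial hi) hS
  · exact fun i _ => ⟨_, .simple (toOrbit σ i), emb_simpleRoot B i⟩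
  · intro i _ hi
    refine ⟨_, .simple (toOrbit σ i), ?_⟩
    have := orb_sum_eq ((h.isSplit_simpleRoot_iff i).2 hi)
    rw [act_simpleRoot] at this
    rw [emb_simpleRoot, this]
  · rintro i _ β _ ⟨y, hy, h1⟩
    have hth := h.isOrthOrbit_orbitRoot i
    obtain ⟨k, hk⟩ := h.exists_orbitRefl_eq (act_emb B y) i
    have hk' : k * foldForm B σ (toOrbit σ i) (toOrbit σ i) =
        2 * pairing (foldForm B σ) y (simpleRoot (toOrbit σ i)) := by
      rw [h.foldForm_eq, h.pairing_foldForm, emb_simpleRoot, hk]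
    refine ⟨_, .reflect y (toOrbit σ i) k hy hk', ?_⟩
    rw [h.emb_reflect y i hk', h1, ← h.orb_orbitRefl hth, h.orbitRefl_orbitRefl hth]
  · rintro β _ ⟨y, hy, h1⟩
    exact ⟨-y, hy.neg, by rw [emb_neg, h1, h.orb_neg]⟩

theorem pairing_orbitSum_of_isSplit (h : IsFoldable B δ σ o) {β : I → ℤ} (hβ : IsSplit B σ β) :
    pairing B (orbitSum σ β) (orbitSum σ β) = 2 := by
  have : orbitSum σ β = β + act σ β := by simp [orbitSum, hβ.2.1, Finset.sum_range_succ]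
  rw [this, h.pairing_self_of_isRealRoot hβ.2.2]

/-- Being split is invariant under the descent, and no simple root is split when every vertex orbit
is orthogonal. The descent applies because a split root has orbit sum of norm 2. -/
theorem not_isSplit (h : IsFoldable B δ σ o) (hB : ∀ i, B i (σ i) ≠ -1) (β : I → ℤ) :
    ¬ IsSplit B σ β := by
  intro hs
  refine h.descent (J := fun _ => True) (fun _ _ => trivial) (P := fun β => ¬ IsSplit B σ β)
    ?_ ?_ ?_ ?_ hs.1 (fun _ hi => absurd trivial hi) (by rw [h.pairing_orbitSum_of_isSplit hs]; norm_num) hs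
  · exact fun i _ hi => hB i ((h.isSplit_simpleRoot_iff i).1 hi)
  · exact fun i _ hi => absurd hi (hB i)
  · intro i _ β _ h1
    rwa [h.isSplit_orbitRefl (h.isOrthOrbit_orbitRoot i)] at h1
  · intro β _ h1
    rwa [h.isSplit_neg]

/-- The descent preserves being σ-fixed. Without fixed vertices it can only end at some α_i + α_{σ
i}, which is a sum of a split pair. -/
theorem isSum_of_act_eq (h : IsFoldable B δ σ o) (hσ : ∀ i, σ i ≠ i) {β : I → ℤ}
    (hβ : IsRealRoot B β) (hf : act σ β = β) : IsSum B σ β := by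
  refine h.descent (J := fun _ => True) (fun _ _ => trivial)
    (P := fun β => act σ β = β → IsSum B σ β)
    ?_ ?_ ?_ ?_ hβ (fun _ hi => absurd trivial hi) ?_ hf
  · intro i _ hi
    rw [act_simpleRoot] at hi
    exact absurd (simpleRoot_injective hi) (hσ i)
  · intro i _ hi _
    have := ((h.isSplit_simpleRoot_iff i).2 hi).isSum
    rwa [act_simpleRoot] at this
  · intro i _ β _ h1 h2
    rw [h.isSum_orbitRefl (h.isOrthOrbit_orbitRoot i), ← h.orbitRefl_act, h2] at h1
    exact h1 rfl
  · intro β _ h1 h2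
    rw [h.isSum_neg]
    rw [act_neg, neg_inj] at h2
    exact h1 h2
  · rw [orbitSum_of_act_eq hf, h.pairing_self_of_isRealRoot hβ]
    norm_num

end IsFoldable

end OrbitFolding

namespace OrbitFolding

set_option linter.unusedSectionVars false

/-! ### Orbit maps and translations -/

/-- Translating `β` by `a δ` translates its image under the orbit map by `P a δ`. -/
def HasShift {I : Type} [Fintype I] [DecidableEq I] (B : I → I → ℤ) (δ : I → ℤ) (σ : Equiv.Perm I)
    (β : I → ℤ) (P : ℤ) : Prop :=
  (∃ c : ℤ, 0 < c ∧ orb B σ β = c • orbitSum σ β ∧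
    c * Function.minimalPeriod (act σ) β = P) ∧
  ∀ a : ℤ, orb B σ (β + a • δ) = orb B σ β + (P * a) • δ

/-- `w` is obtained from `v` by folded reflections at vertices in `J`. -/
def Reach {I : Type} [Fintype I] [DecidableEq I] (B : I → I → ℤ) (σ : Equiv.Perm I)
    (J : I → Prop) : (I → ℤ) → (I → ℤ) → Prop :=
  Relation.ReflTransGen fun v w => ∃ i, J i ∧ w = orbitRefl B σ (orbitRoot B σ i) v

namespace IsFoldable

variable {I : Type} [Fintype I] [DecidableEq I]
  {B : I → I → ℤ} {δ : I → ℤ} {σ : Equiv.Perm I} {o : I}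

/-- The step is the factor 2 of the orbit map times the period 2. -/
theorem hasShift_of_isSplit (h : IsFoldable B δ σ o) {β : I → ℤ} (hβ : IsSplit B σ β) :
    HasShift B δ σ β 4 := by
  refine ⟨⟨2, by norm_num, ?_, by rw [hβ.2.1]; norm_num⟩, fun a => ?_⟩
  · rw [hβ.orb_eq, orbitSum, hβ.2.1]
    simp [Finset.sum_range_succ]
  · rw [hβ.orb_eq, ((h.isSplit_add_delta β a).2 hβ).orb_eq, h.act_add_delta]
    module

/-- Translates of β remain fixed real roots and hence sums of split pairs, so the factor is always 2
while the period is 1. -/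
theorem hasShift_of_act_eq (h : IsFoldable B δ σ o) (hσ : ∀ i, σ i ≠ i) {β : I → ℤ}
    (hβ : IsRealRoot B β) (hf : act σ β = β) : HasShift B δ σ β 2 := by
  have hs := h.isSum_of_act_eq hσ hβ hf
  refine ⟨⟨2, by norm_num, by rw [hs.orb_eq, orbitSum_of_act_eq hf], ?_⟩, fun a => ?_⟩
  · rw [Function.minimalPeriod_eq_one_iff_isFixedPt.2 hf]; norm_num
  · rw [hs.orb_eq, (h.isSum_of_act_eq hσ ((h.isRealRoot_add_delta β a).2 hβ)
      (by rw [h.act_add_delta, hf])).orb_eq]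
    module

/-- The orbit map is the plain orbit sum for β and for all its translates; not being split passes to
translates automatically, whereas not being a sum has to be assumed for each of them. -/
theorem hasShift_minimalPeriod (h : IsFoldable B δ σ o) {β : I → ℤ} (h1 : ¬ IsSplit B σ β)
    (h2 : ∀ a : ℤ, ¬ IsSum B σ (β + a • δ)) :
    HasShift B δ σ β (Function.minimalPeriod (act σ) β) := by
  have h0 : ¬ IsSum B σ β := by simpa using h2 0
  refine ⟨⟨1, one_pos, by rw [orb_eq_orbitSum h1 h0, one_smul], one_mul _⟩, fun a => ?_⟩
  rw [orb_eq_orbitSum h1 h0, orb_eq_orbitSum (by rwa [h.isSplit_add_delta]) (h2 a),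
    h.orbitSum_add_delta]

theorem pairing_orb_self_of_isSplit (h : IsFoldable B δ σ o) {β : I → ℤ} (hβ : IsSplit B σ β) :
    pairing B (orb B σ β) (orb B σ β) = 8 := by
  rw [hβ.orb_eq, pairing_smul_left, pairing_smul_right, h.pairing_self_of_isRealRoot hβ.2.2]
  norm_num

theorem pairing_orb_self_of_isSum (h : IsFoldable B δ σ o) {β : I → ℤ} (hβ : IsSum B σ β) :
    pairing B (orb B σ β) (orb B σ β) = 8 := by
  obtain ⟨γ, hγ, rfl⟩ := hβ
  rw [orb_sum_eq hγ, h.pairing_orb_self_of_isSplit hγ]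

/-- Norm, period and type are invariant under the descent, and for a simple root with orthogonal
orbit the norm is twice the size of the orbit. -/
theorem pairing_orb_self (h : IsFoldable B δ σ o) {β : I → ℤ} (hβ : IsRealRoot B β)
    (hS : pairing B (orbitSum σ β) (orbitSum σ β) ≠ 0) (h1 : ¬ IsSplit B σ β)
    (h2 : ¬ IsSum B σ β) :
    pairing B (orb B σ β) (orb B σ β) = 2 * Function.minimalPeriod (act σ) β := by
  have : IsSplit B σ β ∨ IsSum B σ β ∨
      pairing B (orb B σ β) (orb B σ β) = 2 * Function.minimalPeriod (act σ) β := by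
    refine h.descent (J := fun _ => True) (fun _ _ => trivial)
      (P := fun β => IsSplit B σ β ∨ IsSum B σ β ∨
        pairing B (orb B σ β) (orb B σ β) = 2 * Function.minimalPeriod (act σ) β)
      ?_ ?_ ?_ ?_ hβ (fun _ hi => absurd trivial hi) hS
    · intro i _
      by_cases hi : B i (σ i) = -1
      · exact Or.inl ((h.isSplit_simpleRoot_iff i).2 hi)
      · right; right
        rw [h.orb_simpleRoot_of_ne hi, h.pairing_orbitSum_orbitSum (h.isOrthOrbit_simpleRoot hi)]
    · intro i _ hi
      have := ((h.isSplit_simpleRoot_iff i).2 hi).isSum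
      rw [act_simpleRoot] at this
      exact Or.inr (Or.inl this)
    · intro i _ β _ h3
      have hth := h.isOrthOrbit_orbitRoot i
      rwa [h.isSplit_orbitRefl hth, h.isSum_orbitRefl hth, h.orb_orbitRefl hth,
        h.pairing_orbitRefl hth, h.minimalPeriod_orbitRefl hth] at h3
    · intro β _ h3
      rwa [h.isSplit_neg, h.isSum_neg, h.orb_neg, pairing_neg_left, pairing_neg_right, neg_neg,
        minimalPeriod_neg]
  exact (this.resolve_left h1).resolve_left h2

/-- Roots when all orbits of vertices are orthogonal. -/
theorem hasShift_of_orthogonal (h : IsFoldable B δ σ o) (hB : ∀ i, B i (σ i) ≠ -1) {β : I → ℤ}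
    (hβ : IsRealRoot B β) (hS : pairing B (orbitSum σ β) (orbitSum σ β) ≠ 0) :
    pairing B (orb B σ β) (orb B σ β) = 2 * Function.minimalPeriod (act σ) β ∧
      HasShift B δ σ β (Function.minimalPeriod (act σ) β) := by
  have hsum : ∀ x, ¬ IsSum B σ x := by
    rintro x ⟨γ, hγ, -⟩
    exact h.not_isSplit hB γ hγ
  exact ⟨h.pairing_orb_self hβ hS (h.not_isSplit hB β) (hsum β),
    h.hasShift_minimalPeriod (h.not_isSplit hB β) fun a => hsum _⟩

/-- Roots when `σ` has no fixed vertices. -/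
theorem hasShift_of_ne (h : IsFoldable B δ σ o) (hσ : ∀ i, σ i ≠ i) {β : I → ℤ}
    (hβ : IsRealRoot B β) (hS : pairing B (orbitSum σ β) (orbitSum σ β) ≠ 0) :
    (IsSplit B σ β ∨ IsSum B σ β) ∨
      (pairing B (orb B σ β) (orb B σ β) = 2 * Function.minimalPeriod (act σ) β ∧
        Function.minimalPeriod (act σ) β ≠ 1 ∧
        HasShift B δ σ β (Function.minimalPeriod (act σ) β)) := by
  by_cases h1 : IsSplit B σ β
  · exact Or.inl (Or.inl h1)
  by_cases h2 : IsSum B σ β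
  · exact Or.inl (Or.inr h2)
  have h3 : act σ β ≠ β := fun hf => h2 (h.isSum_of_act_eq hσ hβ hf)
  refine Or.inr ⟨h.pairing_orb_self hβ hS h1 h2, ?_, h.hasShift_minimalPeriod h1 ?_⟩
  · exact fun he => h3 (Function.minimalPeriod_eq_one_iff_isFixedPt.1 he)
  · intro a ha
    have := ha.act_eq
    rw [h.act_add_delta] at this
    exact h3 (add_right_cancel this)

theorem pairing_orb_ne_zero_iff (_ : IsFoldable B δ σ o) (β : I → ℤ) :
    pairing B (orb B σ β) (orb B σ β) ≠ 0 ↔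
      pairing B (orbitSum σ β) (orbitSum σ β) ≠ 0 := by
  obtain ⟨c, hc, h1⟩ := exists_orb_eq B σ β
  rw [h1, pairing_smul_left, pairing_smul_right]
  simp [hc.ne']

theorem pairing_add_smul_delta (h : IsFoldable B δ σ o) (k : ℤ) (x : I → ℤ) :
    pairing B (k • δ + x) (k • δ + x) = pairing B x x := by
  simp only [pairing_add_left, pairing_add_right, pairing_smul_left, pairing_smul_right,
    h.pairing_delta_left, h.pairing_delta_right]
  ring

theorem orbitRefl_add_smul_delta (h : IsFoldable B δ σ o) {θ : I → ℤ} (hθ : IsOrthOrbit B σ θ)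
    (k e : ℤ) (v : I → ℤ) :
    orbitRefl B σ θ (k • δ + e • v) = k • δ + e • orbitRefl B σ θ v := by
  have h1 : orbitRefl B σ θ δ = δ := by
    rw [h.orbitRefl_of_act_eq θ h.act_delta, h.pairing_delta_left, zero_smul, sub_zero]
  have h2 : ∀ (k : ℤ) (v : I → ℤ), orbitRefl B σ θ (k • v) = k • orbitRefl B σ θ v :=
    fun k v => map_zsmul (h.reflEquiv hθ) k v
  rw [h.orbitRefl_add, h2, h2, h1]

/-! ### Finite parts -/

/-- Modulo `δ`, a folded real root is the image of a root supported off the orbit of `o`, or a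
fixed multiple `e` of such an image. -/
theorem exists_finite_part (h : IsFoldable B δ σ o) {θ : I → ℤ} (hθ : IsOrthOrbit B σ θ)
    (hsupp : ∀ i, σ.SameCycle o i → θ i = 0) {c e : ℤ}
    (he : orb B σ (simpleRoot o) = c • δ - e • orb B σ θ) {y : Orbits σ → ℤ}
    (hy : IsRealRoot (foldForm B σ) y) :
    ∃ (k f : ℤ) (β : I → ℤ), IsRealRoot B β ∧ (∀ i, σ.SameCycle o i → β i = 0) ∧
      (f = 1 ∨ f = e) ∧ emb B σ y = k • δ + f • orb B σ β := by
  have hreal := h.isRealRoot_iff.2 hθ.1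
  induction hy with
  | simple η =>
    obtain ⟨i, rfl⟩ := exists_toOrbit_eq η
    rw [emb_simpleRoot]
    by_cases hi : σ.SameCycle o i
    · refine ⟨c, e, -θ, hreal.neg, fun j hj => by rw [Pi.neg_apply, hsupp j hj, neg_zero],
        Or.inr rfl, ?_⟩
      rw [h.orb_neg, ← orb_simpleRoot_eq, ← toOrbit_eq_iff.2 hi, orb_simpleRoot_eq, he, smul_neg,
        sub_eq_add_neg]
    · refine ⟨0, 1, _, .simple i, fun j hj => ?_, Or.inl rfl, by simp⟩
      have : j ≠ i := by rintro rfl; exact hi hj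
      simp [simpleRoot, this]
  | reflect y η k _ hk ih =>
    obtain ⟨i, rfl⟩ := exists_toOrbit_eq η
    obtain ⟨l, f, β, hβ, hβs, hf, h1⟩ := ih
    by_cases hi : σ.SameCycle o i
    · rw [← toOrbit_eq_iff.2 hi] at hk ⊢
      -- Modulo δ the reflection at the orbit of o is the reflection along θ, so it acts on the
      -- finite part by `orbitRefl` along θ and changes only the coefficient of δ.
      refine ⟨l - k * c, f, orbitRefl B σ θ β, (h.isRealRoot_orbitRefl hθ β).2 hβ,
        fun j hj => ?_, hf, ?_⟩
      · rw [orbitRefl, Pi.sub_apply, Finset.sum_apply, Finset.sum_eq_zero, hβs j hj, sub_zero]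
        intro k _
        have hz : (act σ)^[k] θ j = 0 := by
          rw [iterate_act]
          exact hsupp _ (hj.trans (Equiv.Perm.SameCycle.symm ⟨k, by simp⟩))
        rw [Pi.smul_apply, hz, smul_zero]
      · rw [h.foldForm_eq, h.pairing_foldForm, emb_simpleRoot] at hk
        rw [emb_sub, emb_smul, emb_simpleRoot, h.orb_orbitRefl hθ]
        have hf' := h.orbitRefl_add_smul_delta hθ l f (orb B σ β)
        rw [← h1, h.orbitRefl_of_act_eq θ (act_emb B y)] at hf'
        obtain ⟨g, hg, hg'⟩ := exists_orb_eq B σ θ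
        have hp : (0 : ℤ) < Function.minimalPeriod (act σ) θ := by
          exact_mod_cast minimalPeriod_act_pos _
        rw [he, hg', smul_smul] at hk ⊢
        simp only [pairing_sub_left, pairing_sub_right, pairing_smul_left, pairing_smul_right,
          h.pairing_delta_left, h.pairing_delta_right, h.pairing_orbitSum_orbitSum hθ,
          h.pairing_orbitSum_of_act_eq θ (act_emb B y)] at hk
        -- With O(θ) equal to g times the orbit sum of θ, the equation defining the folded
        -- coefficient k becomes this product after removing twice the period.
        have h3 : e * g * (k * (e * g) + pairing B (emb B σ y) θ) = 0 := by
          have : (2 * (Function.minimalPeriod (act σ) θ : ℤ)) *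
              (e * g * (k * (e * g) + pairing B (emb B σ y) θ)) = 0 := by
            linear_combination hk
          exact (mul_eq_zero.1 this).resolve_left (by positivity)
        rcases mul_eq_zero.1 h3 with h4 | h4
        · exfalso
          -- If e g vanished, O(α_o) would be a multiple of δ and hence isotropic, although it is a
          -- nonzero multiple of the sum of an orthogonal orbit.
          have h5 : orb B σ (simpleRoot o) = c • δ := by
            rw [he, hg', smul_smul, h4, zero_smul, sub_zero]
          have h6 := congrArg (fun v => pairing B v v) h5
          obtain ⟨d, hd, h7⟩ := h.exists_orb_simpleRoot o
          have hq : (0 : ℤ) < Function.minimalPeriod (act σ) (orbitRoot B σ o) := by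
            exact_mod_cast minimalPeriod_act_pos _
          simp only [h7, pairing_smul_left, pairing_smul_right, h.pairing_delta_left,
            h.pairing_orbitSum_orbitSum (h.isOrthOrbit_orbitRoot o), mul_zero] at h6
          have : 0 < d * (d * (2 * (Function.minimalPeriod (act σ) (orbitRoot B σ o) : ℤ))) := by
            positivity
          omega
        · have h5 : pairing B (emb B σ y) θ = -(k * (e * g)) := by linarith
          rw [h5] at hf'
          have : emb B σ y - k • (c • δ - (e * g) • orbitSum σ θ) =
              (emb B σ y - (-(k * (e * g))) • orbitSum σ θ) - (k * c) • δ := by module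
          rw [this, hf', sub_smul]
          abel
    · have hth := h.isOrthOrbit_orbitRoot i
      refine ⟨l, f, orbitRefl B σ (orbitRoot B σ i) β, (h.isRealRoot_orbitRefl hth β).2 hβ,
        fun j hj => ?_, hf, ?_⟩
      · rw [orbitRefl_orbitRoot_apply, hβs j hj]
        exact fun hij => hi (hj.trans hij.symm)
      · rw [h.emb_reflect y i hk, h1, h.orbitRefl_add_smul_delta hth, h.orb_orbitRefl hth]

/-! ### Conjugacy under the folded Weyl group -/

section Reach

variable {J : I → Prop}

theorem Reach.symm (h : IsFoldable B δ σ o) {v w : I → ℤ} (hvw : Reach B σ J v w) :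
    Reach B σ J w v := by
  induction hvw with
  | refl => exact Relation.ReflTransGen.refl
  | tail _ h2 ih =>
    obtain ⟨i, hi, rfl⟩ := h2
    exact Relation.ReflTransGen.head
      ⟨i, hi, (h.orbitRefl_orbitRefl (h.isOrthOrbit_orbitRoot i) _).symm⟩ ih

theorem Reach.neg (h : IsFoldable B δ σ o) {v w : I → ℤ} (hvw : Reach B σ J v w) :
    Reach B σ J (-v) (-w) := by
  induction hvw with
  | refl => exact Relation.ReflTransGen.refl
  | tail _ h2 ih =>
    obtain ⟨i, hi, rfl⟩ := h2
    exact Relation.ReflTransGen.tail ih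
      ⟨i, hi, (map_neg (h.reflEquiv (h.isOrthOrbit_orbitRoot i)) _).symm⟩

theorem reach_neg_orb_simpleRoot (h : IsFoldable B δ σ o) {i : I} (hi : J i) :
    Reach B σ J (-orb B σ (simpleRoot i)) (orb B σ (simpleRoot i)) := by
  refine Relation.ReflTransGen.single ⟨i, hi, ?_⟩
  rw [← h.sub_smul_orb_simpleRoot (k := -2) (by rw [act_neg, act_orb])
    (by rw [pairing_neg_left]; ring)]
  module

/-- The descent with vertices restricted to J. A change of sign costs one more reflection, since a
folded simple root is conjugate to its negative. -/
theorem exists_reach_orb_simpleRoot (h : IsFoldable B δ σ o) (hJ : ∀ i, J i → J (σ i))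
    {β : I → ℤ} (hβ : IsRealRoot B β) (hsupp : ∀ i, ¬ J i → β i = 0)
    (hS : pairing B (orbitSum σ β) (orbitSum σ β) ≠ 0) :
    ∃ i, J i ∧ Reach B σ J (orb B σ β) (orb B σ (simpleRoot i)) := by
  refine h.descent hJ
    (P := fun β => ∃ i, J i ∧ Reach B σ J (orb B σ β) (orb B σ (simpleRoot i)))
    ?_ ?_ ?_ ?_ hβ hsupp hS
  · exact fun i hi => ⟨i, hi, Relation.ReflTransGen.refl⟩
  · intro i hi hB
    have := orb_sum_eq ((h.isSplit_simpleRoot_iff i).2 hB)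
    rw [act_simpleRoot] at this
    exact ⟨i, hi, by rw [this]; exact Relation.ReflTransGen.refl⟩
  · rintro i hi β _ ⟨j, hj, hr⟩
    rw [h.orb_orbitRefl (h.isOrthOrbit_orbitRoot i)] at hr
    exact ⟨j, hj, Relation.ReflTransGen.head ⟨i, hi, rfl⟩ hr⟩
  · rintro β _ ⟨j, hj, hr⟩
    rw [h.orb_neg]
    exact ⟨j, hj, Relation.ReflTransGen.trans (Reach.neg h hr) (h.reach_neg_orb_simpleRoot hj)⟩

theorem Reach.pairing_eq (h : IsFoldable B δ σ o) {v w : I → ℤ} (hvw : Reach B σ J v w) :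
    pairing B v v = pairing B w w := by
  induction hvw with
  | refl => rfl
  | tail _ h2 ih =>
    obtain ⟨i, -, rfl⟩ := h2
    rw [ih, h.pairing_orbitRefl (h.isOrthOrbit_orbitRoot i)]

/-- Conjugacy of folded simple roots of equal norm, taken as a hypothesis, extends to all images of
roots supported on J. -/
theorem reach_orb (h : IsFoldable B δ σ o) (hJ : ∀ i, J i → J (σ i))
    (hchain : ∀ i j, J i → J j →
      pairing B (orb B σ (simpleRoot i)) (orb B σ (simpleRoot i)) =
        pairing B (orb B σ (simpleRoot j)) (orb B σ (simpleRoot j)) →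
      Reach B σ J (orb B σ (simpleRoot i)) (orb B σ (simpleRoot j)))
    {β γ : I → ℤ} (hβ : IsRealRoot B β) (hβs : ∀ i, ¬ J i → β i = 0)
    (hγ : IsRealRoot B γ) (hγs : ∀ i, ¬ J i → γ i = 0)
    (hq : pairing B (orb B σ β) (orb B σ β) = pairing B (orb B σ γ) (orb B σ γ))
    (hS : pairing B (orb B σ γ) (orb B σ γ) ≠ 0) :
    Reach B σ J (orb B σ β) (orb B σ γ) := by
  obtain ⟨i, hi, h1⟩ := h.exists_reach_orb_simpleRoot hJ hβ hβs
    ((h.pairing_orb_ne_zero_iff β).1 (by rwa [hq]))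
  obtain ⟨j, hj, h2⟩ := h.exists_reach_orb_simpleRoot hJ hγ hγs
    ((h.pairing_orb_ne_zero_iff γ).1 hS)
  refine Relation.ReflTransGen.trans h1 (Relation.ReflTransGen.trans (hchain i j hi hj ?_)
    (Reach.symm h h2))
  rw [← Reach.pairing_eq h h1, ← Reach.pairing_eq h h2, hq]

/-- The rank two computation for A_2: s_j sends the first root to the sum of the two, and s_i sends
this sum to the second root. -/
theorem reach_of_adjacent (h : IsFoldable B δ σ o) {i j : I} (hi : J i) (hj : J j)
    (h1 : pairing B (orb B σ (simpleRoot i)) (orb B σ (simpleRoot i)) =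
      pairing B (orb B σ (simpleRoot j)) (orb B σ (simpleRoot j)))
    (h2 : 2 * pairing B (orb B σ (simpleRoot i)) (orb B σ (simpleRoot j)) =
      -pairing B (orb B σ (simpleRoot j)) (orb B σ (simpleRoot j))) :
    Reach B σ J (orb B σ (simpleRoot i)) (orb B σ (simpleRoot j)) := by
  have e1 : orb B σ (simpleRoot i) + orb B σ (simpleRoot j) =
      orbitRefl B σ (orbitRoot B σ j) (orb B σ (simpleRoot i)) := by
    rw [← h.sub_smul_orb_simpleRoot (k := -1) (act_orb B _) (by linarith)]
    module
  have e2 : orb B σ (simpleRoot j) = orbitRefl B σ (orbitRoot B σ i)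
      (orb B σ (simpleRoot i) + orb B σ (simpleRoot j)) := by
    rw [← h.sub_smul_orb_simpleRoot (k := 1) (by rw [act_add, act_orb, act_orb])
      (by rw [pairing_add_left, h.comm (orb B σ (simpleRoot j)), h1]; linarith)]
    module
  exact Relation.ReflTransGen.head ⟨j, hj, e1⟩ (Relation.ReflTransGen.single ⟨i, hi, e2⟩)

/-- The reflections fix δ, so they move the finite part of an image while keeping its coefficient of
δ. One root with a given level and finite part thus yields all conjugate finite parts. -/
theorem Reach.exists_orb_eq (h : IsFoldable B δ σ o) {v w : I → ℤ} (hvw : Reach B σ J v w)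
    {k e : ℤ} {β : I → ℤ} (hβ : IsRealRoot B β) (h1 : orb B σ β = k • δ + e • v) :
    ∃ γ, IsRealRoot B γ ∧ orb B σ γ = k • δ + e • w := by
  induction hvw with
  | refl => exact ⟨β, hβ, h1⟩
  | tail _ h2 ih =>
    obtain ⟨i, -, rfl⟩ := h2
    obtain ⟨γ, hγ, h3⟩ := ih
    have hth := h.isOrthOrbit_orbitRoot i
    exact ⟨_, (h.isRealRoot_orbitRefl hth γ).2 hγ, by
      rw [h.orb_orbitRefl hth, h3, h.orbitRefl_add_smul_delta hth]⟩

end Reach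

/-! ### Rotating a root to the finite subsystem -/

theorem nonneg_of_orb_nonneg (h : IsFoldable B δ σ o) {β : I → ℤ} (hβ : IsRealRoot B β)
    (h0 : 0 ≤ orb B σ β) (hS : pairing B (orb B σ β) (orb B σ β) ≠ 0) : 0 ≤ β := by
  rcases h.nonneg_or_nonpos (h.pairing_self_of_isRealRoot hβ) with h1 | h1
  · exact h1
  · exfalso
    have h2 : 0 ≤ orb B σ (-β) := orb_nonneg B (neg_nonneg.2 h1)
    rw [h.orb_neg] at h2
    have : orb B σ β = 0 := le_antisymm (neg_nonneg.1 h2) h0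
    rw [this, pairing_zero_left] at hS
    exact hS rfl

/-- If all rotations of β had a positive coefficient at o, the orbit sum would have coefficient at
least the period there, and O(β) at least P. A rotation with vanishing coefficient therefore exists,
and it changes neither the image nor the step. -/
theorem exists_apply_eq_zero (h : IsFoldable B δ σ o) {β : I → ℤ} (hβ : IsRealRoot B β)
    (h0 : 0 ≤ orb B σ β) (hS : pairing B (orb B σ β) (orb B σ β) ≠ 0) {P : ℤ}
    (hP : HasShift B δ σ β P) (hlt : orb B σ β o < P) :
    ∃ α, IsRealRoot B α ∧ 0 ≤ α ∧ α o = 0 ∧ orb B σ α = orb B σ β ∧ HasShift B δ σ α P := by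
  have hpos := h.nonneg_of_orb_nonneg hβ h0 hS
  obtain ⟨⟨c, hc, h1, h2⟩, h3⟩ := hP
  have hex : ∃ k, (act σ)^[k] β o = 0 := by
    by_contra hne
    push Not at hne
    have h4 : ∀ k, 1 ≤ (act σ)^[k] β o := fun k =>
      lt_of_le_of_ne (iterate_act_nonneg hpos k o) (hne k).symm
    have h5 : (Function.minimalPeriod (act σ) β : ℤ) ≤ orbitSum σ β o := by
      rw [orbitSum, Finset.sum_apply]
      have := Finset.sum_le_sum (s := Finset.range (Function.minimalPeriod (act σ) β))
        fun k _ => h4 k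
      simpa using this
    rw [h1, Pi.smul_apply, smul_eq_mul, ← h2] at hlt
    nlinarith
  obtain ⟨k, hk⟩ := hex
  have hiter : ∀ k, IsRealRoot B ((act σ)^[k] β) ∧ HasShift B δ σ ((act σ)^[k] β) P := by
    intro k
    induction k with
    | zero => exact ⟨hβ, ⟨c, hc, h1, h2⟩, h3⟩
    | succ k ih =>
      rw [Function.iterate_succ_apply']
      obtain ⟨i1, ⟨c', j0, j1, j2⟩, j3⟩ := ih
      refine ⟨(h.isRealRoot_act_iff _).2 i1, ⟨c', j0, ?_, ?_⟩, fun a => ?_⟩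
      · rw [h.orb_act, orbitSum_act, j1]
      · rw [Function.minimalPeriod_apply (mem_periodicPts_act σ _), j2]
      · rw [← h.act_add_delta, h.orb_act, h.orb_act, j3]
  exact ⟨_, (hiter k).1, iterate_act_nonneg hpos k, hk, h.orb_iterate_act β k, (hiter k).2⟩

end IsFoldable

end OrbitFolding

namespace OrbitFolding

set_option linter.unusedSectionVars false

/-! ### The four cases -/

section Cases

variable {c : FoldCase} {n : ℕ}

/-- The diagram automorphism on the labels of the vertices. -/
def sigmaLabel (c : FoldCase) (n i : ℕ) : ℕ :=
  match c with
  | .A | .B => if i = 0 then rk c n - 1 else if i = 1 then rk c n else rk c n - i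
  | .C | .D => rk c n - i

/-- The `σ`-orbits are the fibres of this function. -/
def orbitLabel (c : FoldCase) (n i : ℕ) : ℕ :=
  match c with
  | .A | .B => if i ≤ 1 ∨ rk c n ≤ i + 1 then 0 else min i (rk c n - i)
  | .C | .D => min i (rk c n - i)

/-- The range of `n` in the four cases. -/
def IsValid (c : FoldCase) (n : ℕ) : Prop := 1 ≤ n ∧ (c ≠ .D → 2 ≤ n)

theorem IsValid.le_rk (hv : IsValid c n) : 3 ≤ rk c n ∧ (c ≠ .D → 4 ≤ rk c n) := by
  obtain ⟨h1, h2⟩ := hv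
  cases c <;> simp [rk] at h2 ⊢ <;> omega

theorem sigma_val (hv : IsValid c n) (i : Vertex c n) :
    (sigma c n i).val = sigmaLabel c n i.val := by
  have h3 := hv.le_rk.1
  have key : ∀ i : Vertex c n, (Fin.revPerm (Equiv.swap 0 1 i)).val =
      if i.val = 0 then rk c n - 1 else if i.val = 1 then rk c n else rk c n - i := by
    intro i
    have h1 : (1 : Vertex c n).val = 1 := by
      rw [Fin.val_one']; exact Nat.mod_eq_of_lt (by omega)
    have h0 : (0 : Vertex c n).val = 0 := rfl
    rw [Equiv.swap_apply_def, Fin.revPerm_apply, Fin.val_rev]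
    by_cases hi0 : i.val = 0
    · rw [if_pos (Fin.ext (hi0.trans h0.symm)), if_pos hi0, h1]; omega
    · rw [if_neg (fun h => hi0 ((congrArg Fin.val h).trans h0)), if_neg hi0]
      by_cases hi1 : i.val = 1
      · rw [if_pos (Fin.ext (hi1.trans h1.symm)), if_pos hi1, h0]; omega
      · rw [if_neg (fun h => hi1 ((congrArg Fin.val h).trans h1)), if_neg hi1]; omega
  cases c
  · exact key i
  · exact key i
  · simp [sigma, sigmaLabel, Fin.val_rev]
  · simp [sigma, sigmaLabel, Fin.val_rev]

theorem orbitLabel_sigmaLabel (hv : IsValid c n) {i : ℕ} (hi : i ≤ rk c n) :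
    orbitLabel c n (sigmaLabel c n i) = orbitLabel c n i := by
  have h3 := hv.le_rk
  cases c <;> simp only [sigmaLabel, orbitLabel] <;> (try split_ifs) <;> simp at h3 <;> omega

/-- Adjacency of labels. -/
def adj (c : FoldCase) (n i j : ℕ) : Prop := edge c n (min i j) (max i j)

theorem adj_comm (i j : ℕ) : adj c n i j ↔ adj c n j i := by
  unfold adj; rw [min_comm, max_comm]

theorem adj_sigmaLabel (hv : IsValid c n) {i j : ℕ} (hi : i ≤ rk c n) (hj : j ≤ rk c n)
    (hij : i ≠ j) : adj c n (sigmaLabel c n i) (sigmaLabel c n j) ↔ adj c n i j := by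
  have h3 := hv.le_rk
  wlog hlt : i < j generalizing i j
  · rw [adj_comm, adj_comm i j]
    exact this hj hi hij.symm (by omega)
  cases c <;> simp only [sigmaLabel, adj, edge, edgeD, edgeA] <;> (try split_ifs) <;>
    simp at h3 <;> omega

end Cases

end OrbitFolding

namespace OrbitFolding

set_option linter.unusedSectionVars false

/-! ### The diagrams in terms of vertex labels. -/

section Labels

variable {c : FoldCase} {n : ℕ}

theorem exists_iterate_sigmaLabel (hv : IsValid c n) {i j : ℕ} (hi : i ≤ rk c n) (hj : j ≤ rk c n)
    (hij : orbitLabel c n i = orbitLabel c n j) : ∃ k, (sigmaLabel c n)^[k] i = j := by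
  have h3 := hv.le_rk
  -- Orbits have at most four elements, so three applications suffice.
  suffices h : i = j ∨ sigmaLabel c n i = j ∨ sigmaLabel c n (sigmaLabel c n i) = j ∨
      sigmaLabel c n (sigmaLabel c n (sigmaLabel c n i)) = j by
    rcases h with h | h | h | h
    exacts [⟨0, h⟩, ⟨1, h⟩, ⟨2, h⟩, ⟨3, h⟩]
  have key : ∀ m, 4 ≤ m → i ≤ m → j ≤ m → ∀ s : ℕ → ℕ,
      (∀ i, s i = if i = 0 then m - 1 else if i = 1 then m else m - i) →
      (if i ≤ 1 ∨ m ≤ i + 1 then 0 else min i (m - i)) =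
        (if j ≤ 1 ∨ m ≤ j + 1 then 0 else min j (m - j)) →
      i = j ∨ s i = j ∨ s (s i) = j ∨ s (s (s i)) = j := by
    intro m hm hi hj s hs he
    have s0 : s 0 = m - 1 := by rw [hs, if_pos rfl]
    have s1 : s 1 = m := by rw [hs, if_neg one_ne_zero, if_pos rfl]
    have s2 : ∀ i, 2 ≤ i → s i = m - i := fun i hi => by
      rw [hs, if_neg (by omega), if_neg (by omega)]
    have s3 : s (m - 1) = 1 := by rw [s2 _ (by omega)]; omega
    have s4 : s m = 0 := by rw [s2 _ (by omega)]; omega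
    by_cases h1 : i ≤ 1 ∨ m ≤ i + 1
    · rw [if_pos h1] at he
      have h2 : j ≤ 1 ∨ m ≤ j + 1 := by
        by_contra h2
        rw [if_neg h2] at he
        omega
      have hi' : i = 0 ∨ i = 1 ∨ i = m - 1 ∨ i = m := by omega
      rcases hi' with rfl | rfl | rfl | rfl <;> simp only [s0, s1, s3, s4] <;> omega
    · rw [if_neg h1] at he
      have h2 : ¬ (j ≤ 1 ∨ m ≤ j + 1) := by
        intro h2
        rw [if_pos h2] at he
        omega
      rw [if_neg h2] at he
      rw [s2 i (by omega)]
      omega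
  cases c
  · exact key _ (h3.2 (by simp)) hi hj _ (fun _ => rfl) hij
  · exact key _ (h3.2 (by simp)) hi hj _ (fun _ => rfl) hij
  all_goals
    simp only [orbitLabel] at hij
    simp only [sigmaLabel]
    omega

theorem sigmaLabel_of_adj (hv : IsValid c n) {i j : ℕ} (hi : i ≤ rk c n) (hj : j ≤ rk c n)
    (hne : i ≠ j) (hij : orbitLabel c n i = orbitLabel c n j) (ha : adj c n i j) :
    sigmaLabel c n i = j ∧ sigmaLabel c n j = i := by
  have h3 := hv.le_rk
  wlog hlt : i < j generalizing i j
  · exact (this hj hi hne.symm hij.symm ((adj_comm _ _).1 ha) (by omega)).symm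
  cases c <;> simp only [orbitLabel, adj, edge, edgeD, edgeA] at hij ha <;>
    simp only [sigmaLabel] <;> (try split_ifs at hij ⊢) <;> simp at h3 <;> omega

/-- The null root on the labels of the vertices. -/
def deltaLabel (c : FoldCase) (n i : ℕ) : ℤ :=
  match c with
  | .D => 1
  | _ => if i ≤ 1 ∨ rk c n ≤ i + 1 then 1 else 2

theorem delta_apply (i : Vertex c n) : delta c n i = deltaLabel c n i.val := by
  cases c <;> rfl

theorem deltaLabel_sigmaLabel (hv : IsValid c n) {i : ℕ} (hi : i ≤ rk c n) :
    deltaLabel c n (sigmaLabel c n i) = deltaLabel c n i := by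
  have h3 := hv.le_rk
  cases c <;> simp only [deltaLabel, sigmaLabel] <;> (try split_ifs) <;> simp at h3 <;> omega

theorem sum_range_eq_sum {N : ℕ} {F : ℕ → ℤ} (s : Finset ℕ) (hs : ∀ j ∈ s, j < N)
    (h0 : ∀ j < N, j ∉ s → F j = 0) : ∑ j ∈ Finset.range N, F j = ∑ j ∈ s, F j :=
  (Finset.sum_subset (fun j hj => Finset.mem_range.2 (hs j hj))
    fun j hj hjs => h0 j (Finset.mem_range.1 hj) hjs).symm

/-- The entry of a simply laced Cartan datum with adjacency relation `E`. -/
noncomputable def entry (E : ℕ → ℕ → Prop) (i j : ℕ) : ℤ := by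
  classical exact if i = j then 2 else if E (min i j) (max i j) then -1 else 0

theorem entry_self (E : ℕ → ℕ → Prop) (i : ℕ) : entry E i i = 2 := if_pos rfl

theorem entry_edge {E : ℕ → ℕ → Prop} {i j : ℕ} (h : i ≠ j) (h1 : E (min i j) (max i j)) :
    entry E i j = -1 := by
  rw [entry, if_neg h, if_pos h1]

theorem entry_zero {E : ℕ → ℕ → Prop} {i j : ℕ} (h : i ≠ j) (h1 : ¬ E (min i j) (max i j)) :
    entry E i j = 0 := by
  rw [entry, if_neg h, if_neg h1]

theorem form_eq_entry (i j : Vertex c n) : form c n i j = entry (edge c n) i.val j.val := by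
  unfold form entry
  simp only [Fin.ext_iff]

/-- A neighbour sum in a simply laced diagram. -/
theorem sum_entry_eq_zero {E : ℕ → ℕ → Prop} {m i : ℕ} {d : ℕ → ℤ} (hi : i ≤ m) (s : Finset ℕ)
    (hs : ∀ j ∈ s, j ≤ m ∧ j ≠ i ∧ E (min i j) (max i j))
    (hn : ∀ j ≤ m, j ≠ i → E (min i j) (max i j) → j ∈ s) (hd : ∑ j ∈ s, d j = 2 * d i) :
    ∑ j ∈ Finset.range (m + 1), entry E i j * d j = 0 := by
  rw [sum_range_eq_sum (insert i s), Finset.sum_insert (fun h => (hs i h).2.1 rfl), entry_self,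
    Finset.sum_congr rfl (g := fun j => -d j), Finset.sum_neg_distrib, hd]
  · ring
  · intro j hj
    rw [entry_edge (hs j hj).2.1.symm (hs j hj).2.2, neg_one_mul]
  · intro j hj
    rcases Finset.mem_insert.1 hj with rfl | h
    · omega
    · have := (hs j h).1; omega
  · intro j hj hjs
    rw [Finset.mem_insert, not_or] at hjs
    rw [entry_zero (Ne.symm hjs.1) fun h => hjs.2 (hn j (by omega) hjs.1 h), zero_mul]

theorem sum_entry_edgeA {m : ℕ} (hm : 3 ≤ m) {i : ℕ} (hi : i ≤ m) :
    ∑ j ∈ Finset.range (m + 1), entry (edgeA m) i j * 1 = 0 := by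
  obtain ⟨a, b, hab, h⟩ : ∃ a b, a ≠ b ∧ ∀ j, (j = a ∨ j = b) ↔
      j ≤ m ∧ j ≠ i ∧ edgeA m (min i j) (max i j) := by
    unfold edgeA
    rcases Nat.eq_zero_or_pos i with rfl | hi0
    · exact ⟨1, m, by omega, by omega⟩
    rcases hi.eq_or_lt with rfl | hi1
    · exact ⟨0, i - 1, by omega, by omega⟩
    · exact ⟨i - 1, i + 1, by omega, by omega⟩
  refine sum_entry_eq_zero (d := fun _ => 1) hi {a, b} (fun j hj => (h j).1 (by simpa using hj))
    (fun j h1 h2 h3 => by simpa using (h j).2 ⟨h1, h2, h3⟩) ?_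
  rw [Finset.sum_pair hab]
  norm_num

/-- Every mark is half the sum of the neighbouring marks. The vertices are sorted by the number of
neighbours: ends, branch vertices and inner vertices of the chain. -/
theorem sum_entry_edgeD {m : ℕ} (hm : 4 ≤ m) {i : ℕ} (hi : i ≤ m) :
    ∑ j ∈ Finset.range (m + 1),
      entry (edgeD m) i j * (if j ≤ 1 ∨ m ≤ j + 1 then 1 else 2) = 0 := by
  obtain ⟨d, hd⟩ : ∃ d : ℕ → ℤ, ∀ j, (if j ≤ 1 ∨ m ≤ j + 1 then 1 else 2) = d j := ⟨_, fun _ => rfl⟩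
  have d1 : ∀ j, j ≤ 1 ∨ m ≤ j + 1 → d j = 1 := fun j hj => by rw [← hd, if_pos hj]
  have d2 : ∀ j, ¬ (j ≤ 1 ∨ m ≤ j + 1) → d j = 2 := fun j hj => by rw [← hd, if_neg hj]
  simp only [hd]
  have one : ∀ a, d a = 2 * d i → (∀ j, j = a ↔ j ≤ m ∧ j ≠ i ∧ edgeD m (min i j) (max i j)) →
      ∑ j ∈ Finset.range (m + 1), entry (edgeD m) i j * d j = 0 := by
    intro a ha h
    refine sum_entry_eq_zero hi {a} (fun j hj => (h j).1 (by simpa using hj))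
      (fun j h1 h2 h3 => by simpa using (h j).2 ⟨h1, h2, h3⟩) ?_
    rw [Finset.sum_singleton, ha]
  have two : ∀ a b, a ≠ b → d a + d b = 2 * d i →
      (∀ j, (j = a ∨ j = b) ↔ j ≤ m ∧ j ≠ i ∧ edgeD m (min i j) (max i j)) →
      ∑ j ∈ Finset.range (m + 1), entry (edgeD m) i j * d j = 0 := by
    intro a b hab ha h
    refine sum_entry_eq_zero hi {a, b} (fun j hj => (h j).1 (by simpa using hj))
      (fun j h1 h2 h3 => by simpa using (h j).2 ⟨h1, h2, h3⟩) ?_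
    rw [Finset.sum_pair hab, ha]
  have three : ∀ a b e, a ≠ b → a ≠ e → b ≠ e → d a + (d b + d e) = 2 * d i →
      (∀ j, (j = a ∨ j = b ∨ j = e) ↔ j ≤ m ∧ j ≠ i ∧ edgeD m (min i j) (max i j)) →
      ∑ j ∈ Finset.range (m + 1), entry (edgeD m) i j * d j = 0 := by
    intro a b e hab hae hbe ha h
    refine sum_entry_eq_zero hi {a, b, e} (fun j hj => (h j).1 (by simpa using hj))
      (fun j h1 h2 h3 => by simpa using (h j).2 ⟨h1, h2, h3⟩) ?_
    rw [Finset.sum_insert (by simp; omega), Finset.sum_pair hbe, ha]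
  by_cases h0 : i ≤ 1
  · exact one 2 (by rw [d1 i (by omega), d2 2 (by omega)]; norm_num) (by unfold edgeD; omega)
  by_cases h1 : m ≤ i + 1
  · exact one (m - 2) (by rw [d1 i (by omega), d2 (m - 2) (by omega)]; norm_num)
      (by unfold edgeD; omega)
  by_cases h2 : i = 2
  · subst h2
    -- For rank 4 the two branch vertices coincide and the vertex 2 has four neighbours.
    rcases hm.eq_or_lt with rfl | hm
    · refine sum_entry_eq_zero hi {0, 1, 3, 4} ?_ ?_ ?_
      · intro j hj
        simp only [Finset.mem_insert, Finset.mem_singleton] at hj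
        unfold edgeD; omega
      · intro j hj h2 _
        simp only [Finset.mem_insert, Finset.mem_singleton]
        omega
      · rw [Finset.sum_insert (by simp), Finset.sum_insert (by simp), Finset.sum_pair (by simp),
          d1 0 (by omega), d1 1 (by omega), d1 3 (by omega), d1 4 (by omega), d2 2 (by omega)]
        norm_num
    · exact three 0 1 3 (by omega) (by omega) (by omega)
        (by rw [d1 0 (by omega), d1 1 (by omega), d2 2 (by omega), d2 3 (by omega)]; norm_num)
        (by unfold edgeD; omega)
  by_cases h3 : i + 2 = m
  · exact three (i - 1) (i + 1) (i + 2) (by omega) (by omega) (by omega)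
      (by rw [d1 (i + 1) (by omega), d1 (i + 2) (by omega), d2 i (by omega),
            d2 (i - 1) (by omega)]; norm_num)
      (by unfold edgeD; omega)
  · exact two (i - 1) (i + 1) (by omega)
      (by rw [d2 (i + 1) (by omega), d2 i (by omega), d2 (i - 1) (by omega)]; norm_num)
      (by unfold edgeD; omega)

theorem sameCycle_iff (hv : IsValid c n) (i j : Vertex c n) :
    (sigma c n).SameCycle i j ↔ orbitLabel c n i.val = orbitLabel c n j.val := by
  have hpow : ∀ k (i : Vertex c n), (((sigma c n) ^ k) i).val = (sigmaLabel c n)^[k] i.val := by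
    intro k
    induction k with
    | zero => intro i; rfl
    | succ k ih => intro i; rw [pow_succ, Equiv.Perm.mul_apply, ih, sigma_val hv]; rfl
  constructor
  · intro h
    obtain ⟨k, rfl⟩ := h.exists_nat_pow_eq
    clear h
    induction k with
    | zero => rfl
    | succ k ih =>
      rw [pow_succ', Equiv.Perm.mul_apply, sigma_val hv, orbitLabel_sigmaLabel hv (by omega), ih]
  · intro h
    obtain ⟨k, hk⟩ := exists_iterate_sigmaLabel hv (by omega) (by omega) h
    refine ⟨k, Fin.ext ?_⟩
    rw [zpow_natCast, hpow, hk]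

/-- Proportionality is propagated from the vertex 0, along the cycle in the case D and otherwise to
2, along the chain, and out to the remaining ends. -/
theorem conn_label {x : ℕ → ℤ} (hv : IsValid c n)
    (hx : ∀ i j, i ≤ rk c n → j ≤ rk c n → i ≠ j → adj c n i j →
      x i * deltaLabel c n j = x j * deltaLabel c n i) {i : ℕ} (hi : i ≤ rk c n) :
    x i = x 0 * deltaLabel c n i := by
  have h3 := hv.le_rk
  have hpos : ∀ j, deltaLabel c n j ≠ 0 := by
    intro j
    cases c <;> simp only [deltaLabel] <;> (try split_ifs) <;> norm_num
  have step : ∀ i j, i ≤ rk c n → j ≤ rk c n → i ≠ j → adj c n i j →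
      x j = x 0 * deltaLabel c n j → x i = x 0 * deltaLabel c n i := by
    intro i j hi hj hij ha he
    have := hx i j hi hj hij ha
    rw [he] at this
    exact mul_right_cancel₀ (hpos j) (by rw [this]; ring)
  have h0 : x 0 = x 0 * deltaLabel c n 0 := by
    cases c <;> simp [deltaLabel]
  by_cases hc : c = .D
  · subst hc
    induction i with
    | zero => exact h0
    | succ i ih =>
      exact step (i + 1) i hi (by omega) (by omega) (by unfold adj edge edgeA; omega) (ih (by omega))
  · have hE : ∀ i j, adj c n i j ↔ edgeD (rk c n) (min i j) (max i j) := by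
      intro i j; cases c <;> first | rfl | exact absurd rfl hc
    have h4 := h3.2 hc
    have h2 : x 2 = x 0 * deltaLabel c n 2 :=
      step 2 0 (by omega) (by omega) (by omega) (by rw [hE]; unfold edgeD; omega) h0
    have hm : ∀ i, 2 ≤ i → i + 1 ≤ rk c n → x i = x 0 * deltaLabel c n i := by
      intro i hi
      induction i, hi using Nat.le_induction with
      | base => exact fun _ => h2
      | succ i hi ih =>
        exact fun h => step (i + 1) i (by omega) (by omega) (by omega)
          (by rw [hE]; unfold edgeD; omega) (ih (by omega))
    rcases Nat.lt_or_ge i 2 with h | h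
    · rcases Nat.eq_zero_or_pos i with rfl | h'
      · exact h0
      · exact step i 2 (by omega) (by omega) (by omega) (by rw [hE]; unfold edgeD; omega) h2
    · rcases Nat.lt_or_ge i (rk c n) with h' | h'
      · exact hm i h h'
      · exact step i (rk c n - 2) (by omega) (by omega) (by omega)
          (by rw [hE]; unfold edgeD; omega) (hm _ (by omega) (by omega))

theorem isFoldable (hv : IsValid c n) : IsFoldable (form c n) (delta c n) (sigma c n) 0 where
  symm i j := by
    rw [form_eq_entry, form_eq_entry, entry, entry, min_comm, max_comm]
    simp only [eq_comm (a := i.val)]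
  diag i := by rw [form_eq_entry, entry_self]
  off i j hij := by
    rw [form_eq_entry]
    have h : i.val ≠ j.val := fun h => hij (Fin.ext h)
    by_cases h1 : edge c n (min i.val j.val) (max i.val j.val)
    · exact Or.inr (entry_edge h h1)
    · exact Or.inl (entry_zero h h1)
  inv i j := by
    rw [form_eq_entry, form_eq_entry, sigma_val hv, sigma_val hv]
    by_cases h : i = j
    · subst h; rw [entry_self, entry_self]
    · have h' : i.val ≠ j.val := fun h1 => h (Fin.ext h1)
      have h1 : sigmaLabel c n i.val ≠ sigmaLabel c n j.val := by
        rw [← sigma_val hv, ← sigma_val hv]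
        exact fun h2 => h ((sigma c n).injective (Fin.ext h2))
      have h2 := adj_sigmaLabel hv (i := i.val) (j := j.val) (by omega) (by omega) h'
      by_cases h3 : adj c n i.val j.val
      · rw [entry_edge h' h3, entry_edge h1 (h2.2 h3)]
      · rw [entry_zero h' h3, entry_zero h1 fun h4 => h3 (h2.1 h4)]
  null i := by
    have h3 := hv.le_rk
    simp only [form_eq_entry, delta_apply]
    rw [Fin.sum_univ_eq_sum_range (fun j => entry (edge c n) i.val j * deltaLabel c n j)]
    have hi : i.val ≤ rk c n := by omega
    cases c
    · exact sum_entry_edgeD (h3.2 (by simp)) hi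
    · exact sum_entry_edgeD (h3.2 (by simp)) hi
    · exact sum_entry_edgeD (h3.2 (by simp)) hi
    · exact sum_entry_edgeA h3.1 hi
  pos i := by
    rw [delta_apply]
    cases c <;> simp only [deltaLabel] <;> (try split_ifs) <;> norm_num
  fix i := by
    rw [delta_apply, delta_apply, sigma_val hv, deltaLabel_sigmaLabel hv (by omega)]
  conn x hx i := by
    rw [delta_apply]
    have := conn_label (x := fun i => if h : i ≤ rk c n then x ⟨i, by omega⟩ else 0) hv
      (i := i.val) ?_ (by omega)
    · have hi : i.val ≤ rk c n := by omega
      simpa [hi] using this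
    · intro i j hi hj hij ha
      have := hx ⟨i, by omega⟩ ⟨j, by omega⟩ (by rw [form_eq_entry, entry_edge hij ha]; norm_num)
      simpa [hi, hj, delta_apply] using this
  dich i := by
    by_cases h : ∀ j, (sigma c n).SameCycle i j → i ≠ j → form c n i j = 0
    · exact Or.inl h
    · right
      push Not at h
      obtain ⟨j, hij, hne, h1⟩ := h
      have hne' : i.val ≠ j.val := fun h => hne (Fin.ext h)
      have ha : adj c n i.val j.val := by
        by_contra ha
        exact h1 (by rw [form_eq_entry, entry_zero hne' ha])
      obtain ⟨h2, h4⟩ := sigmaLabel_of_adj hv (by omega) (by omega) hne'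
        ((sameCycle_iff hv i j).1 hij) ha
      have hi : sigma c n i = j := Fin.ext (by rw [sigma_val hv, h2])
      have hj : sigma c n j = i := Fin.ext (by rw [sigma_val hv, h4])
      refine ⟨by rw [hi, hj], ?_⟩
      rw [hi, form_eq_entry, entry_edge hne' ha]
  proper i := by
    have h3 := hv.le_rk
    have hi : i.val ≤ rk c n := by omega
    have hlab : ∃ j, j ≤ rk c n ∧ orbitLabel c n i.val ≠ orbitLabel c n j := by
      by_cases h0 : orbitLabel c n i.val = 0
      · rw [h0]
        cases c <;> simp at h3
        · exact ⟨2, by omega, by simp only [orbitLabel]; split_ifs <;> omega⟩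
        · exact ⟨2, by omega, by simp only [orbitLabel]; split_ifs <;> omega⟩
        · exact ⟨1, by omega, by simp only [orbitLabel]; omega⟩
        · exact ⟨1, by omega, by simp only [orbitLabel]; omega⟩
      · refine ⟨0, by omega, ?_⟩
        have : orbitLabel c n 0 = 0 := by cases c <;> simp [orbitLabel]
        rwa [this]
    obtain ⟨j, hj, hne⟩ := hlab
    exact ⟨⟨j, by omega⟩, fun h => hne ((sameCycle_iff hv _ _).1 h)⟩

end Labels
end OrbitFolding

namespace OrbitFolding

set_option linter.unusedSectionVars false

/-! ### Images of simple roots and periods in the four cases. -/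

section Data

variable {c : FoldCase} {n : ℕ}

theorem orb_simpleRoot_apply_eq (hv : IsValid c n) (i j : Vertex c n) :
    orb (form c n) (sigma c n) (simpleRoot i) j =
      if orbitLabel c n i.val = orbitLabel c n j.val then
        (if form c n i (sigma c n i) = -1 then 2 else 1) else 0 := by
  have h := isFoldable hv
  rw [h.orb_simpleRoot, h.orbitMult_toOrbit, orbitSum_simpleRoot, Pi.smul_apply, Finset.sum_apply]
  have : ∑ l ∈ members (sigma c n) (toOrbit (sigma c n) i), simpleRoot l j =
      if orbitLabel c n i.val = orbitLabel c n j.val then 1 else 0 := by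
    simp only [simpleRoot, Pi.single_apply, Finset.sum_ite_eq, members, Finset.mem_filter,
      Finset.mem_univ, true_and]
    exact if_congr (by rw [eq_comm, toOrbit_eq_iff, sameCycle_iff hv]) rfl rfl
  rw [this]
  split_ifs <;> simp

theorem orb_simpleRoot_congr (hv : IsValid c n) {i j : Vertex c n}
    (hij : orbitLabel c n i.val = orbitLabel c n j.val) :
    orb (form c n) (sigma c n) (simpleRoot i) = orb (form c n) (sigma c n) (simpleRoot j) := by
  rw [← orb_simpleRoot_eq, ← orb_simpleRoot_eq,
    toOrbit_eq_iff.2 ((sameCycle_iff hv i j).2 hij)]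

theorem orbitLabel_zero : orbitLabel c n 0 = 0 := by cases c <;> simp [orbitLabel]

/-- These are the edges reversed by σ: the middle edge when the rank is odd, and in the cyclic
diagram also the edge joining 0 to the last vertex. -/
theorem form_sigma_iff (hv : IsValid c n) (i : Vertex c n) :
    form c n i (sigma c n i) = -1 ↔
      match c with
      | .A => False
      | .B | .C => i.val = n ∨ i.val = n + 1
      | .D => i.val = n ∨ i.val = n + 1 ∨ i.val = 0 ∨ i.val = rk .D n := by
  have h3 := hv.le_rk
  have hi : i.val ≤ rk c n := by omega
  have key : form c n i (sigma c n i) = -1 ↔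
      i.val ≠ sigmaLabel c n i.val ∧ adj c n i.val (sigmaLabel c n i.val) := by
    rw [form_eq_entry, sigma_val hv]
    by_cases h1 : i.val = sigmaLabel c n i.val
    · rw [← h1, entry_self]; simp
    · by_cases h2 : adj c n i.val (sigmaLabel c n i.val)
      · simp [entry_edge h1 h2, h1, h2]
      · simp [entry_zero h1 h2, h2]
  rw [key]
  clear key
  cases c <;> simp only [adj, edge, edgeD, edgeA, sigmaLabel, iff_false] <;>
    generalize i.val = i at hi ⊢ <;> simp only [rk] at * <;> (try split_ifs) <;> simp at h3 <;> omega

theorem form_sigma_ne (hv : IsValid .A n) (i : Vertex .A n) :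
    form .A n i (sigma .A n i) ≠ -1 := fun h => (form_sigma_iff hv i).1 h

theorem sigma_apply_ne (hv : IsValid c n) (hc : c ≠ .A) (i : Vertex c n) :
    sigma c n i ≠ i := by
  intro h
  have h1 := congrArg Fin.val h
  have h3 := hv.le_rk
  have hi : i.val ≤ rk c n := by omega
  rw [sigma_val hv] at h1
  cases c <;> simp only [sigmaLabel] at h1 <;> simp only [rk] at * <;> (try split_ifs at h1) <;>
    simp at h3 hc <;> omega

theorem sigma_sigma_apply (hv : IsValid c n) {i : Vertex c n}
    (hi : orbitLabel c n i.val ≠ 0 ∨ c = .C ∨ c = .D) : sigma c n (sigma c n i) = i := by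
  apply Fin.ext
  rw [sigma_val hv, sigma_val hv]
  have hi' : i.val ≤ rk c n := by omega
  have h3 := hv.le_rk
  cases c <;> simp only [sigmaLabel, orbitLabel] at hi ⊢ <;> (try split_ifs at hi ⊢) <;>
    simp at h3 hi <;> omega

theorem sigma_pow_four (hv : IsValid c n) (i : Vertex c n) :
    sigma c n (sigma c n (sigma c n (sigma c n i))) = i := by
  have h := (sameCycle_iff hv i (sigma c n (sigma c n i))).1 ⟨2, by simp [pow_two]⟩
  by_cases hi : orbitLabel c n i.val ≠ 0 ∨ c = .C ∨ c = .D
  · rw [sigma_sigma_apply hv (i := sigma c n (sigma c n i)) (by rwa [← h]), sigma_sigma_apply hv hi]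
  · apply Fin.ext
    simp only [sigma_val hv]
    have hi' : i.val ≤ rk c n := by omega
    have h3 := hv.le_rk
    have key : ∀ m i, 4 ≤ m → i = 0 ∨ i = 1 ∨ i = m - 1 ∨ i = m → ∀ s : ℕ → ℕ,
        (∀ i, s i = if i = 0 then m - 1 else if i = 1 then m else m - i) →
        s (s (s (s i))) = i := by
      intro m i hm hi s hs
      have s0 : s 0 = m - 1 := by rw [hs, if_pos rfl]
      have s1 : s 1 = m := by rw [hs, if_neg one_ne_zero, if_pos rfl]
      have s2 : ∀ i, 2 ≤ i → s i = m - i := fun i hi => by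
        rw [hs, if_neg (by omega), if_neg (by omega)]
      have s3 : s (m - 1) = 1 := by rw [s2 _ (by omega)]; omega
      have s4 : s m = 0 := by rw [s2 _ (by omega)]; omega
      rcases hi with rfl | rfl | rfl | rfl <;> simp only [s0, s1, s3, s4]
    have hm : ∀ m, 4 ≤ m → i.val ≤ m →
        ¬ ((if i.val ≤ 1 ∨ m ≤ i.val + 1 then 0 else min i.val (m - i.val)) ≠ 0) →
        i.val = 0 ∨ i.val = 1 ∨ i.val = m - 1 ∨ i.val = m := by
      intro m h1 h2 h3
      split_ifs at h3 <;> omega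
    push Not at hi
    cases c
    · exact key _ _ (h3.2 (by simp)) (hm _ (h3.2 (by simp)) hi' (not_not.2 hi.1)) _ fun _ => rfl
    · exact key _ _ (h3.2 (by simp)) (hm _ (h3.2 (by simp)) hi' (not_not.2 hi.1)) _ fun _ => rfl
    · exact absurd rfl hi.2.1
    · exact absurd rfl hi.2.2

/-- Periods of roots divide `4`. -/
theorem minimalPeriod_dvd_four (hv : IsValid c n) (β : Lat c n) :
    Function.minimalPeriod (act (sigma c n)) β ∣ 4 := by
  apply Function.IsPeriodicPt.minimalPeriod_dvd
  funext i
  change β ((sigma c n).symm ((sigma c n).symm ((sigma c n).symm ((sigma c n).symm i)))) = β i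
  congr 1
  simp only [Equiv.symm_apply_eq, sigma_pow_four hv]

/-- Periods of roots supported on vertices whose orbit has at most two elements divide `2`. -/
theorem minimalPeriod_dvd_two {β : Lat c n}
    (hβ : ∀ i, sigma c n (sigma c n i) ≠ i → β i = 0) :
    Function.minimalPeriod (act (sigma c n)) β ∣ 2 := by
  apply Function.IsPeriodicPt.minimalPeriod_dvd
  funext i
  change β ((sigma c n).symm ((sigma c n).symm i)) = β i
  by_cases hi : sigma c n (sigma c n i) = i
  · congr 1
    rw [Equiv.symm_apply_eq, Equiv.symm_apply_eq, hi]
  · rw [hβ i hi, hβ]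
    intro h
    simp only [Equiv.apply_symm_apply] at h
    have := congrArg (fun x => sigma c n (sigma c n x)) h
    simp only [Equiv.apply_symm_apply] at this
    exact hi this

end Data
end OrbitFolding

namespace OrbitFolding

set_option linter.unusedSectionVars false

theorem IsFoldable.orb_simpleRoot_pair {I : Type} [Fintype I] [DecidableEq I]
    {B : I → I → ℤ} {δ : I → ℤ} {σ : Equiv.Perm I} {o : I} (h : IsFoldable B δ σ o) {i : I}
    (h1 : σ (σ i) = i) (h2 : σ i ≠ i) (h3 : B i (σ i) ≠ -1) :
    orb B σ (simpleRoot i) = simpleRoot i + simpleRoot (σ i) ∧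
      pairing B (orb B σ (simpleRoot i)) (orb B σ (simpleRoot i)) = 4 := by
  have hp : Function.minimalPeriod (act σ) (simpleRoot i) = 2 := by
    refine Function.minimalPeriod_eq_prime ?_ ?_
    · change act σ (act σ (simpleRoot i)) = simpleRoot i
      rw [act_simpleRoot, act_simpleRoot, h1]
    · change ¬ act σ (simpleRoot i) = simpleRoot i
      rw [act_simpleRoot]
      exact fun h => h2 (simpleRoot_injective h)
  rw [h.orb_simpleRoot_of_ne h3, h.pairing_orbitSum_orbitSum (h.isOrthOrbit_simpleRoot h3), hp]
  refine ⟨?_, by norm_num⟩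
  rw [orbitSum, hp]
  simp [Finset.sum_range_succ, act_simpleRoot]

section Data

variable {c : FoldCase} {n : ℕ}

/-! ### Norms and translations -/

/-- All vertex orbits are orthogonal, so there are no split roots, the norm is twice the period, the
step is the period, and the period divides 4. -/
theorem shift_of_A (hv : IsValid .A n) {β : Lat .A n} (hβ : IsRealRoot (form .A n) β)
    (hq : pairing (form .A n) (O .A n β) (O .A n β) ≠ 0) :
    (pairing (form .A n) (O .A n β) (O .A n β) = 2 ∧
        HasShift (form .A n) (delta .A n) (sigma .A n) β 1) ∨
      (pairing (form .A n) (O .A n β) (O .A n β) = 4 ∧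
        HasShift (form .A n) (delta .A n) (sigma .A n) β 2) ∨
      (pairing (form .A n) (O .A n β) (O .A n β) = 8 ∧
        HasShift (form .A n) (delta .A n) (sigma .A n) β 4) := by
  have h := isFoldable hv
  obtain ⟨h1, h2⟩ := h.hasShift_of_orthogonal (form_sigma_ne hv) hβ
    ((h.pairing_orb_ne_zero_iff β).1 hq)
  have h3 := minimalPeriod_dvd_four hv β
  have h4 := Nat.le_of_dvd (by norm_num) h3
  unfold O
  rw [h1]
  generalize Function.minimalPeriod (act (sigma .A n)) β = p at h2 h3 h4
  interval_cases p
  · simp at h3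
  · exact Or.inl ⟨by norm_num, h2⟩
  · exact Or.inr (Or.inl ⟨by norm_num, h2⟩)
  · norm_num at h3
  · exact Or.inr (Or.inr ⟨by norm_num, h2⟩)

/-- No vertex is fixed, so roots of period 1 are sums of split pairs. Any other root that is not
split has period 2 or 4, and the norm is twice the period. -/
theorem shift_of_ne_A (hv : IsValid c n) (hc : c ≠ .A) {β : Lat c n}
    (hβ : IsRealRoot (form c n) β)
    (hq : pairing (form c n) (O c n β) (O c n β) ≠ 0) :
    (IsSplit (form c n) (sigma c n) β ∨ IsSum (form c n) (sigma c n) β) ∨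
      (pairing (form c n) (O c n β) (O c n β) = 4 ∧
        HasShift (form c n) (delta c n) (sigma c n) β 2) ∨
      (pairing (form c n) (O c n β) (O c n β) = 8 ∧
        Function.minimalPeriod (act (sigma c n)) β = 4 ∧
        HasShift (form c n) (delta c n) (sigma c n) β 4) := by
  have h := isFoldable hv
  rcases h.hasShift_of_ne (sigma_apply_ne hv hc) hβ ((h.pairing_orb_ne_zero_iff β).1 hq) with
    h0 | ⟨h1, h0, h2⟩
  · exact Or.inl h0
  have h3 := minimalPeriod_dvd_four hv β
  have h4 := Nat.le_of_dvd (by norm_num) h3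
  unfold O
  rw [h1]
  generalize Function.minimalPeriod (act (sigma c n)) β = p at h0 h2 h3 h4
  interval_cases p
  · simp at h3
  · exact absurd rfl h0
  · exact Or.inr (Or.inl ⟨by norm_num, h2⟩)
  · norm_num at h3
  · exact Or.inr (Or.inr ⟨by norm_num, rfl, h2⟩)

theorem even_O_of_isSplit_or_isSum {β : Lat c n}
    (hs : IsSplit (form c n) (sigma c n) β ∨ IsSum (form c n) (sigma c n) β) (i : Vertex c n) :
    Even (O c n β i) := by
  unfold O
  rcases hs with hs | hs
  · rw [hs.orb_eq]; exact ⟨_, two_mul _⟩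
  · rw [hs.orb_eq]; exact ⟨_, two_mul _⟩

theorem norm_of_isSplit_or_isSum (hv : IsValid c n) {β : Lat c n}
    (hs : IsSplit (form c n) (sigma c n) β ∨ IsSum (form c n) (sigma c n) β) :
    pairing (form c n) (O c n β) (O c n β) = 8 := by
  have h := isFoldable hv
  rcases hs with hs | hs
  · exact h.pairing_orb_self_of_isSplit hs
  · exact h.pairing_orb_self_of_isSum hs

theorem norm_of_ne_A (hv : IsValid c n) (hc : c ≠ .A) {β : Lat c n}
    (hβ : IsRealRoot (form c n) β)
    (hq : pairing (form c n) (O c n β) (O c n β) ≠ 0) :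
    pairing (form c n) (O c n β) (O c n β) = 4 ∨ pairing (form c n) (O c n β) (O c n β) = 8 := by
  rcases shift_of_ne_A hv hc hβ hq with h1 | h1 | h1
  · exact Or.inr (norm_of_isSplit_or_isSum hv h1)
  · exact Or.inl h1.1
  · exact Or.inr h1.1

theorem hasShift_of_norm_four (hv : IsValid c n) {β : Lat c n} (hβ : IsRealRoot (form c n) β)
    (hq : pairing (form c n) (O c n β) (O c n β) = 4) :
    HasShift (form c n) (delta c n) (sigma c n) β 2 := by
  by_cases hc : c = .A
  · subst hc
    rcases shift_of_A hv hβ (by omega) with h1 | h1 | h1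
    · omega
    · exact h1.2
    · omega
  · rcases shift_of_ne_A hv hc hβ (by omega) with h1 | h1 | h1
    · have := norm_of_isSplit_or_isSum hv h1; omega
    · exact h1.2
    · omega

/-- A root of norm `8` whose image has an odd coordinate lies in an orbit of size `4`. -/
theorem hasShift_of_odd (hv : IsValid c n) {β : Lat c n} (hβ : IsRealRoot (form c n) β)
    (hq : pairing (form c n) (O c n β) (O c n β) = 8) {i : Vertex c n} (hi : Odd (O c n β i)) :
    HasShift (form c n) (delta c n) (sigma c n) β 4 := by
  by_cases hc : c = .A
  · subst hc
    rcases shift_of_A hv hβ (by omega) with h1 | h1 | h1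
    · omega
    · omega
    · exact h1.2
  · rcases shift_of_ne_A hv hc hβ (by omega) with h1 | h1 | h1
    · exact absurd (even_O_of_isSplit_or_isSum h1 i) (Int.not_even_iff_odd.2 hi)
    · omega
    · exact h1.2.2

/-- The step is 4 for split roots and roots of period 4, and 2 for sums of split pairs. -/
theorem exists_hasShift_of_norm_eight (hv : IsValid c n) {β : Lat c n}
    (hβ : IsRealRoot (form c n) β)
    (hq : pairing (form c n) (O c n β) (O c n β) = 8) :
    ∃ P, 0 < P ∧ P ∣ 4 ∧ HasShift (form c n) (delta c n) (sigma c n) β P := by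
  have h := isFoldable hv
  by_cases hc : c = .A
  · subst hc
    rcases shift_of_A hv hβ (by omega) with h1 | h1 | h1
    · omega
    · omega
    · exact ⟨4, by norm_num, by norm_num, h1.2⟩
  · rcases shift_of_ne_A hv hc hβ (by omega) with (h1 | h1) | h1 | h1
    · exact ⟨4, by norm_num, by norm_num, h.hasShift_of_isSplit h1⟩
    · exact ⟨2, by norm_num, by norm_num,
        h.hasShift_of_act_eq (sigma_apply_ne hv hc) hβ h1.act_eq⟩
    · omega
    · exact ⟨4, by norm_num, by norm_num, h1.2.2⟩

/-! ### Roots supported off the orbit of the vertex `0` -/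

theorem mem_finSub_iff {β : Lat c n} : β ∈ finSub c n ↔
    IsRealRoot (form c n) β ∧ ∀ i, (sigma c n).SameCycle 0 i → β i = 0 := by
  unfold finSub
  rw [Set.mem_ofPred_eq]
  refine and_congr_right fun _ => forall_congr' fun i => ?_
  rw [eq_comm, toOrbit_eq_iff]

theorem minimalPeriod_dvd_two_of_mem (hv : IsValid c n) {β : Lat c n} (hβ : β ∈ finSub c n) :
    Function.minimalPeriod (act (sigma c n)) β ∣ 2 := by
  refine minimalPeriod_dvd_two fun i hi => (mem_finSub_iff.1 hβ).2 i ?_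
  rw [sameCycle_iff hv]
  by_contra hne
  have h0 : orbitLabel c n (0 : Vertex c n).val = 0 := orbitLabel_zero
  rw [h0] at hne
  exact hi (sigma_sigma_apply hv (Or.inl (Ne.symm hne)))

/-- The square of σ fixes every vertex outside the orbit of 0, so the period is at most 2 and the
norm at most 4. -/
theorem norm_of_mem_finSub_A (hv : IsValid .A n) {β : Lat .A n} (hβ : β ∈ finSub .A n)
    (hq : pairing (form .A n) (O .A n β) (O .A n β) ≠ 0) :
    pairing (form .A n) (O .A n β) (O .A n β) = 2 ∨
      pairing (form .A n) (O .A n β) (O .A n β) = 4 := by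
  have h := isFoldable hv
  obtain ⟨h1, -⟩ := h.hasShift_of_orthogonal (form_sigma_ne hv) (mem_finSub_iff.1 hβ).1
    ((h.pairing_orb_ne_zero_iff β).1 hq)
  have h2 := Nat.le_of_dvd (by norm_num) (minimalPeriod_dvd_two_of_mem hv hβ)
  unfold O at hq ⊢
  omega

/-- Norm 8 could otherwise only come from an orbit of four roots, which cannot occur off the orbit
of 0. -/
theorem isSplit_or_isSum_of_mem_finSub (hv : IsValid c n) (hc : c ≠ .A) {β : Lat c n}
    (hβ : β ∈ finSub c n) (hq : pairing (form c n) (O c n β) (O c n β) = 8) :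
    IsSplit (form c n) (sigma c n) β ∨ IsSum (form c n) (sigma c n) β := by
  rcases shift_of_ne_A hv hc (mem_finSub_iff.1 hβ).1 (by omega) with h1 | h1 | h1
  · exact h1
  · omega
  · have h2 := Nat.le_of_dvd (by norm_num) (minimalPeriod_dvd_two_of_mem hv hβ)
    omega

/-! ### The null root of the folded datum -/

/-- The multiple of `δ` corresponding to the null root of the folded datum. -/
def nullFactor : FoldCase → ℤ
  | .D => 2
  | _ => 1

theorem udelta_eq_one (hv : IsValid c n) {j : Vertex c n} (i : ℕ) (hi : i ≤ rk c n)
    (he : orbitLabel c n i = orbitLabel c n j.val) (hm : markOne c n i) :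
    udelta c n (toOrbit (sigma c n) j) = 1 :=
  if_pos ⟨⟨i, by omega⟩, toOrbit_eq_iff.2 ((sameCycle_iff hv _ j).2 he), hm⟩

theorem udelta_eq_two (hv : IsValid c n) {j : Vertex c n}
    (h : ∀ i ≤ rk c n, orbitLabel c n i = orbitLabel c n j.val → ¬ markOne c n i) :
    udelta c n (toOrbit (sigma c n) j) = 2 :=
  if_neg fun ⟨i, hi, hm⟩ =>
    h i.val (by omega) ((sameCycle_iff hv i j).1 (toOrbit_eq_iff.1 hi)) hm

/-- Coordinatewise, the mark of an orbit is doubled exactly when the orbit is a pair of adjacent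
vertices, and the product is compared with the mark in δ. -/
theorem iota_udelta (hv : IsValid c n) : iota c n (udelta c n) = nullFactor c • delta c n := by
  funext j
  unfold iota
  rw [emb_apply, orb_simpleRoot_apply_eq hv, if_pos rfl, Pi.smul_apply, delta_apply, smul_eq_mul]
  have h3 := hv.le_rk
  have hj : j.val ≤ rk c n := by omega
  have hB := form_sigma_iff hv j
  have h1 := fun i => udelta_eq_one hv (j := j) i
  have h2 := udelta_eq_two hv (j := j)
  generalize udelta c n (toOrbit (sigma c n) j) = u at h1 h2 ⊢
  cases c <;> simp only [orbitLabel, markOne, deltaLabel, nullFactor] at h1 h2 hB ⊢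
  · have hrk : rk .A n = 2 * n := rfl
    have h4 := h3.2 (by simp)
    rw [if_neg (fun h => hB.1 h)]
    by_cases h0 : j.val ≤ 1 ∨ rk .A n ≤ j.val + 1
    · rw [h1 0 (by omega) (by rw [if_pos h0, if_pos (by omega)]) rfl, if_pos h0]
    · rw [if_neg h0, h2 (by rintro i hi he rfl; rw [if_neg h0, if_pos (by omega)] at he; omega)]
      norm_num
  · have hrk : rk .B n = 2 * n + 1 := rfl
    have h4 := h3.2 (by simp)
    by_cases h0 : j.val ≤ 1 ∨ rk .B n ≤ j.val + 1
    · rw [if_neg (fun h => by have := hB.1 h; omega),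
        h1 0 (by omega) (by rw [if_pos h0, if_pos (by omega)]) (Or.inl rfl), if_pos h0]
    · rw [if_neg h0]
      by_cases hn : j.val = n ∨ j.val = n + 1
      · rw [if_pos (hB.2 hn), h1 n (by omega) (by rw [if_neg h0, if_neg (by omega)]; omega)
          (Or.inr rfl)]
      · rw [if_neg (fun h => hn (hB.1 h)), h2]
        · norm_num
        intro i hi he hm
        rw [if_neg h0] at he
        rcases hm with rfl | rfl
        · rw [if_pos (by omega)] at he; omega
        · rw [if_neg (by omega)] at he; omega
  · have hrk : rk .C n = 2 * n + 1 := rfl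
    have h4 := h3.2 (by simp)
    by_cases h0 : j.val ≤ 1 ∨ rk .C n ≤ j.val + 1
    · rw [if_neg (fun h => by have := hB.1 h; omega), if_pos h0]
      by_cases h5 : j.val = 0 ∨ j.val = 2 * n + 1
      · rw [h1 0 (by omega) (by omega) (Or.inl rfl)]
      · rw [h1 1 (by omega) (by omega) (Or.inr (Or.inl rfl))]
    · rw [if_neg h0]
      by_cases hn : j.val = n ∨ j.val = n + 1
      · rw [if_pos (hB.2 hn), h1 n (by omega) (by omega) (Or.inr (Or.inr rfl))]
      · rw [if_neg (fun h => hn (hB.1 h)), h2 (by intro i hi he hm; omega)]; norm_num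
  · have hrk : rk .D n = 2 * n + 1 := rfl
    by_cases h0 : j.val = 0 ∨ j.val = 2 * n + 1
    · rw [if_pos (hB.2 (by omega)), h1 0 (by omega) (by omega) (Or.inl rfl)]; norm_num
    · by_cases hn : j.val = n ∨ j.val = n + 1
      · rw [if_pos (hB.2 (by omega)), h1 n (by omega) (by omega) (Or.inr rfl)]; norm_num
      · rw [if_neg (fun h => by have := hB.1 h; omega), h2 (by intro i hi he hm; omega)]

/-! ### The finite part of the simple root at the orbit of `0` -/

/-- The multiple of a root of the finite folded system occurring in the simple root at the orbit
of `0`. -/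
def thetaFactor : FoldCase → ℤ
  | .A => 2
  | _ => 1

theorem form_sigma_zero_iff (hv : IsValid c n) :
    form c n 0 (sigma c n 0) = -1 ↔ c = .D := by
  have hv0 : (0 : Vertex c n).val = 0 := rfl
  have h3 := hv.1
  cases c
  · exact ⟨fun h => ((form_sigma_iff hv _).1 h).elim, by simp⟩
  · exact ⟨fun h => by have := (form_sigma_iff hv _).1 h; omega, by simp⟩
  · exact ⟨fun h => by have := (form_sigma_iff hv _).1 h; omega, by simp⟩
  · exact ⟨fun _ => rfl, fun _ => (form_sigma_iff hv _).2 (by omega)⟩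

theorem orb_simpleRoot_zero_apply (hv : IsValid c n) (j : Vertex c n) :
    orb (form c n) (sigma c n) (simpleRoot 0) j =
      if orbitLabel c n j.val = 0 then nullFactor c else 0 := by
  have h0 : orbitLabel c n (0 : Vertex c n).val = 0 := orbitLabel_zero
  rw [orb_simpleRoot_apply_eq hv, h0]
  refine if_congr eq_comm ?_ rfl
  by_cases hD : c = .D
  · rw [if_pos ((form_sigma_zero_iff hv).2 hD), hD]; rfl
  · rw [if_neg fun h => hD ((form_sigma_zero_iff hv).1 h)]
    cases c <;> first | rfl | exact absurd rfl hD

/-- In the case D the simple root at 0 is split; in the cases A and B its orbit consists of four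
orthogonal simple roots. The case C is different, with norm 4. -/
theorem norm_orb_simpleRoot_zero (hv : IsValid c n) (hc : c ≠ .C) :
    pairing (form c n) (orb (form c n) (sigma c n) (simpleRoot 0))
      (orb (form c n) (sigma c n) (simpleRoot 0)) = 8 := by
  have h := isFoldable hv
  have hv0 : (0 : Vertex c n).val = 0 := rfl
  by_cases hD : c = .D
  · exact h.pairing_orb_self_of_isSplit ((h.isSplit_simpleRoot_iff 0).2
      ((form_sigma_zero_iff hv).2 hD))
  · have hB' : form c n 0 (sigma c n 0) ≠ -1 := fun h1 => hD ((form_sigma_zero_iff hv).1 h1)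
    have h4 := minimalPeriod_dvd_four hv (simpleRoot (0 : Vertex c n))
    have h2 : ¬ Function.minimalPeriod (act (sigma c n)) (simpleRoot 0) ∣ 2 := by
      intro hd
      have hp : act (sigma c n) (act (sigma c n) (simpleRoot 0)) = simpleRoot 0 :=
        Function.isPeriodicPt_iff_minimalPeriod_dvd.2 hd
      rw [act_simpleRoot, act_simpleRoot] at hp
      have h5 := congrArg Fin.val (simpleRoot_injective hp)
      have h6 := hv.le_rk.2 hD
      rw [sigma_val hv, sigma_val hv, hv0] at h5
      cases c
      · simp only [sigmaLabel, if_true] at h5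
        split_ifs at h5 <;> omega
      · simp only [sigmaLabel, if_true] at h5
        split_ifs at h5 <;> omega
      · exact hc rfl
      · exact hD rfl
    rw [h.orb_simpleRoot_of_ne hB', h.pairing_orbitSum_orbitSum (h.isOrthOrbit_simpleRoot hB')]
    have h5 := Nat.le_of_dvd (by norm_num) h4
    generalize Function.minimalPeriod (act (sigma c n)) (simpleRoot (0 : Vertex c n)) = p at *
    interval_cases p
    · simp at h4
    · norm_num at h2
    · norm_num at h2
    · norm_num at h4
    · norm_num

end Data
end OrbitFolding

namespace OrbitFolding

set_option linter.unusedSectionVars false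

/-! ### The finite part of the simple root at 0, and transitivity of the finite folded Weyl group.
-/

section Theta

variable {c : FoldCase} {n : ℕ}

theorem sameCycle_zero_iff (hv : IsValid c n) (i : Vertex c n) :
    (sigma c n).SameCycle 0 i ↔ orbitLabel c n i.val = 0 := by
  have h0 : orbitLabel c n (0 : Vertex c n).val = 0 := orbitLabel_zero
  rw [sameCycle_iff hv, h0, eq_comm]

/-- Here θ is the sum of the simple roots off the orbit of 0, and O(α_0) equals the null multiple of
δ minus 2θ. The norm 8 of O(α_0) gives θ norm 2. As θ is fixed, O(θ) is θ in the case A and 2θ in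
the cases B and D, which explains the two values of `thetaFactor`. -/
theorem exists_theta_of_ne_C (hv : IsValid c n) (hc : c ≠ .C) :
    ∃ θ : Lat c n, IsOrthOrbit (form c n) (sigma c n) θ ∧
      (∀ i, (sigma c n).SameCycle 0 i → θ i = 0) ∧
      orb (form c n) (sigma c n) (simpleRoot 0) =
        nullFactor c • delta c n - thetaFactor c • orb (form c n) (sigma c n) θ := by
  have h := isFoldable hv
  set θ : Lat c n := fun i => if orbitLabel c n i.val = 0 then 0 else 1 with hθ
  have hfix : act (sigma c n) θ = θ := by
    funext i
    obtain ⟨j, rfl⟩ := (sigma c n).surjective i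
    have : orbitLabel c n (sigma c n j).val = orbitLabel c n j.val := by
      rw [sigma_val hv, orbitLabel_sigmaLabel hv (by omega)]
    simp only [act, Equiv.symm_apply_apply, hθ, this]
  have h2 : orb (form c n) (sigma c n) (simpleRoot 0) =
      nullFactor c • delta c n + (-2 : ℤ) • θ := by
    funext i
    rw [orb_simpleRoot_zero_apply hv, Pi.add_apply, Pi.smul_apply, Pi.smul_apply, delta_apply]
    simp only [hθ, smul_eq_mul]
    have hrk := hv.le_rk
    by_cases h0 : orbitLabel c n i.val = 0
    · rw [if_pos h0, if_pos h0]
      cases c <;> simp only [nullFactor, deltaLabel, orbitLabel] at h0 ⊢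
      · split_ifs at h0 ⊢ <;> first | rfl | omega
      · split_ifs at h0 ⊢ <;> first | rfl | omega
      · exact absurd rfl hc
      · rfl
    · rw [if_neg h0, if_neg h0]
      cases c <;> simp only [nullFactor, deltaLabel, orbitLabel] at h0 ⊢
      · split_ifs at h0 ⊢ <;> first | rfl | omega
      · split_ifs at h0 ⊢ <;> first | rfl | omega
      · exact absurd rfl hc
      · rfl
  have hq : pairing (form c n) θ θ = 2 := by
    have h3 := norm_orb_simpleRoot_zero hv hc
    rw [h2, h.pairing_add_smul_delta, pairing_smul_left, pairing_smul_right] at h3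
    omega
  have hreal := h.isRealRoot_iff.2 hq
  have hp : Function.minimalPeriod (act (sigma c n)) θ = 1 :=
    Function.minimalPeriod_eq_one_iff_isFixedPt.2 hfix
  refine ⟨θ, ⟨hq, fun k h0 h1 => by omega⟩, fun i hi => if_pos ((sameCycle_zero_iff hv i).1 hi), ?_⟩
  rw [h2]
  by_cases hA : c = .A
  · subst hA
    rw [orb_eq_orbitSum (h.not_isSplit (form_sigma_ne hv) _)
      (fun ⟨γ, hγ, _⟩ => h.not_isSplit (form_sigma_ne hv) γ hγ), orbitSum_of_act_eq hfix]
    simp only [thetaFactor]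
    module
  · rw [(h.isSum_of_act_eq (sigma_apply_ne hv hA) hreal hfix).orb_eq]
    cases c
    · exact absurd rfl hA
    all_goals simp only [thetaFactor]; module

/-- Here θ = α_1 + ⋯ + α_{m-2} with m the rank, so θ and σ θ add up to δ - α_0 - α_m. Since O(α_0)
has norm 4, the two are orthogonal. -/
theorem exists_theta_of_C (hv : IsValid .C n) :
    ∃ θ : Lat .C n, IsOrthOrbit (form .C n) (sigma .C n) θ ∧
      (∀ i, (sigma .C n).SameCycle 0 i → θ i = 0) ∧
      orb (form .C n) (sigma .C n) (simpleRoot 0) =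
        nullFactor .C • delta .C n - thetaFactor .C • orb (form .C n) (sigma .C n) θ := by
  have h := isFoldable hv
  have hrk : 4 ≤ rk .C n := hv.le_rk.2 (by simp)
  -- Partial sums of simple roots along a chain are roots: each new simple root pairs to -1 with the
  -- preceding sum.
  have hreal : ∀ j : ℕ, 1 ≤ j → j + 2 ≤ rk .C n →
      IsRealRoot (form .C n) fun i => if 1 ≤ i.val ∧ i.val ≤ j then 1 else 0 := by
    intro j hj
    induction j, hj using Nat.le_induction with
    | base =>
      intro hj
      have : (fun i : Vertex .C n => if 1 ≤ i.val ∧ i.val ≤ 1 then (1 : ℤ) else 0) =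
          simpleRoot ⟨1, by omega⟩ := by
        funext i
        rw [simpleRoot, Pi.single_apply]
        exact if_congr (by rw [Fin.ext_iff]; simp only; omega) rfl rfl
      rw [this]
      exact .simple _
    | succ j hj ih =>
      intro hj'
      have h1 := ih (by omega)
      have h2 : (fun i : Vertex .C n => if 1 ≤ i.val ∧ i.val ≤ j + 1 then (1 : ℤ) else 0) =
          (fun i => if 1 ≤ i.val ∧ i.val ≤ j then 1 else 0) + simpleRoot ⟨j + 1, by omega⟩ := by
        funext i
        rw [Pi.add_apply, simpleRoot, Pi.single_apply]
        simp only [Fin.ext_iff]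
        split_ifs <;> first | rfl | omega
      have h3 : pairing (form .C n) (fun i => if 1 ≤ i.val ∧ i.val ≤ j then 1 else 0)
          (simpleRoot ⟨j + 1, by omega⟩) = -1 := by
        rw [pairing_simpleRoot_right, Finset.sum_eq_single ⟨j, by omega⟩]
        · rw [form_eq_entry, entry_edge (by simp), if_pos ⟨hj, le_rfl⟩, one_mul]
          simp only [edge, edgeD]
          omega
        · intro i _ hi
          have hi' : i.val ≠ j := fun hh => hi (Fin.ext hh)
          split_ifs with hh
          · rw [form_eq_entry, entry_zero (by simp only; omega), mul_zero]
            simp only [edge, edgeD]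
            omega
          · exact zero_mul _
        · simp
      rw [h2, h.isRealRoot_iff, pairing_add_left, pairing_add_right, pairing_add_right,
        h.comm (simpleRoot _), h3, h.pairing_self_of_isRealRoot h1,
        h.pairing_self_of_isRealRoot (.simple _)]
      norm_num
  obtain ⟨θ, hθ⟩ : ∃ θ : Lat .C n,
      θ = fun i => if 1 ≤ i.val ∧ i.val ≤ rk .C n - 2 then 1 else 0 := ⟨_, rfl⟩
  have hr : IsRealRoot (form .C n) θ := by rw [hθ]; exact hreal _ (by omega) (by omega)
  have hsymm : ∀ i : Vertex .C n, ((sigma .C n).symm i).val = rk .C n - i.val := by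
    intro i
    have h1 := sigma_val hv ((sigma .C n).symm i)
    rw [Equiv.apply_symm_apply] at h1
    simp only [sigmaLabel] at h1
    omega
  have hsum : θ + act (sigma .C n) θ =
      delta .C n + (-1 : ℤ) • orb (form .C n) (sigma .C n) (simpleRoot 0) := by
    funext i
    rw [Pi.add_apply, Pi.add_apply, Pi.smul_apply, orb_simpleRoot_zero_apply hv, delta_apply]
    simp only [act, hθ, hsymm, nullFactor, deltaLabel, orbitLabel, smul_eq_mul]
    have hi : i.val ≤ rk .C n := by omega
    split_ifs <;> first | rfl | omega
  have hss : act (sigma .C n) (act (sigma .C n) θ) = θ := by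
    funext i
    change θ ((sigma .C n).symm ((sigma .C n).symm i)) = θ i
    congr 1
    apply Fin.ext
    rw [hsymm, hsymm]
    omega
  have hne : act (sigma .C n) θ ≠ θ := by
    intro hh
    have h1 := congrFun hh ⟨1, by omega⟩
    simp only [act, hθ, hsymm] at h1
    rw [if_neg (by omega), if_pos (by omega)] at h1
    omega
  have hp : Function.minimalPeriod (act (sigma .C n)) θ = 2 :=
    Function.minimalPeriod_eq_prime hss hne
  have hn0 : pairing (form .C n) (orb (form .C n) (sigma .C n) (simpleRoot 0))
      (orb (form .C n) (sigma .C n) (simpleRoot 0)) = 4 := by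
    refine (h.orb_simpleRoot_pair (sigma_sigma_apply hv (Or.inr (Or.inl rfl)))
      (sigma_apply_ne hv (by simp) _) fun hh => ?_).2
    exact absurd ((form_sigma_zero_iff hv).1 hh) (by simp)
  have hq : pairing (form .C n) (θ + act (sigma .C n) θ) (θ + act (sigma .C n) θ) = 4 := by
    rw [hsum, ← one_smul ℤ (delta .C n), h.pairing_add_smul_delta, pairing_smul_left,
      pairing_smul_right, hn0]
    norm_num
  have hq2 := h.pairing_self_of_isRealRoot hr
  have horth : pairing (form .C n) θ (act (sigma .C n) θ) = 0 := by
    have hq' := hq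
    rw [pairing_add_left, pairing_add_right, pairing_add_right, h.pairing_act,
      h.comm (act _ θ), hq2] at hq'
    omega
  refine ⟨θ, ⟨hq2, fun k h0 h1 => ?_⟩, fun i hi => ?_, ?_⟩
  · obtain rfl : k = 1 := by omega
    exact horth
  · have h1 := (sameCycle_zero_iff hv i).1 hi
    simp only [orbitLabel] at h1
    rw [hθ]
    exact if_neg (by omega)
  · rw [orb_eq_orbitSum (β := θ), orbitSum, hp]
    · simp only [Finset.sum_range_succ, Finset.sum_range_zero, Function.iterate_zero, id_eq,
        Function.iterate_one, zero_add, hsum, nullFactor, thetaFactor]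
      module
    · intro hs
      rw [h.pairing_self_of_isRealRoot hs.2.2] at hq
      omega
    · exact fun hs => hne hs.act_eq

/-- The finite part of the simple root at the orbit of `0`. -/
theorem exists_theta (hv : IsValid c n) :
    ∃ θ : Lat c n, IsOrthOrbit (form c n) (sigma c n) θ ∧
      (∀ i, (sigma c n).SameCycle 0 i → θ i = 0) ∧
      orb (form c n) (sigma c n) (simpleRoot 0) =
        nullFactor c • delta c n - thetaFactor c • orb (form c n) (sigma c n) θ := by
  by_cases hc : c = .C
  · subst hc; exact exists_theta_of_C hv
  · exact exists_theta_of_ne_C hv hc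

/-! ### Transitivity of the folded finite Weyl group on roots of given norm -/

theorem rk_eq (n : ℕ) : rk .A n = 2 * n ∧ rk .B n = 2 * n + 1 ∧ rk .C n = 2 * n + 1 ∧
    rk .D n = 2 * n + 1 := ⟨rfl, rfl, rfl, rfl⟩

theorem orbitLabel_le (i : Vertex c n) : orbitLabel c n i.val ≤ n := by
  have hr := rk_eq n
  have hi : i.val ≤ rk c n := by omega
  cases c <;> simp only [orbitLabel] at hi ⊢ <;> (try split_ifs) <;> omega

theorem orbitLabel_orbitLabel (hv : IsValid c n) (i : Vertex c n) :
    orbitLabel c n (orbitLabel c n i.val) = orbitLabel c n i.val := by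
  have hi : i.val ≤ rk c n := by omega
  have hrk := hv.le_rk
  have hr := rk_eq n
  cases c <;> simp only [orbitLabel] at hi ⊢ <;> (try split_ifs) <;> omega

theorem orb_simpleRoot_of_lt (hv : IsValid c n) {i : Vertex c n}
    (h0 : orbitLabel c n i.val ≠ 0) (hn : orbitLabel c n i.val < n) :
    orb (form c n) (sigma c n) (simpleRoot i) = simpleRoot i + simpleRoot (sigma c n i) ∧
      pairing (form c n) (orb (form c n) (sigma c n) (simpleRoot i))
        (orb (form c n) (sigma c n) (simpleRoot i)) = 4 := by
  have hi : i.val ≤ rk c n := by omega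
  have hrk := hv.le_rk
  have hr := rk_eq n
  refine (isFoldable hv).orb_simpleRoot_pair (sigma_sigma_apply hv (Or.inl h0)) (fun hh => ?_)
    fun hh => ?_
  · have h1 := congrArg Fin.val hh
    rw [sigma_val hv] at h1
    cases c <;> simp only [orbitLabel, sigmaLabel] at * <;> (try split_ifs at *) <;> omega
  · have h1 := (form_sigma_iff hv i).1 hh
    cases c <;> simp only [orbitLabel] at * <;> (try split_ifs at *) <;> omega

/-- At the end of the folded chain the vertex is fixed in the case A, giving norm 2, and its simple
root is split otherwise, giving norm 8. -/
theorem norm_ne_four_of_eq (hv : IsValid c n) {i : Vertex c n}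
    (h0 : orbitLabel c n i.val ≠ 0) (hn : orbitLabel c n i.val = n) :
    pairing (form c n) (orb (form c n) (sigma c n) (simpleRoot i))
        (orb (form c n) (sigma c n) (simpleRoot i)) ≠ 4 := by
  have hi : i.val ≤ rk c n := by omega
  have hrk := hv.le_rk
  have hr := rk_eq n
  have h := isFoldable hv
  by_cases hA : c = .A
  · subst hA
    have hs : sigma .A n i = i := by
      apply Fin.ext
      rw [sigma_val hv]
      simp only [orbitLabel, sigmaLabel] at *
      split_ifs at * <;> omega
    rw [h.orb_simpleRoot_of_ne (form_sigma_ne hv i), orbitSum_of_act_eq (by rw [act_simpleRoot, hs]),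
      pairing_simpleRoot_simpleRoot, h.diag]
    norm_num
  · rw [h.pairing_orb_self_of_isSplit ((h.isSplit_simpleRoot_iff i).2 ((form_sigma_iff hv i).2 ?_))]
    · norm_num
    · cases c
      · exact absurd rfl hA
      all_goals simp only [orbitLabel] at *
      · split_ifs at h0 hn <;> omega
      · omega
      · omega

theorem reach_succ (hv : IsValid c n) {i j : Vertex c n} (hi : orbitLabel c n i.val = i.val)
    (hj : orbitLabel c n j.val = j.val) (h0 : i.val ≠ 0) (hn : j.val < n)
    (hij : j.val = i.val + 1) :
    Reach (form c n) (sigma c n) (fun i => ¬ (sigma c n).SameCycle 0 i)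
      (orb (form c n) (sigma c n) (simpleRoot i)) (orb (form c n) (sigma c n) (simpleRoot j)) := by
  have h := isFoldable hv
  have hrk := hv.le_rk
  have hr := rk_eq n
  obtain ⟨i1, i2⟩ := orb_simpleRoot_of_lt hv (i := i) (by omega) (by omega)
  obtain ⟨j1, j2⟩ := orb_simpleRoot_of_lt hv (i := j) (by omega) (by omega)
  refine h.reach_of_adjacent ?_ ?_ (i2.trans j2.symm) ?_
  · rw [sameCycle_zero_iff hv]; omega
  · rw [sameCycle_zero_iff hv]; omega
  · rw [j2, i1, j1]
    simp only [pairing_add_left, pairing_add_right, pairing_simpleRoot_simpleRoot, h.inv]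
    have e1 : form c n i j = -1 := by
      rw [form_eq_entry, entry_edge (by omega)]
      have hj' : j.val ≤ rk c n := by omega
      cases c <;> simp only [edge, edgeD, edgeA, orbitLabel] at * <;> (try split_ifs at *) <;>
        omega
    have e2 : form c n (sigma c n i) j = 0 := by
      have hj' : j.val ≤ rk c n := by omega
      rw [form_eq_entry, sigma_val hv, entry_zero]
      all_goals
        cases c <;> simp only [edge, edgeD, edgeA, orbitLabel, sigmaLabel] at * <;>
          (try split_ifs at *) <;> omega
    have e3 : form c n i (sigma c n j) = 0 := by
      have hj' : j.val ≤ rk c n := by omega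
      rw [form_eq_entry, sigma_val hv, entry_zero]
      all_goals
        cases c <;> simp only [edge, edgeD, edgeA, orbitLabel, sigmaLabel] at * <;>
          (try split_ifs at *) <;> omega
    rw [e1, e2, e3]
    norm_num

/-- Folded simple roots with labels strictly between 0 and n all have norm 4, and consecutive ones
are conjugate by `reach_of_adjacent`; the last label has a different norm and stands alone. -/
theorem reach_simpleRoot (hv : IsValid c n) (i j : Vertex c n)
    (hi : ¬ (sigma c n).SameCycle 0 i) (hj : ¬ (sigma c n).SameCycle 0 j)
    (hq : pairing (form c n) (orb (form c n) (sigma c n) (simpleRoot i))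
        (orb (form c n) (sigma c n) (simpleRoot i)) =
      pairing (form c n) (orb (form c n) (sigma c n) (simpleRoot j))
        (orb (form c n) (sigma c n) (simpleRoot j))) :
    Reach (form c n) (sigma c n) (fun i => ¬ (sigma c n).SameCycle 0 i)
      (orb (form c n) (sigma c n) (simpleRoot i)) (orb (form c n) (sigma c n) (simpleRoot j)) := by
  have h := isFoldable hv
  have hrk := hv.le_rk
  have hr := rk_eq n
  wlog hle : orbitLabel c n i.val ≤ orbitLabel c n j.val generalizing i j
  · exact IsFoldable.Reach.symm h (this j i hj hi hq.symm (by omega))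
  rw [sameCycle_zero_iff hv] at hi hj
  have hjn := orbitLabel_le j
  rcases hle.eq_or_lt with he | hlt
  · rw [orb_simpleRoot_congr hv he]
    exact Relation.ReflTransGen.refl
  have hjn' : orbitLabel c n j.val < n := by
    refine lt_of_le_of_ne hjn fun he => norm_ne_four_of_eq hv hj he ?_
    rw [← hq]
    exact (orb_simpleRoot_of_lt hv hi (by omega)).2
  have hnrk : n ≤ rk c n := by cases c <;> simp only [rk] <;> omega
  have key : ∀ l, orbitLabel c n i.val ≤ l → ∀ hl : l < n,
      orbitLabel c n l = l ∧ Reach (form c n) (sigma c n) (fun i => ¬ (sigma c n).SameCycle 0 i)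
        (orb (form c n) (sigma c n) (simpleRoot i))
        (orb (form c n) (sigma c n) (simpleRoot ⟨l, by omega⟩)) := by
    intro l hl
    induction l, hl using Nat.le_induction with
    | base =>
      intro hl
      refine ⟨orbitLabel_orbitLabel hv i, ?_⟩
      rw [orb_simpleRoot_congr hv (j := ⟨orbitLabel c n i.val, by omega⟩)
        (orbitLabel_orbitLabel hv i).symm]
      exact Relation.ReflTransGen.refl
    | succ l hl ih =>
      intro hl'
      obtain ⟨h1, h2⟩ := ih (by omega)
      have h3 : orbitLabel c n (l + 1) = l + 1 := by
        cases c <;> simp only [orbitLabel] at * <;> (try split_ifs at *) <;> omega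
      exact ⟨h3, Relation.ReflTransGen.trans h2
        (reach_succ hv h1 h3 (by simp only; omega) hl' rfl)⟩
  obtain ⟨h1, h2⟩ := key _ hlt.le hjn'
  rwa [orb_simpleRoot_congr hv (i := j) (j := ⟨orbitLabel c n j.val, by omega⟩) h1.symm]

theorem reach_of_mem_finSub (hv : IsValid c n) {β γ : Lat c n} (hβ : β ∈ finSub c n)
    (hγ : γ ∈ finSub c n)
    (hq : pairing (form c n) (O c n β) (O c n β) = pairing (form c n) (O c n γ) (O c n γ))
    (hS : pairing (form c n) (O c n γ) (O c n γ) ≠ 0) :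
    Reach (form c n) (sigma c n) (fun i => ¬ (sigma c n).SameCycle 0 i)
      (O c n β) (O c n γ) := by
  rw [mem_finSub_iff] at hβ hγ
  refine (isFoldable hv).reach_orb (fun i hi h1 => hi ?_) (reach_simpleRoot hv) hβ.1
    (fun i hi => hβ.2 i (not_not.1 hi)) hγ.1 (fun i hi => hγ.2 i (not_not.1 hi)) hq hS
  exact (Equiv.Perm.sameCycle_apply_right).1 h1

end Theta
end OrbitFolding

namespace OrbitFolding

set_option linter.unusedSectionVars false

/-! ### Types of roots, norms of finite parts and admissible levels. -/

section Target

variable {c : FoldCase} {n : ℕ}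

theorem delta_zero : delta c n 0 = 1 := by
  rw [delta_apply]
  have h0 : (0 : Vertex c n).val = 0 := rfl
  rw [h0]
  cases c <;> simp [deltaLabel]

theorem O_apply_of_mem_finSub {β : Lat c n} (hβ : β ∈ finSub c n) {i : Vertex c n}
    (hi : (sigma c n).SameCycle 0 i) : O c n β i = 0 := by
  obtain ⟨e, -, he⟩ := exists_orb_eq (form c n) (sigma c n) β
  unfold O
  rw [he, Pi.smul_apply, orbitSum, Finset.sum_apply, Finset.sum_eq_zero, smul_zero]
  intro k _
  rw [iterate_act]
  refine (mem_finSub_iff.1 hβ).2 _ (hi.trans ?_)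
  rw [← Equiv.Perm.sameCycle_pow_right (n := k)]
  simp [Equiv.Perm.SameCycle.refl]

theorem O_apply_zero_of_mem_finSub {β : Lat c n} (hβ : β ∈ finSub c n) : O c n β 0 = 0 :=
  O_apply_of_mem_finSub hβ (Equiv.Perm.SameCycle.refl _ _)

theorem neg_mem_finSub {β : Lat c n} (hβ : β ∈ finSub c n) : -β ∈ finSub c n := by
  rw [mem_finSub_iff] at hβ ⊢
  exact ⟨hβ.1.neg, fun i hi => by rw [Pi.neg_apply, hβ.2 i hi, neg_zero]⟩

theorem O_neg (hv : IsValid c n) (β : Lat c n) : O c n (-β) = -O c n β :=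
  (isFoldable hv).orb_neg β

theorem pairing_uform (hv : IsValid c n) (b : FoldLat c n) :
    pairing (uform c n) b b = pairing (form c n) (iota c n b) (iota c n b) :=
  (isFoldable hv).pairing_foldForm b b

/-- The multiple of a root of the finite folded system in `target c n x`. -/
def Kind.mult : Kind → ℤ
  | .ds1 | .ds2 => 2
  | _ => 1

/-- The norm of the root of the finite folded system attached to a kind. -/
def Kind.norm (c : FoldCase) : Kind → ℤ
  | .s | .s1 | .ds1 | .ds2 => shortNorm c
  | _ => 2 * shortNorm c

theorem Kind.norm_pos (x : Kind) : 0 < x.norm c := by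
  cases x <;> cases c <;> simp [Kind.norm, shortNorm]

theorem Kind.mult_pos (x : Kind) : 0 < x.mult := by
  cases x <;> simp [Kind.mult]

theorem exists_iota_eq_O (hv : IsValid c n) {β : Lat c n} (hβ : IsRealRoot (form c n) β)
    (hq : pairing (form c n) (O c n β) (O c n β) ≠ 0) :
    ∃ y, IsRealRoot (uform c n) y ∧ iota c n y = O c n β :=
  (isFoldable hv).exists_emb_eq_orb hβ (((isFoldable hv).pairing_orb_ne_zero_iff β).1 hq)

/-- All types are described uniformly by a multiple and a norm. For the doubled types, the half of t
is recovered because O(β) lies in the image of the folded lattice. -/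
theorem mem_target_iff (hv : IsValid c n) {x : Kind} {t : FoldLat c n} :
    t ∈ target c n x ↔ ∃ β ∈ finSub c n, 0 ≤ O c n β ∧
      pairing (form c n) (O c n β) (O c n β) = x.norm c ∧ iota c n t = x.mult • O c n β := by
  have key : ∀ b : FoldLat c n, ∀ N : ℤ, N ≠ 0 →
      ((b ∈ foldFin c n ∧ 0 ≤ b ∧ pairing (uform c n) b b = N) ↔ ∃ β ∈ finSub c n, 0 ≤ O c n β ∧
      pairing (form c n) (O c n β) (O c n β) = N ∧ iota c n b = O c n β) := by
    intro b N hN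
    constructor
    · rintro ⟨⟨β, hβ, h1⟩, h2, h3⟩
      refine ⟨β, hβ, ?_, ?_, h1⟩
      · rw [← h1]; exact (emb_nonneg_iff _ _).2 h2
      · rw [← h1, ← pairing_uform hv, h3]
    · rintro ⟨β, hβ, h1, h2, h3⟩
      refine ⟨⟨β, hβ, h3⟩, ?_, ?_⟩
      · rw [← h3] at h1; exact (emb_nonneg_iff _ _).1 h1
      · rw [pairing_uform hv, h3, h2]
  have hs : shortNorm c ≠ 0 := by cases c <;> simp [shortNorm]
  have key2 : t ∈ {b | ∃ a ∈ shortPos c n, b = (2 : ℤ) • a} ↔ ∃ β ∈ finSub c n, 0 ≤ O c n β ∧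
      pairing (form c n) (O c n β) (O c n β) = shortNorm c ∧ iota c n t = (2 : ℤ) • O c n β := by
    constructor
    · rintro ⟨a, ha, rfl⟩
      obtain ⟨β, h1, h2, h3, h4⟩ := (key a _ hs).1 ha
      exact ⟨β, h1, h2, h3, by rw [← h4]; exact emb_smul _ _ _⟩
    · rintro ⟨β, h1, h2, h3, h4⟩
      obtain ⟨a, -, ha⟩ := exists_iota_eq_O hv (mem_finSub_iff.1 h1).1 (by rw [h3]; exact hs)
      refine ⟨a, (key a _ hs).2 ⟨β, h1, h2, h3, ha⟩, emb_injective (form c n) (sigma c n) ?_⟩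
      rw [emb_smul]
      unfold iota at h4 ha
      rw [h4, ha]
  cases x <;> simp only [target, Kind.norm, Kind.mult, one_smul]
  exacts [key t _ hs, key t _ hs, key2, key2, key t _ (by omega), key t _ (by omega),
    key t _ (by omega), key t _ (by omega)]

theorem iota_apply_zero_of_mem_target (hv : IsValid c n) {x : Kind} {t : FoldLat c n}
    (ht : t ∈ target c n x) : iota c n t 0 = 0 := by
  obtain ⟨β, h1, -, -, h4⟩ := (mem_target_iff hv).1 ht
  rw [h4, Pi.smul_apply, O_apply_zero_of_mem_finSub h1, smul_zero]

theorem nonneg_of_mem_target (hv : IsValid c n) {x : Kind} {t : FoldLat c n}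
    (ht : t ∈ target c n x) : 0 ≤ t := by
  obtain ⟨β, h1, h2, -, h4⟩ := (mem_target_iff hv).1 ht
  refine (emb_nonneg_iff (form c n) _).1 ?_
  unfold iota at h4
  rw [h4]
  exact smul_nonneg x.mult_pos.le h2

theorem norm_of_mem_target (hv : IsValid c n) {x : Kind} {t : FoldLat c n}
    (ht : t ∈ target c n x) :
    pairing (form c n) (iota c n t) (iota c n t) = x.mult ^ 2 * x.norm c := by
  obtain ⟨β, h1, h2, h3, h4⟩ := (mem_target_iff hv).1 ht
  rw [h4, pairing_smul_left, pairing_smul_right, h3]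
  ring

theorem norm_pos_of_mem_target (hv : IsValid c n) {x : Kind} {t : FoldLat c n}
    (ht : t ∈ target c n x) :
    0 < pairing (form c n) (iota c n t) (iota c n t) := by
  rw [norm_of_mem_target hv ht]
  have := x.mult_pos
  have := x.norm_pos (c := c)
  positivity

theorem apply_zero_of_eq (hv : IsValid c n) {x : Kind} {t : FoldLat c n}
    (ht : t ∈ target c n x) (k : ℤ) : (k • delta c n + iota c n t) 0 = k := by
  rw [Pi.add_apply, Pi.smul_apply, delta_zero, iota_apply_zero_of_mem_target hv ht]
  simp

/-! ### Coefficients of `δ` -/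

/-- By descent it suffices to treat simple roots. Those off the orbit of 0 have norm 2 or 4, and
O(α_0) = δ - 2 O(θ); reflections fix δ and preserve twice the lattice. -/
theorem exists_eq_delta_add_two_smul (hv : IsValid .A n) {β : Lat .A n}
    (hβ : IsRealRoot (form .A n) β) (hq : pairing (form .A n) (O .A n β) (O .A n β) = 8) :
    ∃ u, O .A n β = delta .A n + (2 : ℤ) • u := by
  have h := isFoldable hv
  unfold O at hq ⊢
  refine h.descent (J := fun _ => True) (fun _ _ => trivial)
    (P := fun β => pairing (form .A n) (orb (form .A n) (sigma .A n) β)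
      (orb (form .A n) (sigma .A n) β) = 8 →
        ∃ u, orb (form .A n) (sigma .A n) β = delta .A n + (2 : ℤ) • u)
    ?_ ?_ ?_ ?_ hβ (fun _ hi => absurd trivial hi)
    ((h.pairing_orb_ne_zero_iff β).1 (by rw [hq]; norm_num)) hq
  · intro i _ h8
    by_cases h0 : (sigma .A n).SameCycle 0 i
    · obtain ⟨θ, -, -, h3⟩ := exists_theta hv
      have h4 : orbitLabel .A n (0 : Vertex .A n).val = 0 := orbitLabel_zero
      rw [orb_simpleRoot_congr hv (j := 0) (((sameCycle_zero_iff hv i).1 h0).trans h4.symm), h3]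
      refine ⟨-orb (form .A n) (sigma .A n) θ, ?_⟩
      simp only [nullFactor, thetaFactor]
      module
    · have h1 : simpleRoot i ∈ finSub .A n := mem_finSub_iff.2 ⟨.simple i, fun j hj => by
        rw [simpleRoot, Pi.single_apply, if_neg]
        rintro rfl
        exact h0 hj⟩
      rcases norm_of_mem_finSub_A hv h1 (by unfold O; rw [h8]; norm_num) with h2 | h2 <;>
      · unfold O at h2; omega
  · exact fun i _ hi => absurd hi (form_sigma_ne hv i)
  · intro i _ β _ ih h8
    have hth := h.isOrthOrbit_orbitRoot i
    obtain ⟨u, hu⟩ := ih (by rw [h.orb_orbitRefl hth, h.pairing_orbitRefl hth, h8])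
    refine ⟨orbitRefl (form .A n) (sigma .A n) (orbitRoot (form .A n) (sigma .A n) i) u, ?_⟩
    have h1 := h.orbitRefl_add_smul_delta hth 1 2 u
    rw [one_smul, ← hu, h.orb_orbitRefl hth, h.orbitRefl_orbitRefl hth] at h1
    rw [h1]
  · intro β _ ih h8
    rw [h.orb_neg, pairing_neg_left, pairing_neg_right, neg_neg] at h8
    obtain ⟨u, hu⟩ := ih h8
    refine ⟨-delta .A n - u, ?_⟩
    rw [h.orb_neg, hu]
    module

theorem odd_of_norm_eight_A (hv : IsValid .A n) {β : Lat .A n}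
    (hβ : IsRealRoot (form .A n) β) (hq : pairing (form .A n) (O .A n β) (O .A n β) = 8) :
    Odd (O .A n β 0) := by
  obtain ⟨u, hu⟩ := exists_eq_delta_add_two_smul hv hβ hq
  rw [hu, Pi.add_apply, Pi.smul_apply, delta_zero]
  exact ⟨u 0, by simp; ring⟩

theorem minimalPeriod_dvd_two_of_CD (hv : IsValid c n) (hc : c = .C ∨ c = .D) (β : Lat c n) :
    Function.minimalPeriod (act (sigma c n)) β ∣ 2 :=
  minimalPeriod_dvd_two fun _ hi => absurd (sigma_sigma_apply hv (Or.inr hc)) hi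

theorem isSplit_or_isSum_of_CD (hv : IsValid c n) (hc : c = .C ∨ c = .D) {β : Lat c n}
    (hβ : IsRealRoot (form c n) β) (hq : pairing (form c n) (O c n β) (O c n β) = 8) :
    IsSplit (form c n) (sigma c n) β ∨ IsSum (form c n) (sigma c n) β := by
  have hA : c ≠ .A := by rintro rfl; simp at hc
  rcases shift_of_ne_A hv hA hβ (by omega) with h1 | h1 | h1
  · exact h1
  · omega
  · have h2 := Nat.le_of_dvd (by norm_num) (minimalPeriod_dvd_two_of_CD hv hc β)
    omega

/-- Every vector of the embedded folded lattice has even coefficient at 0, since O(α_0) has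
coefficient 2 there. -/
theorem even_of_D (hv : IsValid .D n) {β : Lat .D n} (hβ : IsRealRoot (form .D n) β)
    (hq : pairing (form .D n) (O .D n β) (O .D n β) ≠ 0) : Even (O .D n β 0) := by
  obtain ⟨y, -, hy⟩ := exists_iota_eq_O hv hβ hq
  have h0 : orbitLabel .D n (0 : Vertex .D n).val = 0 := orbitLabel_zero
  rw [← hy, iota, emb_apply, orb_simpleRoot_zero_apply hv, if_pos h0]
  exact ⟨y _, mul_two _⟩

theorem norm_of_mem_finSub (hv : IsValid c n) {β : Lat c n} (hβ : β ∈ finSub c n)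
    (hq : pairing (form c n) (O c n β) (O c n β) ≠ 0) :
    pairing (form c n) (O c n β) (O c n β) = shortNorm c ∨
      pairing (form c n) (O c n β) (O c n β) = 2 * shortNorm c := by
  cases c
  · exact norm_of_mem_finSub_A hv hβ hq
  all_goals exact norm_of_ne_A hv (by simp) (mem_finSub_iff.1 hβ).1 hq

/-- The type is read off from the norm of O(γ), the factor f and the residue of k. The excluded
residues are ruled out by parity of the coefficient at 0: odd for the doubled roots in A, even for
long roots in C, and even for all roots in D. -/
theorem exists_occurs (hv : IsValid c n) {β γ : Lat c n} {k f : ℤ}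
    (hβ : IsRealRoot (form c n) β) (hγ : γ ∈ finSub c n) (h0 : 0 ≤ O c n γ)
    (hf : f = 1 ∨ f = thetaFactor c)
    (hq : pairing (form c n) (O c n β) (O c n β) ≠ 0) (hO : O c n β = k • delta c n + f • O c n γ) :
    ∃ x, Occurs c x k ∧ ∃ t ∈ target c n x, O c n β = k • delta c n + iota c n t := by
  have h := isFoldable hv
  have hk : O c n β 0 = k := by
    rw [hO, Pi.add_apply, Pi.smul_apply, Pi.smul_apply, delta_zero, O_apply_zero_of_mem_finSub hγ]
    simp
  have hn : pairing (form c n) (O c n β) (O c n β) =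
      f * (f * pairing (form c n) (O c n γ) (O c n γ)) := by
    rw [hO, h.pairing_add_smul_delta, pairing_smul_left, pairing_smul_right]
  have hγq : pairing (form c n) (O c n γ) (O c n γ) ≠ 0 := by
    intro h1
    rw [h1] at hn
    simp at hn
    exact hq hn
  obtain ⟨a, -, ha⟩ := exists_iota_eq_O hv (mem_finSub_iff.1 hγ).1 hγq
  have hγn := norm_of_mem_finSub hv hγ hγq
  suffices ∃ x, Occurs c x k ∧ pairing (form c n) (O c n γ) (O c n γ) = x.norm c ∧ f = x.mult by
    obtain ⟨x, h1, h2, h3⟩ := this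
    have h4 : iota c n (f • a) = f • O c n γ := by rw [← ha]; exact emb_smul _ _ _
    exact ⟨x, h1, f • a, (mem_target_iff hv).2 ⟨γ, hγ, h0, h2, by rw [h4, h3]⟩, by rw [h4, hO]⟩
  generalize pairing (form c n) (O c n γ) (O c n γ) = N at hn hγn
  have hk2 : k % 2 = 0 ∨ k % 2 = 1 := by omega
  have hk4 : k % 4 = 0 ∨ k % 4 = 1 ∨ k % 4 = 2 ∨ k % 4 = 3 := by omega
  cases c <;> simp only [thetaFactor, shortNorm] at hf hγn
  -- The bound 8 excludes the double of a long root, whose norm would be 16.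
  · have hβn : pairing (form .A n) (O .A n β) (O .A n β) ≤ 8 := by
      rcases shift_of_A hv hβ hq with h1 | h1 | h1 <;> omega
    rcases hf with rfl | rfl
    · rcases hγn with rfl | rfl
      · exact ⟨.s, trivial, rfl, rfl⟩
      · rcases hk2 with h2 | h2
        · exact ⟨.l, h2, rfl, rfl⟩
        · exact ⟨.l1, h2, rfl, rfl⟩
    · obtain rfl : N = 2 := by omega
      have h3 := odd_of_norm_eight_A hv hβ (by omega)
      rw [hk, Int.odd_iff] at h3
      have hk4' : k % 4 = 1 ∨ k % 4 = 3 := by omega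
      rcases hk4' with h2 | h2
      · exact ⟨.ds1, h2, rfl, rfl⟩
      · exact ⟨.ds2, h2, rfl, rfl⟩
  · obtain rfl : f = 1 := by omega
    rcases hγn with rfl | rfl
    · rcases hk2 with h2 | h2
      · exact ⟨.s, h2, rfl, rfl⟩
      · exact ⟨.s1, h2, rfl, rfl⟩
    · rcases hk4 with h2 | h2 | h2 | h2
      · exact ⟨.l, h2, rfl, rfl⟩
      · exact ⟨.l1, h2, rfl, rfl⟩
      · exact ⟨.l2, h2, rfl, rfl⟩
      · exact ⟨.l3, h2, rfl, rfl⟩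
  · obtain rfl : f = 1 := by omega
    rcases hγn with rfl | rfl
    · rcases hk2 with h2 | h2
      · exact ⟨.s, h2, rfl, rfl⟩
      · exact ⟨.s1, h2, rfl, rfl⟩
    · have h3 := even_O_of_isSplit_or_isSum
        (isSplit_or_isSum_of_CD hv (Or.inl rfl) hβ (by omega)) 0
      rw [hk, Int.even_iff] at h3
      have hk4' : k % 4 = 0 ∨ k % 4 = 2 := by omega
      rcases hk4' with h2 | h2
      · exact ⟨.l, h2, rfl, rfl⟩
      · exact ⟨.l2, h2, rfl, rfl⟩
  · obtain rfl : f = 1 := by omega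
    have h3 := even_of_D hv hβ hq
    rw [hk, Int.even_iff] at h3
    rcases hγn with rfl | rfl
    · exact ⟨.s, h3, rfl, rfl⟩
    · have hk4' : k % 4 = 0 ∨ k % 4 = 2 := by omega
      rcases hk4' with h2 | h2
      · exact ⟨.l, h2, rfl, rfl⟩
      · exact ⟨.l2, h2, rfl, rfl⟩

/-- Up to sign, the image of a real root is `k δ + ι(t)` for some occurring kind. -/
theorem exists_occurs_or_neg (hv : IsValid c n) {β : Lat c n} (hβ : IsRealRoot (form c n) β)
    (hq : pairing (form c n) (O c n β) (O c n β) ≠ 0) :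
    ∃ x k, Occurs c x k ∧ ∃ t ∈ target c n x,
      O c n β = k • delta c n + iota c n t ∨ O c n β = -(k • delta c n + iota c n t) := by
  have h := isFoldable hv
  obtain ⟨θ, h1, h2, h3⟩ := exists_theta hv
  obtain ⟨y, hy, hyO⟩ := exists_iota_eq_O hv hβ hq
  obtain ⟨k, f, γ, h4, h5, h6, h7⟩ := h.exists_finite_part h1 h2 h3 hy
  have hγ : γ ∈ finSub c n := mem_finSub_iff.2 ⟨h4, h5⟩
  have hO : O c n β = k • delta c n + f • O c n γ := hyO.symm.trans h7
  rcases h.nonneg_or_nonpos (h.pairing_self_of_isRealRoot h4) with h8 | h8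
  · obtain ⟨x, h9, t, ht, h10⟩ := exists_occurs hv hβ hγ (orb_nonneg _ h8) h6 hq hO
    exact ⟨x, k, h9, t, ht, Or.inl h10⟩
  · obtain ⟨x, h9, t, ht, h10⟩ := exists_occurs hv (k := -k) hβ.neg (neg_mem_finSub hγ)
      (orb_nonneg _ (neg_nonneg.2 h8)) h6
      (by rwa [O_neg hv, pairing_neg_left, pairing_neg_right, neg_neg])
      (by rw [O_neg hv, O_neg hv, hO]; module)
    exact ⟨x, -k, h9, t, ht, Or.inr (by rw [← h10, O_neg hv, neg_neg])⟩

end Target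
end OrbitFolding

namespace OrbitFolding

set_option linter.unusedSectionVars false

/-! ### Existence of roots of every occurring type at its base level. -/

section Level

variable {c : FoldCase} {n : ℕ}

theorem exists_mem_sigmaPos (hv : IsValid c n) {x : Kind} {t : FoldLat c n} (ht : t ∈ target c n x)
    {γ : Lat c n} (hγ : IsRealRoot (form c n) γ)
    (hO : O c n γ = x.level • delta c n + iota c n t) {P : ℤ}
    (hP : HasShift (form c n) (delta c n) (sigma c n) γ P) (hlt : x.level < P) :
    ∃ α ∈ sigmaPos c n x, O c n α = x.level • delta c n + iota c n t ∧
      HasShift (form c n) (delta c n) (sigma c n) α P := by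
  have h := isFoldable hv
  have h0 : 0 ≤ O c n γ := by
    rw [hO]
    refine add_nonneg (smul_nonneg ?_ fun i => (h.pos i).le)
      ((emb_nonneg_iff _ _).2 (nonneg_of_mem_target hv ht))
    cases x <;> simp [Kind.level]
  have hq : pairing (form c n) (O c n γ) (O c n γ) ≠ 0 := by
    rw [hO, h.pairing_add_smul_delta]
    exact (norm_pos_of_mem_target hv ht).ne'
  obtain ⟨α, h1, h2, h3, h4, h5⟩ := h.exists_apply_eq_zero hγ h0 hq hP
    (lt_of_eq_of_lt ((congrFun hO 0).trans (apply_zero_of_eq hv ht _)) hlt)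
  have h6 : O c n α = x.level • delta c n + iota c n t := h4.trans hO
  exact ⟨α, ⟨⟨h1, h2, h3⟩, t, ht, h6⟩, h6, h5⟩

/-- The norm of the image of the root of the finite folded system attached to the vertex `0`. -/
def thetaNorm : FoldCase → ℤ
  | .A => 2
  | .C => 4
  | _ => 8

theorem norm_orb_theta (hv : IsValid c n) {θ : Lat c n}
    (hθ : orb (form c n) (sigma c n) (simpleRoot 0) =
        nullFactor c • delta c n - thetaFactor c • O c n θ) :
    pairing (form c n) (O c n θ) (O c n θ) = thetaNorm c := by
  have h := isFoldable hv
  have h1 : pairing (form c n) (orb (form c n) (sigma c n) (simpleRoot 0))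
      (orb (form c n) (sigma c n) (simpleRoot 0)) =
      thetaFactor c * (thetaFactor c * pairing (form c n) (O c n θ) (O c n θ)) := by
    rw [hθ, sub_eq_add_neg, ← neg_smul, h.pairing_add_smul_delta, pairing_smul_left,
      pairing_smul_right]
    ring
  by_cases hC : c = .C
  · subst hC
    rw [(h.orb_simpleRoot_pair (sigma_sigma_apply hv (Or.inr (Or.inl rfl)))
      (sigma_apply_ne hv (by simp) _) fun hh =>
        absurd ((form_sigma_zero_iff hv).1 hh) (by simp)).2] at h1
    simp only [thetaFactor, thetaNorm] at h1 ⊢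
    omega
  · rw [norm_orb_simpleRoot_zero hv hC] at h1
    cases c <;> simp only [thetaFactor, thetaNorm] at h1 ⊢ <;> first | omega | exact absurd rfl hC

/-- Roots of level `1` and `3` obtained from the vertex `0`. -/
theorem exists_level_one_three (hv : IsValid c n) (hD : c ≠ .D) {β : Lat c n} (hβ : β ∈ finSub c n)
    (hq : pairing (form c n) (O c n β) (O c n β) = thetaNorm c) :
    (∃ γ, IsRealRoot (form c n) γ ∧
      O c n γ = (1 : ℤ) • delta c n + thetaFactor c • O c n β) ∧
    (c ≠ .C → ∃ γ, IsRealRoot (form c n) γ ∧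
      O c n γ = (3 : ℤ) • delta c n + thetaFactor c • O c n β) := by
  have h := isFoldable hv
  obtain ⟨θ, h1, h2, h3⟩ := exists_theta hv
  have hnf : nullFactor c = 1 := by cases c <;> first | rfl | exact absurd rfl hD
  have hθ : θ ∈ finSub c n := mem_finSub_iff.2 ⟨h.isRealRoot_iff.2 h1.1, h2⟩
  have hqθ := norm_orb_theta hv h3
  have hpos : pairing (form c n) (O c n β) (O c n β) ≠ 0 := by
    rw [hq]; cases c <;> simp [thetaNorm]
  constructor
  · have hr := reach_of_mem_finSub hv (neg_mem_finSub hθ) hβ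
      (by rw [O_neg hv, pairing_neg_left, pairing_neg_right, neg_neg, hqθ, hq]) hpos
    -- The image of α_0 is δ plus a multiple of O(-θ), and -θ is then moved to β.
    refine IsFoldable.Reach.exists_orb_eq h hr (.simple 0) ?_
    rw [h3, hnf, O_neg hv]
    unfold O
    module
  · intro hC
    have hr := reach_of_mem_finSub hv hθ hβ (by rw [hqθ, hq]) hpos
    have h8 := norm_orb_simpleRoot_zero hv hC
    have hs := (hasShift_of_odd hv (.simple 0) h8 (i := 0) (by
      have h0 : orbitLabel c n (0 : Vertex c n).val = 0 := orbitLabel_zero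
      unfold O
      rw [orb_simpleRoot_zero_apply hv, if_pos h0, hnf]
      exact odd_one)).2 (-1)
    -- The step at α_0 is 4, so α_0 - δ has level 1 - 4 = -3; negation gives level 3 with finite
    -- part θ.
    refine IsFoldable.Reach.exists_orb_eq h (β := -(simpleRoot 0 + (-1 : ℤ) • delta c n)) hr
      ((h.isRealRoot_add_delta _ _).2 (.simple 0)).neg ?_
    rw [h.orb_neg, hs, h3, hnf]
    unfold O
    module

/-- Roots of level `1` obtained by reflecting the neighbour of the vertex `0`. -/
theorem exists_level_one_of_norm_four (hv : IsValid c n) (hc : c = .A ∨ c = .B) {β : Lat c n}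
    (hβ : β ∈ finSub c n) (hq : pairing (form c n) (O c n β) (O c n β) = 4) :
    ∃ γ, IsRealRoot (form c n) γ ∧ O c n γ = (1 : ℤ) • delta c n + (1 : ℤ) • O c n β := by
  have h := isFoldable hv
  have hC : c ≠ .C := by rintro rfl; simp at hc
  have hD : c ≠ .D := by rintro rfl; simp at hc
  have hrk := hv.le_rk.2 hD
  have hr := rk_eq n
  have h0 : orbitLabel c n (0 : Vertex c n).val = 0 := orbitLabel_zero
  have hnf : nullFactor c = 1 := by cases c <;> first | rfl | exact absurd rfl hD
  obtain ⟨i, hi, hri⟩ := h.exists_reach_orb_simpleRoot (J := fun i => ¬ (sigma c n).SameCycle 0 i)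
    (fun i hi h1 => hi (Equiv.Perm.sameCycle_apply_right.1 h1)) (mem_finSub_iff.1 hβ).1
    (fun i hi => (mem_finSub_iff.1 hβ).2 i (not_not.1 hi))
    ((h.pairing_orb_ne_zero_iff β).1 (by unfold O at hq; rw [hq]; norm_num))
  rw [sameCycle_zero_iff hv] at hi
  have hi4 : pairing (form c n) (orb (form c n) (sigma c n) (simpleRoot i))
      (orb (form c n) (sigma c n) (simpleRoot i)) = 4 :=
    (IsFoldable.Reach.pairing_eq h hri).symm.trans hq
  have hin : orbitLabel c n i.val < n :=
    lt_of_le_of_ne (orbitLabel_le i) fun he => norm_ne_four_of_eq hv hi he hi4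
  have hi2 : 2 ≤ orbitLabel c n i.val := by
    rcases hc with rfl | rfl <;> simp only [orbitLabel] at hi ⊢ <;> split_ifs at hi ⊢ <;> omega
  -- An image of norm 4 forces a folded simple root with label between 2 and n - 1, hence n > 2, so
  -- the neighbour 2 of the vertex 0 also has norm 4.
  obtain ⟨j, hj⟩ : ∃ j : Vertex c n, j.val = 2 :=
    ⟨⟨2, by omega⟩, rfl⟩
  have hj2 : orbitLabel c n j.val = 2 := by
    rcases hc with rfl | rfl <;> simp only [orbitLabel] <;> split_ifs <;> omega
  obtain ⟨j1, j2⟩ := orb_simpleRoot_of_lt hv (i := j) (by omega) (by omega)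
  have hB' : form c n 0 (sigma c n 0) ≠ -1 := fun h1 => hD ((form_sigma_zero_iff hv).1 h1)
  have h8 := norm_orb_simpleRoot_zero hv hC
  have e1 : form c n j 0 = -1 := by
    rw [form_eq_entry]
    have hv0 : (0 : Vertex c n).val = 0 := rfl
    rw [hv0, entry_edge (by omega)]
    rcases hc with rfl | rfl <;> simp only [edge, edgeD] <;> omega
  have e2 : form c n (sigma c n j) 0 = 0 := by
    rw [form_eq_entry, sigma_val hv]
    have hv0 : (0 : Vertex c n).val = 0 := rfl
    rw [hv0, entry_zero]
    all_goals rcases hc with rfl | rfl <;> simp only [edge, edgeD, sigmaLabel] <;>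
      split_ifs <;> omega
  have hp : pairing (form c n) (orb (form c n) (sigma c n) (simpleRoot j))
      (orb (form c n) (sigma c n) (simpleRoot 0)) = -4 := by
    have h9 := h8
    rw [h.orb_simpleRoot_of_ne hB', h.pairing_orbitSum_orbitSum (h.isOrthOrbit_simpleRoot hB')] at h9
    rw [h.orb_simpleRoot_of_ne hB', h.pairing_orbitSum_of_act_eq _ (act_orb _ _), j1,
      pairing_add_left, pairing_simpleRoot_simpleRoot, pairing_simpleRoot_simpleRoot, e1, e2]
    omega
  have hth := h.isOrthOrbit_orbitRoot (0 : Vertex c n)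
  -- Reflecting at the orbit of 0 adds O(α_0) once, since the pairing is -4 and O(α_0) has norm 8.
  -- This produces coefficient 1 at the vertex 0.
  have e3 : O c n (orbitRefl (form c n) (sigma c n) (orbitRoot (form c n) (sigma c n) 0)
      (simpleRoot j)) = orb (form c n) (sigma c n) (simpleRoot j) +
        orb (form c n) (sigma c n) (simpleRoot 0) := by
    unfold O
    rw [h.orb_orbitRefl hth, ← h.sub_smul_orb_simpleRoot (k := -1) (act_orb _ _)
      (by rw [hp, h8]; norm_num)]
    module
  have hγ := (h.isRealRoot_orbitRefl hth (simpleRoot j)).2 (.simple j)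
  generalize orbitRefl (form c n) (sigma c n) (orbitRoot (form c n) (sigma c n) 0)
    (simpleRoot j) = γ at e3 hγ
  have hγ4 : pairing (form c n) (O c n γ) (O c n γ) = 4 := by
    rw [e3, pairing_add_left, pairing_add_right, pairing_add_right,
      h.comm (orb _ _ (simpleRoot 0)), hp, h8, j2]
    norm_num
  obtain ⟨θ, h1, h2, h3⟩ := exists_theta hv
  obtain ⟨y, hy, hyO⟩ := exists_iota_eq_O hv hγ (by omega)
  obtain ⟨k, f, β', h4, h5, h6, h7⟩ := h.exists_finite_part h1 h2 h3 hy
  have hβ' : β' ∈ finSub c n := mem_finSub_iff.2 ⟨h4, h5⟩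
  have hO : O c n γ = k • delta c n + f • O c n β' := hyO.symm.trans h7
  have hk : k = 1 := by
    have h10 := congrFun e3 0
    have h11 : orb (form c n) (sigma c n) (simpleRoot j) 0 = 0 :=
      orb_simpleRoot_apply_eq_zero _ fun hs => by
        have := (sameCycle_zero_iff hv j).1 hs.symm
        omega
    rw [hO, Pi.add_apply, Pi.add_apply, Pi.smul_apply, Pi.smul_apply, delta_zero,
      O_apply_zero_of_mem_finSub hβ', h11, orb_simpleRoot_zero_apply hv, if_pos h0, hnf] at h10
    simpa using h10
  have hn : f * (f * pairing (form c n) (O c n β') (O c n β')) = 4 := by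
    rw [← hγ4, hO, h.pairing_add_smul_delta, pairing_smul_left, pairing_smul_right]
  -- The factor 2 in the case A would require a finite image of norm 1.
  have hf : f = 1 := by
    rcases h6 with h6 | h6
    · exact h6
    rcases hc with rfl | rfl
    · exfalso
      simp only [thetaFactor] at h6
      subst h6
      rcases norm_of_mem_finSub_A hv hβ' (by intro h0; rw [h0] at hn; omega) with h12 | h12 <;> omega
    · exact h6
  subst hf hk
  have hn' : pairing (form c n) (O c n β') (O c n β') = 4 := by omega
  exact IsFoldable.Reach.exists_orb_eq h
    (reach_of_mem_finSub hv hβ' hβ (by rw [hn', hq]) (by omega)) hγ hO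

/-- Roots of level `2`. -/
theorem exists_level_two (hv : IsValid c n) (hA : c ≠ .A) {β : Lat c n}
    (hβ : β ∈ finSub c n) (hq : pairing (form c n) (O c n β) (O c n β) = 8) :
    ∃ γ, IsRealRoot (form c n) γ ∧ O c n γ = (2 : ℤ) • delta c n + O c n β ∧
      HasShift (form c n) (delta c n) (sigma c n) γ 4 := by
  have h := isFoldable hv
  obtain ⟨g, hg⟩ : ∃ g, IsSum (form c n) (sigma c n) g ∧ O c n β = (2 : ℤ) • g := by
    rcases isSplit_or_isSum_of_mem_finSub hv hA hβ hq with hs | hs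
    · exact ⟨_, hs.isSum, hs.orb_eq⟩
    · exact ⟨_, hs, hs.orb_eq⟩
  have hreal : IsRealRoot (form c n) g := by
    obtain ⟨γ, hγ, rfl⟩ := hg.1
    exact hγ.2.2
  -- Here g is a fixed real root with O(β) = 2g. Then g + δ is a fixed real root, so it is γ + σ γ
  -- with γ split, and O(γ) = 2(g + δ).
  obtain ⟨γ, hγ, h1⟩ := h.isSum_of_act_eq (sigma_apply_ne hv hA) (β := g + (1 : ℤ) • delta c n)
    ((h.isRealRoot_add_delta _ _).2 hreal) (by rw [h.act_add_delta, hg.1.act_eq])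
  refine ⟨γ, hγ.1, ?_, h.hasShift_of_isSplit hγ⟩
  rw [hg.2, O, hγ.orb_eq, ← h1]
  module

/-- Besides a root at the base level, a step P is produced that exceeds the base level, so that the
root can be rotated into Δ_0^+, and that divides the distance to every occurring level, so that
translations reach all of them. -/
theorem exists_real_of_occurs (hv : IsValid c n) {x : Kind} {k₀ : ℤ} (hx : Occurs c x k₀)
    {t : FoldLat c n} (ht : t ∈ target c n x) :
    ∃ γ, IsRealRoot (form c n) γ ∧ O c n γ = x.level • delta c n + iota c n t ∧
      ∃ P, x.level < P ∧ HasShift (form c n) (delta c n) (sigma c n) γ P ∧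
        ∀ k, Occurs c x k → P ∣ k - x.level := by
  have h := isFoldable hv
  obtain ⟨β, hβ, -, hN, hι⟩ := (mem_target_iff hv).1 ht
  have hβr := (mem_finSub_iff.1 hβ).1
  have hodd : ∀ {γ : Lat c n} {k : ℤ}, IsRealRoot (form c n) γ →
      O c n γ = k • delta c n + iota c n t → k % 2 = 1 →
      pairing (form c n) (iota c n t) (iota c n t) = 8 →
      HasShift (form c n) (delta c n) (sigma c n) γ 4 := by
    intro γ k hγ hO hk h8
    refine hasShift_of_odd hv hγ (by rw [hO, h.pairing_add_smul_delta, h8]) (i := 0) ?_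
    rw [hO, apply_zero_of_eq hv ht, Int.odd_iff, hk]
  have hfour : ∀ {γ : Lat c n} {k : ℤ}, IsRealRoot (form c n) γ →
      O c n γ = k • delta c n + iota c n t →
      pairing (form c n) (iota c n t) (iota c n t) = 4 →
      HasShift (form c n) (delta c n) (sigma c n) γ 2 := fun hγ hO h4 =>
    hasShift_of_norm_four hv hγ (by rw [hO, h.pairing_add_smul_delta, h4])
  have hnorm : pairing (form c n) (iota c n t) (iota c n t) = x.mult ^ 2 * x.norm c :=
    norm_of_mem_target hv ht
  have hzero : x.mult = 1 → O c n β = (0 : ℤ) • delta c n + iota c n t := by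
    intro hm; rw [hι, hm]; module
  -- The auxiliary statements separate the constructions: level 0 uses β itself, level 2 a split
  -- root, and at odd levels with norm 8 the odd coefficient at 0 forces the step 4.
  have h0 : x.mult = 1 → x.norm c = 4 → x.level = 0 → (∀ k, Occurs c x k → 2 ∣ k) →
      ∃ γ, IsRealRoot (form c n) γ ∧ O c n γ = x.level • delta c n + iota c n t ∧
        ∃ P, x.level < P ∧ HasShift (form c n) (delta c n) (sigma c n) γ P ∧
          ∀ k, Occurs c x k → P ∣ k - x.level := by
    intro h1 h2 h3 h4
    rw [h3]
    exact ⟨β, hβr, hzero h1, 2, by norm_num, hfour hβr (hzero h1) (by rw [hnorm, h1, h2]; norm_num),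
      fun k hk => by rw [sub_zero]; exact h4 k hk⟩
  have h0' : x.mult = 1 → x.norm c = 8 → x.level = 0 → (∀ k, Occurs c x k → 4 ∣ k) →
      ∃ γ, IsRealRoot (form c n) γ ∧ O c n γ = x.level • delta c n + iota c n t ∧
        ∃ P, x.level < P ∧ HasShift (form c n) (delta c n) (sigma c n) γ P ∧
          ∀ k, Occurs c x k → P ∣ k - x.level := by
    intro h1 h2 h3 h4
    obtain ⟨P, hP, hd, hs⟩ := exists_hasShift_of_norm_eight hv hβr (by rw [hN, h2])
    rw [h3]
    exact ⟨β, hβr, hzero h1, P, hP, hs, fun k hk => by rw [sub_zero]; exact hd.trans (h4 k hk)⟩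
  have h2' : c ≠ .A → x.mult = 1 → x.norm c = 8 → x.level = 2 →
      (∀ k, Occurs c x k → k % 4 = 2) →
      ∃ γ, IsRealRoot (form c n) γ ∧ O c n γ = x.level • delta c n + iota c n t ∧
        ∃ P, x.level < P ∧ HasShift (form c n) (delta c n) (sigma c n) γ P ∧
          ∀ k, Occurs c x k → P ∣ k - x.level := by
    intro hA h1 h2 h3 h4
    obtain ⟨γ, hγ, hO, hs⟩ := exists_level_two hv hA hβ (by rw [hN, h2])
    rw [h3]
    refine ⟨γ, hγ, by rw [hO, hι, h1, one_smul], 4, by norm_num, hs, fun k hk => ?_⟩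
    have := h4 k hk
    omega
  have h13 : ∀ j, (∃ γ, IsRealRoot (form c n) γ ∧
        O c n γ = j • delta c n + x.mult • O c n β) → j % 2 = 1 → j < 4 →
      x.mult ^ 2 * x.norm c = 8 → x.level = j → (∀ k, Occurs c x k → k % 4 = j % 4) →
      ∃ γ, IsRealRoot (form c n) γ ∧ O c n γ = x.level • delta c n + iota c n t ∧
        ∃ P, x.level < P ∧ HasShift (form c n) (delta c n) (sigma c n) γ P ∧
          ∀ k, Occurs c x k → P ∣ k - x.level := by
    rintro j ⟨γ, hγ, hO⟩ hj hj4 h8 hl h4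
    rw [hl]
    rw [← hι] at hO
    refine ⟨γ, hγ, hO, 4, hj4, hodd hγ hO hj (by rw [hnorm, h8]), fun k hk => ?_⟩
    have := h4 k hk
    omega
  have h1' : (∃ γ, IsRealRoot (form c n) γ ∧ O c n γ = (1 : ℤ) • delta c n + (1 : ℤ) • O c n β) →
      x.mult = 1 → x.norm c = 4 → x.level = 1 → (∀ k, Occurs c x k → k % 2 = 1) →
      ∃ γ, IsRealRoot (form c n) γ ∧ O c n γ = x.level • delta c n + iota c n t ∧
        ∃ P, x.level < P ∧ HasShift (form c n) (delta c n) (sigma c n) γ P ∧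
          ∀ k, Occurs c x k → P ∣ k - x.level := by
    rintro ⟨γ, hγ, hO⟩ h1 h2 h3 h4
    rw [h3]
    replace hO : O c n γ = (1 : ℤ) • delta c n + iota c n t := by rw [hO, hι, h1]
    refine ⟨γ, hγ, hO, 2, by norm_num, hfour hγ hO (by rw [hnorm, h1, h2]; norm_num),
      fun k hk => ?_⟩
    have := h4 k hk
    omega
  have hmod : ∀ {k d r : ℤ}, k ≡ r [ZMOD d] → k % d = r % d := fun hk => hk
  cases c
  · cases x <;> first | exact hx.elim | skip
    · rcases shift_of_A hv hβr (by rw [hN]; exact two_ne_zero) with h1 | h1 | h1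
      · exact ⟨β, hβr, hzero rfl, 1, one_pos, h1.2, fun k _ => one_dvd _⟩
      · rw [hN] at h1; exact absurd h1.1 (by simp [Kind.norm, shortNorm])
      · rw [hN] at h1; exact absurd h1.1 (by simp [Kind.norm, shortNorm])
    · exact h13 1 (exists_level_one_three hv (by simp) hβ hN).1 rfl (by norm_num) rfl rfl
        fun k hk => hmod hk
    · exact h13 3 ((exists_level_one_three hv (by simp) hβ hN).2 (by simp)) rfl (by norm_num) rfl rfl
        fun k hk => hmod hk
    · exact h0 rfl rfl rfl fun k hk => Int.dvd_of_emod_eq_zero (hmod hk)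
    · exact h1' (exists_level_one_of_norm_four hv (Or.inl rfl) hβ hN) rfl rfl rfl
        fun k hk => hmod hk
  · cases x <;> first | exact hx.elim | skip
    · exact h0 rfl rfl rfl fun k hk => Int.dvd_of_emod_eq_zero (hmod hk)
    · exact h1' (exists_level_one_of_norm_four hv (Or.inr rfl) hβ hN) rfl rfl rfl
        fun k hk => hmod hk
    · exact h0' rfl rfl rfl fun k hk => Int.dvd_of_emod_eq_zero (hmod hk)
    · exact h13 1 (exists_level_one_three hv (by simp) hβ hN).1 rfl (by norm_num) rfl rfl
        fun k hk => hmod hk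
    · exact h2' (by simp) rfl rfl rfl fun k hk => hmod hk
    · exact h13 3 ((exists_level_one_three hv (by simp) hβ hN).2 (by simp)) rfl (by norm_num) rfl rfl
        fun k hk => hmod hk
  · cases x <;> first | exact hx.elim | skip
    · exact h0 rfl rfl rfl fun k hk => Int.dvd_of_emod_eq_zero (hmod hk)
    · exact h1' (exists_level_one_three hv (by simp) hβ hN).1 rfl rfl rfl fun k hk => hmod hk
    · exact h0' rfl rfl rfl fun k hk => Int.dvd_of_emod_eq_zero (hmod hk)
    · exact h2' (by simp) rfl rfl rfl fun k hk => hmod hk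
  · cases x <;> first | exact hx.elim | skip
    · exact h0 rfl rfl rfl fun k hk => Int.dvd_of_emod_eq_zero (hmod hk)
    · exact h0' rfl rfl rfl fun k hk => Int.dvd_of_emod_eq_zero (hmod hk)
    · exact h2' (by simp) rfl rfl rfl fun k hk => hmod hk

/-- For every occurring kind `x` and every `t` in `target c n x` there is a root in `Σ_x^+` with
finite part `t`, and its image moves in steps compatible with the occurrence condition. -/
theorem exists_sigmaPos_of_occurs (hv : IsValid c n) {x : Kind} {k : ℤ} (hx : Occurs c x k)
    {t : FoldLat c n} (ht : t ∈ target c n x) :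
    ∃ α ∈ sigmaPos c n x, ∃ P, x.level < P ∧ P ∣ k - x.level ∧
      ∀ a : ℤ, O c n (a • delta c n + α) = (x.level + P * a) • delta c n + iota c n t := by
  obtain ⟨γ, hγ, hO, P, hlt, hP, hd⟩ := exists_real_of_occurs hv hx ht
  obtain ⟨α, hα, h1, h2⟩ := exists_mem_sigmaPos hv ht hγ hO hP hlt
  refine ⟨α, hα, P, hlt, hd k hx, fun a => ?_⟩
  rw [add_comm (a • _)]
  refine (h2.2 a).trans ?_
  unfold O at h1
  rw [h1]
  module

end Level
end OrbitFolding

namespace OrbitFolding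

set_option linter.unusedSectionVars false

/-! ### Classes of positive real roots and their partition into blocks. -/

section Blocks

variable {c : FoldCase} {n : ℕ}

theorem Kind.level_nonneg (x : Kind) : 0 ≤ x.level := by cases x <;> simp [Kind.level]

theorem le_orbitSum {I : Type} [Fintype I] [DecidableEq I] {σ : Equiv.Perm I} {x : I → ℤ} (hx : 0 ≤ x) :
    x ≤ orbitSum σ x := by
  have h1 := Finset.single_le_sum (f := fun k => (act σ)^[k] x)
    (s := Finset.range (Function.minimalPeriod (act σ) x))
    (fun k _ => iterate_act_nonneg hx k) (Finset.mem_range.2 (minimalPeriod_act_pos x))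
  exact h1

/-- Adding a multiple of `δ` does not affect whether the image is isotropic. -/
theorem norm_O_add_smul_delta (hv : IsValid c n) (β : Lat c n) (a : ℤ) :
    pairing (form c n) (O c n (β + a • delta c n)) (O c n (β + a • delta c n)) = 0 ↔
      pairing (form c n) (O c n β) (O c n β) = 0 := by
  have h := isFoldable hv
  rw [← not_iff_not]
  refine (h.pairing_orb_ne_zero_iff _).trans (Iff.trans ?_ (h.pairing_orb_ne_zero_iff _).symm)
  rw [h.orbitSum_add_delta, add_comm (orbitSum _ _), h.pairing_add_smul_delta]

theorem norm_O_neg (hv : IsValid c n) (β : Lat c n) :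
    pairing (form c n) (O c n (-β)) (O c n (-β)) = pairing (form c n) (O c n β) (O c n β) := by
  rw [O_neg hv, pairing_neg_left, pairing_neg_right, neg_neg]

theorem norm_smul_delta (hv : IsValid c n) (k : ℤ) :
    pairing (form c n) (k • delta c n) (k • delta c n) = 0 := by
  rw [pairing_smul_left, (isFoldable hv).pairing_delta_left, mul_zero]

/-- The discarded roots are those with isotropic image: subtracting β_0 δ from such a root leaves a
root that vanishes at 0 and has image in ℤδ, hence up to sign an element of Σ_0^+. -/
theorem mem_Dom_iff (hv : IsValid c n) {β : Lat c n} :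
    β ∈ Dom c n ↔ IsRealRoot (form c n) β ∧ 0 ≤ β ∧
      pairing (form c n) (O c n β) (O c n β) ≠ 0 := by
  have h := isFoldable hv
  constructor
  · rintro ⟨⟨h1, h2⟩, h3⟩
    refine ⟨h1, h2, fun h0 => h3 ?_⟩
    have h0' : pairing (form c n) (O c n (β + (-β 0) • delta c n))
        (O c n (β + (-β 0) • delta c n)) = 0 := (norm_O_add_smul_delta hv β _).2 h0
    have hr : IsRealRoot (form c n) (β + (-β 0) • delta c n) := (h.isRealRoot_add_delta β _).2 h1
    have hz : (β + (-β 0) • delta c n) 0 = 0 := by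
      rw [Pi.add_apply, Pi.smul_apply, delta_zero, smul_eq_mul]; ring
    have hm : ((β 0).toNat : ℤ) = β 0 := Int.toNat_of_nonneg (h2 0)
    generalize hα : β + (-β 0) • delta c n = α at *
    rcases h.nonneg_or_nonpos (h.pairing_self_of_isRealRoot hr) with h4 | h4
    · refine ⟨(β 0).toNat, α, ⟨⟨hr, h4, hz⟩, _, h.eq_smul_delta h0'⟩, Or.inl ?_⟩
      rw [hm, ← hα]
      module
    · refine ⟨(β 0).toNat, -α, ⟨⟨hr.neg, neg_nonneg.2 h4, by rw [Pi.neg_apply, hz, neg_zero]⟩, _,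
        h.eq_smul_delta (x := O c n (-α)) (by rw [norm_O_neg hv, h0'])⟩, Or.inr ?_⟩
      rw [hm, ← hα]
      module
  · rintro ⟨h1, h2, h3⟩
    refine ⟨⟨h1, h2⟩, ?_⟩
    rintro ⟨m, α, ⟨-, k, hk⟩, h4⟩
    have h5 : pairing (form c n) (O c n α) (O c n α) = 0 := by rw [hk, norm_smul_delta hv]
    apply h3
    rcases h4 with rfl | rfl
    · rw [add_comm (_ • _) α, norm_O_add_smul_delta hv, h5]
    · rw [sub_eq_add_neg, add_comm (_ • _) (-α), norm_O_add_smul_delta hv, norm_O_neg hv, h5]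

theorem exists_mem_Sig (hv : IsValid c n) {x : Kind} {k : ℕ} (hx : Occurs c x k)
    {t : FoldLat c n} (ht : t ∈ target c n x) :
    ∃ β : Dom c n, β.1 ∈ Sig c n x k ∧ O c n β.1 = (k : ℤ) • delta c n + iota c n t := by
  have h := isFoldable hv
  obtain ⟨α, hα, P, hlt, ⟨a, ha⟩, h1⟩ := exists_sigmaPos_of_occurs hv hx ht
  have hl := x.level_nonneg
  -- The level k = level(x) + P a is nonnegative and level(x) < P, which forces a > -1.
  have ha0 : 0 ≤ a := by nlinarith
  lift a to ℕ using ha0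
  have h2 : O c n ((a : ℤ) • delta c n + α) = (k : ℤ) • delta c n + iota c n t := by
    rw [h1, ← ha]; congr 2; ring
  refine ⟨⟨(a : ℤ) • delta c n + α, (mem_Dom_iff hv).2 ⟨?_, ?_, ?_⟩⟩,
    ⟨⟨a, 0, α, hα, rfl⟩, t, ht, h2⟩, h2⟩
  · rw [add_comm (_ • _) α]; exact (h.isRealRoot_add_delta _ _).2 hα.1.1
  · exact add_nonneg (smul_nonneg (by positivity) fun i => (h.pos i).le) hα.1.2.1
  · rw [h2, h.pairing_add_smul_delta]
    exact (norm_pos_of_mem_target hv ht).ne'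

/-- Translating to the negative level -k gives aδ + α with a < 0; its negative is the required root.
It is positive because its coefficient at 0 is -a. -/
theorem exists_mem_SigNeg (hv : IsValid c n) {x : Kind} {k : ℕ} (hk : 1 ≤ k)
    (hx : Occurs c x (-(k : ℤ))) {t : FoldLat c n} (ht : t ∈ target c n x) :
    ∃ β : Dom c n, β.1 ∈ SigNeg c n x k ∧ O c n β.1 = (k : ℤ) • delta c n - iota c n t := by
  have h := isFoldable hv
  obtain ⟨α, hα, P, hlt, ⟨a, ha⟩, h1⟩ := exists_sigmaPos_of_occurs hv hx ht
  have hl := x.level_nonneg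
  have ha0 : 0 < -a := by
    by_contra hcon
    have : 0 ≤ P * a := mul_nonneg (by omega) (by omega)
    omega
  obtain ⟨b, hb⟩ : ∃ b : ℕ, (b : ℤ) = -a := ⟨(-a).toNat, Int.toNat_of_nonneg ha0.le⟩
  have h2 : O c n ((b : ℤ) • delta c n - α) = (k : ℤ) • delta c n - iota c n t := by
    have h3 : (b : ℤ) • delta c n - α = -(a • delta c n + α) := by rw [hb]; module
    have h4 : x.level + P * a = -(k : ℤ) := by rw [← ha]; ring
    rw [h3, O_neg hv, h1, h4]
    module
  have hr : IsRealRoot (form c n) ((b : ℤ) • delta c n - α) := by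
    rw [sub_eq_add_neg, add_comm (_ • _) (-α)]; exact (h.isRealRoot_add_delta _ _).2 hα.1.1.neg
  refine ⟨⟨(b : ℤ) • delta c n - α, (mem_Dom_iff hv).2 ⟨hr, ?_, ?_⟩⟩,
    ⟨⟨b, 0, by omega, α, hα, rfl⟩, t, ht, h2⟩, h2⟩
  · rcases h.nonneg_or_nonpos (h.pairing_self_of_isRealRoot hr) with h5 | h5
    · exact h5
    · have h6 := h5 0
      rw [Pi.sub_apply, Pi.smul_apply, delta_zero, hα.1.2.2] at h6
      simp at h6
      omega
  · rw [h2, sub_eq_add_neg, h.pairing_add_smul_delta, pairing_neg_left, pairing_neg_right, neg_neg]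
    exact (norm_pos_of_mem_target hv ht).ne'

/-- The image of a positive real root with nonisotropic image. -/
theorem exists_occurs_of_mem_Dom (hv : IsValid c n) (β : Dom c n) :
    ∃ (x : Kind) (k : ℕ) (t : FoldLat c n), t ∈ target c n x ∧
      ((Occurs c x k ∧ O c n β.1 = (k : ℤ) • delta c n + iota c n t) ∨
        (1 ≤ k ∧ Occurs c x (-(k : ℤ)) ∧ O c n β.1 = (k : ℤ) • delta c n - iota c n t)) := by
  obtain ⟨h1, h2, h3⟩ := (mem_Dom_iff hv).1 β.2
  have hO : 0 ≤ O c n β.1 := orb_nonneg _ h2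
  obtain ⟨x, k, hx, t, ht, h4 | h4⟩ := exists_occurs_or_neg hv h1 h3
  · have h5 : 0 ≤ k := by
      have h6 := hO 0
      rwa [h4, apply_zero_of_eq hv ht] at h6
    lift k to ℕ using h5
    exact ⟨x, k, t, ht, Or.inl ⟨hx, h4⟩⟩
  · have h5 : 0 ≤ -k := by
      have h6 := hO 0
      rwa [h4, Pi.neg_apply, apply_zero_of_eq hv ht] at h6
    obtain ⟨b, hb⟩ : ∃ b : ℕ, (b : ℤ) = -k := ⟨(-k).toNat, Int.toNat_of_nonneg h5⟩
    have hk : k = -(b : ℤ) := by omega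
    subst hk
    have h7 : O c n β.1 = (b : ℤ) • delta c n - iota c n t := by rw [h4]; module
    refine ⟨x, b, t, ht, Or.inr ⟨?_, hx, h7⟩⟩
    -- At level 0 the image would be -ι(t), which is nonnegative only for t = 0.
    by_contra hb0
    obtain rfl : b = 0 := by omega
    have h8 : iota c n t = 0 := by
      refine le_antisymm ?_ ((emb_nonneg_iff _ _).2 (nonneg_of_mem_target hv ht))
      rw [h7] at hO
      simpa using hO
    have h9 := norm_pos_of_mem_target hv ht
    rw [h8, pairing_zero_left] at h9
    omega

theorem cls_eq_iff {β γ : Dom c n} : cls c n β = cls c n γ ↔ O c n β.1 = O c n γ.1 :=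
  Quotient.eq (r := Setoid.ker fun β : Dom c n => O c n β.1)

theorem exists_cls_eq (C : Hat c n) : ∃ β, cls c n β = C :=
  Quotient.exists_rep (s := Setoid.ker fun β : Dom c n => O c n β.1) C

theorem iUnion_block (hv : IsValid c n) : ⋃ p ∈ blockIndex c, block c n p = Set.univ := by
  rw [Set.eq_univ_iff_forall]
  intro C
  obtain ⟨β, rfl⟩ := exists_cls_eq C
  simp only [Set.mem_iUnion]
  obtain ⟨x, k, t, ht, ⟨h1, h2⟩ | ⟨h0, h1, h2⟩⟩ := exists_occurs_of_mem_Dom hv β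
  · obtain ⟨γ, h3, h4⟩ := exists_mem_Sig hv h1 ht
    exact ⟨Sum.inl (x, k), h1, γ, h3, cls_eq_iff.2 (h4.trans h2.symm)⟩
  · obtain ⟨γ, h3, h4⟩ := exists_mem_SigNeg hv h0 h1 ht
    exact ⟨Sum.inr (x, k), ⟨h0, h1⟩, γ, h3, cls_eq_iff.2 (h4.trans h2.symm)⟩

/-- Among the types occurring at a given level, the norms of the finite parts are distinct. -/
theorem Occurs.eq {x x' : Kind} {k : ℤ} (h : Occurs c x k) (h' : Occurs c x' k)
    (hn : x.mult ^ 2 * x.norm c = x'.mult ^ 2 * x'.norm c) : x = x' := by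
  cases c <;> cases x <;> first | exact h.elim | skip
  all_goals
    cases x' <;> first | rfl | exact h'.elim | skip
  all_goals
    simp only [Occurs, Int.ModEq, Kind.mult, Kind.norm, shortNorm] at h h' hn
    omega

/-- The coefficient at 0 gives k, and then the finite parts agree. Opposite signs are impossible
since finite parts are nonnegative and nonzero; with equal signs the norm determines the type. -/
theorem pairwiseDisjoint_block (hv : IsValid c n) :
    (blockIndex c).PairwiseDisjoint (block c n) := by
  have hO : ∀ {β γ : Dom c n} {C}, cls c n β = C → cls c n γ = C → O c n β.1 = O c n γ.1 :=
    fun h1 h2 => cls_eq_iff.1 (h1.trans h2.symm)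
  have key : ∀ {x x' : Kind} {k k' : ℤ} {t t' : FoldLat c n}, Occurs c x k → Occurs c x' k' →
      t ∈ target c n x → t' ∈ target c n x' →
      k • delta c n + iota c n t = k' • delta c n + iota c n t' → x = x' ∧ k = k' := by
    intro x x' k k' t t' hx hx' ht ht' he
    have hk : k = k' := by
      have h1 := congrFun he 0
      rwa [apply_zero_of_eq hv ht, apply_zero_of_eq hv ht'] at h1
    subst hk
    have h2 := add_left_cancel he
    exact ⟨hx.eq hx' (by rw [← norm_of_mem_target hv ht, ← norm_of_mem_target hv ht', h2]), rfl⟩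
  have key2 : ∀ {x x' : Kind} {k k' : ℤ} {t t' : FoldLat c n},
      t ∈ target c n x → t' ∈ target c n x' →
      k • delta c n + iota c n t = k' • delta c n - iota c n t' → False := by
    intro x x' k k' t t' ht ht' he
    have hk : k = k' := by
      have h1 := congrFun he 0
      rw [apply_zero_of_eq hv ht, Pi.sub_apply, Pi.smul_apply, delta_zero,
        iota_apply_zero_of_mem_target hv ht'] at h1
      simpa using h1
    subst hk
    have h2 : iota c n t = -iota c n t' := by
      rw [sub_eq_add_neg] at he
      exact add_left_cancel he
    have h3 : 0 ≤ iota c n t := (emb_nonneg_iff _ _).2 (nonneg_of_mem_target hv ht)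
    have h4 : 0 ≤ iota c n t' := (emb_nonneg_iff _ _).2 (nonneg_of_mem_target hv ht')
    have h5 : iota c n t = 0 := le_antisymm (by rw [h2]; exact neg_nonpos.2 h4) h3
    have h6 := norm_pos_of_mem_target hv ht
    rw [h5, pairing_zero_left] at h6
    omega
  intro p hp p' hp' hne
  refine Set.disjoint_left.2 fun C h1 h2 => hne ?_
  rcases p with ⟨x, k⟩ | ⟨x, k⟩ <;> rcases p' with ⟨x', k'⟩ | ⟨x', k'⟩ <;>
    obtain ⟨β, ⟨-, t, ht, hβ⟩, h3⟩ := h1 <;> obtain ⟨γ, ⟨-, t', ht', hγ⟩, h4⟩ := h2 <;>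
    have he := hO h3 h4 <;> rw [hβ, hγ] at he
  · obtain ⟨h5, h6⟩ := key hp hp' ht ht' he
    dsimp only at h5 h6
    rw [h5, Int.ofNat_inj.1 h6]
  · exact (key2 ht ht' he).elim
  · exact (key2 ht' ht he.symm).elim
  · obtain ⟨h5, h6⟩ := key hp.2 hp'.2 ht ht' (by
      rw [← neg_inj] at he
      convert he using 1 <;> · dsimp only; module)
    dsimp only at h5 h6
    rw [h5, Int.ofNat_inj.1 (neg_inj.1 h6)]

end Blocks
end OrbitFolding

namespace OrbitFolding

set_option linter.unusedSectionVars false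

/-- The norm is invariant under folded reflections and positive on folded simple roots. -/
theorem IsFoldable.norm_foldForm_pos {I : Type} [Fintype I] [DecidableEq I]
    {B : I → I → ℤ} {δ : I → ℤ} {σ : Equiv.Perm I} {o : I} (h : IsFoldable B δ σ o)
    {y : Orbits σ → ℤ} (hy : IsRealRoot (foldForm B σ) y) :
    0 < pairing B (emb B σ y) (emb B σ y) := by
  induction hy with
  | simple η =>
    obtain ⟨i, rfl⟩ := exists_toOrbit_eq η
    obtain ⟨c, hc, h1⟩ := h.exists_orb_simpleRoot i
    have hth := h.isOrthOrbit_orbitRoot i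
    rw [emb_simpleRoot, h1, pairing_smul_left, pairing_smul_right, h.pairing_orbitSum_orbitSum hth]
    have := minimalPeriod_act_pos (σ := σ) (orbitRoot B σ i)
    positivity
  | reflect x η k _ hk ih =>
    obtain ⟨i, rfl⟩ := exists_toOrbit_eq η
    rwa [h.emb_reflect x i hk, h.pairing_orbitRefl (h.isOrthOrbit_orbitRoot i)]

/-! ### The induced map on classes and its restrictions to blocks. -/

section Bijections

variable {c : FoldCase} {n : ℕ}

theorem exists_fold (hv : IsValid c n) :
    ∃ f : Hat c n → FoldLat c n, ∀ β : Dom c n, iota c n (f (cls c n β)) = O c n β.1 := by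
  have h1 : ∀ C : Hat c n, ∃ y, ∀ β : Dom c n, cls c n β = C → iota c n y = O c n β.1 := by
    intro C
    obtain ⟨γ, rfl⟩ := exists_cls_eq C
    obtain ⟨h2, -, h3⟩ := (mem_Dom_iff hv).1 γ.2
    obtain ⟨y, -, hy⟩ := exists_iota_eq_O hv h2 h3
    exact ⟨y, fun β hβ => hy.trans (cls_eq_iff.1 hβ).symm⟩
  choose f hf using h1
  exact ⟨f, fun β => hf _ β rfl⟩

variable {f : Hat c n → FoldLat c n}

theorem iota_injective : Function.Injective (iota c n) := emb_injective _ _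

theorem fold_injective (hf : ∀ β : Dom c n, iota c n (f (cls c n β)) = O c n β.1) :
    Function.Injective f := by
  intro C C' he
  obtain ⟨β, rfl⟩ := exists_cls_eq C
  obtain ⟨γ, rfl⟩ := exists_cls_eq C'
  rw [cls_eq_iff, ← hf, ← hf, he]

theorem O_mem_posRealRoots (hv : IsValid c n) {β : Lat c n} (hβ : β ∈ posRealRoots (form c n))
    (hq : pairing (form c n) (O c n β) (O c n β) ≠ 0) :
    ∃ y ∈ posRealRoots (uform c n), iota c n y = O c n β := by
  obtain ⟨y, h1, h2⟩ := exists_iota_eq_O hv hβ.1 hq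
  refine ⟨y, ⟨h1, (emb_nonneg_iff (form c n) _).1 ?_⟩, h2⟩
  have h3 : 0 ≤ O c n β := orb_nonneg _ hβ.2
  rwa [← h2] at h3

/-- A folded real root lifts to a real root; since its norm is nonzero, positivity of the image
forces positivity of the lift, and the lift is not among the discarded roots. -/
theorem fold_bijOn (hv : IsValid c n)
    (hf : ∀ β : Dom c n, iota c n (f (cls c n β)) = O c n β.1) :
    Set.BijOn f Set.univ (posRealRoots (uform c n)) := by
  have h := isFoldable hv
  refine ⟨fun C _ => ?_, (fold_injective hf).injOn, fun y hy => ?_⟩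
  · obtain ⟨β, rfl⟩ := exists_cls_eq C
    obtain ⟨y, hy, h1⟩ := O_mem_posRealRoots hv β.2.1 ((mem_Dom_iff hv).1 β.2).2.2
    rwa [← iota_injective (h1.trans (hf β).symm)]
  · obtain ⟨β, hβ, h1⟩ := h.exists_orb_eq_emb hy.1
    have h2 : pairing (form c n) (O c n β) (O c n β) ≠ 0 := by
      unfold O
      rw [← h1]
      exact (h.norm_foldForm_pos hy.1).ne'
    have h3 : 0 ≤ orb (form c n) (sigma c n) β := by
      rw [← h1]; exact (emb_nonneg_iff _ _).2 hy.2
    have h4 : β ∈ Dom c n := (mem_Dom_iff hv).2 ⟨hβ, h.nonneg_of_orb_nonneg hβ h3 h2, h2⟩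
    exact ⟨cls c n ⟨β, h4⟩, trivial, iota_injective ((hf ⟨β, h4⟩).trans h1.symm)⟩

theorem iota_smul_udelta (hv : IsValid c n) {N m : ℕ} (hN : (N : ℤ) = nullFactor c * m) :
    iota c n ((m : ℤ) • udelta c n) = (N : ℤ) • delta c n := by
  have h1 : iota c n ((m : ℤ) • udelta c n) = (m : ℤ) • iota c n (udelta c n) := emb_smul _ _ _
  rw [h1, iota_udelta hv, hN, smul_smul, mul_comm]

theorem iota_add (x y : FoldLat c n) : iota c n (x + y) = iota c n x + iota c n y := emb_add _ _ _

theorem iota_sub (x y : FoldLat c n) : iota c n (x - y) = iota c n x - iota c n y := emb_sub _ _ _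

/-- The membership condition of a block prescribes the image. No occurrence condition is needed,
which is used for the unions of blocks in the case D. -/
theorem fold_mapsTo (hv : IsValid c n)
    (hf : ∀ β : Dom c n, iota c n (f (cls c n β)) = O c n β.1) (x : Kind) {N m : ℕ}
    (hN : (N : ℤ) = nullFactor c * m) : Set.MapsTo f (HatSig c n x N) (USig c n x m) := by
  rintro _ ⟨β, ⟨-, t, ht, h1⟩, rfl⟩
  refine ⟨t, ht, iota_injective ?_⟩
  rw [hf, h1, iota_add, iota_smul_udelta hv hN]

theorem fold_surjOn (hv : IsValid c n)
    (hf : ∀ β : Dom c n, iota c n (f (cls c n β)) = O c n β.1) {x : Kind} {N m : ℕ}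
    (hN : (N : ℤ) = nullFactor c * m) (hx : Occurs c x N) :
    Set.SurjOn f (HatSig c n x N) (USig c n x m) := by
  rintro _ ⟨t, ht, rfl⟩
  obtain ⟨β, h1, h2⟩ := exists_mem_Sig hv hx ht
  refine ⟨cls c n β, ⟨β, h1, rfl⟩, iota_injective ?_⟩
  rw [hf, h2, iota_add, iota_smul_udelta hv hN]

theorem fold_mapsTo_neg (hv : IsValid c n)
    (hf : ∀ β : Dom c n, iota c n (f (cls c n β)) = O c n β.1) (x : Kind) {N m : ℕ}
    (hN : (N : ℤ) = nullFactor c * m) : Set.MapsTo f (HatSigNeg c n x N) (USigNeg c n x m) := by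
  rintro _ ⟨β, ⟨-, t, ht, h1⟩, rfl⟩
  refine ⟨t, ht, iota_injective ?_⟩
  rw [hf, h1, iota_sub, iota_smul_udelta hv hN]

theorem fold_surjOn_neg (hv : IsValid c n)
    (hf : ∀ β : Dom c n, iota c n (f (cls c n β)) = O c n β.1) {x : Kind} {N m : ℕ}
    (hN : (N : ℤ) = nullFactor c * m) (h0 : 1 ≤ N) (hx : Occurs c x (-(N : ℤ))) :
    Set.SurjOn f (HatSigNeg c n x N) (USigNeg c n x m) := by
  rintro _ ⟨t, ht, rfl⟩
  obtain ⟨β, h1, h2⟩ := exists_mem_SigNeg hv h0 hx ht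
  refine ⟨cls c n β, ⟨β, h1, rfl⟩, iota_injective ?_⟩
  rw [hf, h2, iota_sub, iota_smul_udelta hv hN]

theorem fold_bijOn_sig (hv : IsValid c n)
    (hf : ∀ β : Dom c n, iota c n (f (cls c n β)) = O c n β.1) {x : Kind} {N m : ℕ}
    (hN : (N : ℤ) = nullFactor c * m) (hx : Occurs c x N) :
    Set.BijOn f (HatSig c n x N) (USig c n x m) :=
  ⟨fold_mapsTo hv hf x hN, (fold_injective hf).injOn, fold_surjOn hv hf hN hx⟩

theorem fold_bijOn_sigNeg (hv : IsValid c n)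
    (hf : ∀ β : Dom c n, iota c n (f (cls c n β)) = O c n β.1) {x : Kind} {N m : ℕ}
    (hN : (N : ℤ) = nullFactor c * m) (h0 : 1 ≤ N) (hx : Occurs c x (-(N : ℤ))) :
    Set.BijOn f (HatSigNeg c n x N) (USigNeg c n x m) :=
  ⟨fold_mapsTo_neg hv hf x hN, (fold_injective hf).injOn, fold_surjOn_neg hv hf hN h0 hx⟩

/-- A positive root has nonisotropic image, or its image is a positive multiple of `δ`. -/
theorem O_eq_smul_delta_or (hv : IsValid c n) {β : Lat c n}
    (hβ : β ∈ posRoots (form c n) (delta c n)) :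
    (β ∈ posRealRoots (form c n) ∧ pairing (form c n) (O c n β) (O c n β) ≠ 0) ∨
      ∃ k : ℕ, 0 < k ∧ O c n β = (k : ℤ) • delta c n := by
  have h := isFoldable hv
  by_cases hq : pairing (form c n) (O c n β) (O c n β) = 0
  · right
    have h1 := h.eq_smul_delta hq
    have h2 : 0 ≤ O c n β := orb_nonneg _ hβ.2
    refine ⟨(O c n β 0).toNat, ?_, by rwa [Int.toNat_of_nonneg (h2 0)]⟩
    by_contra h3
    have h4 : O c n β = 0 := by
      have h5 : O c n β 0 = 0 := le_antisymm (by omega) (h2 0)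
      rw [h1, h5, zero_smul]
    -- The multiple of δ cannot be zero: the orbit sum of a positive root dominates the root.
    obtain ⟨e, he, h5⟩ := exists_orb_eq (form c n) (sigma c n) β
    have h6 : orbitSum (sigma c n) β = 0 :=
      (smul_eq_zero.1 (h5.symm.trans h4)).resolve_left he.ne'
    have h7 : β = 0 := le_antisymm ((le_orbitSum hβ.2).trans_eq h6) hβ.2
    rcases hβ.1 with h8 | ⟨k, hk, h8⟩
    · have h9 := h.pairing_self_of_isRealRoot h8
      rw [h7, pairing_zero_left] at h9
      omega
    · have h9 := congrFun (h8.symm.trans h7) 0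
      rw [Pi.smul_apply, delta_zero] at h9
      exact hk (by simpa using h9)
  · left
    refine ⟨⟨?_, hβ.2⟩, hq⟩
    rcases hβ.1 with h8 | ⟨k, -, rfl⟩
    · exact h8
    · exfalso
      -- An imaginary root has norm 0, so it is neither split nor a sum of a split pair, and being
      -- fixed it equals its image.
      have h9 : ∀ γ, IsSplit (form c n) (sigma c n) γ → ¬ k • delta c n = γ + act (sigma c n) γ := by
        intro γ hγ he
        have h10 := h.pairing_self_of_isRealRoot hγ.2.2
        rw [← he, norm_smul_delta hv] at h10
        omega
      apply hq
      unfold O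
      rw [orb_eq_orbitSum, orbitSum_of_act_eq, norm_smul_delta hv]
      · rw [act_smul, h.act_delta]
      · intro hs
        have h10 := h.pairing_self_of_isRealRoot hs.1
        rw [norm_smul_delta hv] at h10
        omega
      · rintro ⟨γ, hγ, he⟩
        exact h9 γ hγ he

theorem smul_udelta_mem_posRoots {k : ℕ} (hk : 0 < k) :
    (k : ℤ) • udelta c n ∈ posRoots (uform c n) (udelta c n) := by
  refine ⟨Or.inr ⟨k, by omega, rfl⟩, smul_nonneg (by omega) fun η => ?_⟩
  unfold udelta
  rw [Pi.zero_apply]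
  split_ifs <;> norm_num

theorem mem_posRoots_of_mem_posRealRoots {y : FoldLat c n} (hy : y ∈ posRealRoots (uform c n)) :
    y ∈ posRoots (uform c n) (udelta c n) := ⟨Or.inl hy.1, hy.2⟩

theorem exists_posRoot (hv : IsValid c n) (hD : c ≠ .D) {β : Lat c n}
    (hβ : β ∈ posRoots (form c n) (delta c n)) :
    ∃ y ∈ posRoots (uform c n) (udelta c n), O c n β = iota c n y := by
  have hnf : nullFactor c = 1 := by cases c <;> first | rfl | exact absurd rfl hD
  rcases O_eq_smul_delta_or hv hβ with ⟨h1, h2⟩ | ⟨k, hk, h1⟩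
  · obtain ⟨y, hy, h3⟩ := O_mem_posRealRoots hv h1 h2
    exact ⟨y, mem_posRoots_of_mem_posRealRoots hy, h3.symm⟩
  · exact ⟨_, smul_udelta_mem_posRoots hk,
      h1.trans (iota_smul_udelta hv (by rw [hnf, one_mul])).symm⟩

/-! ### The case `D` -/

theorem apply_toOrbit_zero_of_mem_foldFin {b : FoldLat c n} (hb : b ∈ foldFin c n) :
    b (toOrbit (sigma c n) 0) = 0 := by
  obtain ⟨β, hβ, h1⟩ := hb
  have h2 := congrFun h1 0
  rw [O_apply_zero_of_mem_finSub hβ, iota, emb_apply] at h2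
  exact (mul_eq_zero.1 h2).resolve_right
    (orb_simpleRoot_apply_pos _ (Equiv.Perm.SameCycle.refl _ _)).ne'

theorem neg_mem_foldFin (hv : IsValid c n) {b : FoldLat c n} (hb : b ∈ foldFin c n) :
    -b ∈ foldFin c n := by
  obtain ⟨β, hβ, h1⟩ := hb
  refine ⟨-β, neg_mem_finSub hβ, ?_⟩
  rw [O_neg hv, ← h1]
  exact emb_neg _ _

theorem exists_eq_two_mul (hv : IsValid .D n) (β : Dom .D n) :
    ∃ m : ℕ, ∃ b ∈ foldFin .D n, O .D n β.1 = (2 * m : ℤ) • delta .D n + iota .D n b := by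
  have hocc : ∀ {x : Kind} {k : ℤ}, Occurs .D x k → Even k ∧ target .D n x ⊆ foldFin .D n := by
    intro x k hx
    cases x <;> first | exact hx.elim | skip
    all_goals
      simp only [Occurs, Int.ModEq] at hx
      exact ⟨by rw [Int.even_iff]; omega, fun t ht => ht.1⟩
  obtain ⟨x, k, t, ht, ⟨h1, h2⟩ | ⟨-, h1, h2⟩⟩ := exists_occurs_of_mem_Dom hv β
  · obtain ⟨⟨m, hm⟩, h3⟩ := hocc h1
    exact ⟨k / 2, t, h3 ht, by rw [h2]; congr 2; omega⟩
  · obtain ⟨⟨m, hm⟩, h3⟩ := hocc h1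
    refine ⟨k / 2, -t, neg_mem_foldFin hv (h3 ht), ?_⟩
    have h4 : iota .D n (-t) = -iota .D n t := emb_neg _ _
    rw [h2, h4, ← sub_eq_add_neg]; congr 2; omega

/-- A split root has step 4, but it may be replaced by the sum of its orbit, which has the same
image and step 2. -/
theorem exists_hasShift_two (hv : IsValid .D n) {β : Lat .D n} (hβ : IsRealRoot (form .D n) β)
    (hq : pairing (form .D n) (O .D n β) (O .D n β) ≠ 0) :
    ∃ γ, IsRealRoot (form .D n) γ ∧ O .D n γ = O .D n β ∧
      HasShift (form .D n) (delta .D n) (sigma .D n) γ 2 := by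
  have h := isFoldable hv
  have hσ := sigma_apply_ne hv (by simp)
  rcases norm_of_ne_A hv (by simp) hβ hq with h4 | h8
  · exact ⟨β, hβ, rfl, hasShift_of_norm_four hv hβ h4⟩
  · rcases isSplit_or_isSum_of_CD hv (Or.inr rfl) hβ h8 with hs | hs
    · exact ⟨_, hs.2.2, orb_sum_eq hs, h.hasShift_of_act_eq hσ hs.2.2 hs.isSum.act_eq⟩
    · exact ⟨β, hβ, rfl, h.hasShift_of_act_eq hσ hβ hs.act_eq⟩

theorem exists_posRoot_of_D (hv : IsValid .D n) {β : Lat .D n}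
    (hβ : β ∈ posRoots (form .D n) (delta .D n)) :
    ((∃ y ∈ posRoots (uform .D n) (udelta .D n), O .D n β = iota .D n y) ∨
        ∃ k : ℕ, Odd k ∧ O .D n β = (k : ℤ) • delta .D n) ∧
      ∃ (k : ℕ) (b : FoldLat .D n), b (toOrbit (sigma .D n) 0) = 0 ∧
        O .D n β = (k : ℤ) • delta .D n + iota .D n b ∧
        (k : ℤ) • udelta .D n + b ∈ posRoots (uform .D n) (udelta .D n) := by
  have h := isFoldable hv
  rcases O_eq_smul_delta_or hv hβ with ⟨h1, h2⟩ | ⟨k, hk, h1⟩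
  · obtain ⟨y, hy, h3⟩ := O_mem_posRealRoots hv h1 h2
    refine ⟨Or.inl ⟨y, mem_posRoots_of_mem_posRealRoots hy, h3.symm⟩, ?_⟩
    obtain ⟨m, b, hb, h4⟩ := exists_eq_two_mul hv ⟨β, (mem_Dom_iff hv).2 ⟨h1.1, h1.2, h2⟩⟩
    refine ⟨2 * m, b, apply_toOrbit_zero_of_mem_foldFin hb, by rw [h4]; push_cast; rfl, ?_⟩
    -- Since the folded null root embeds as 2δ, the vector 2m times it plus b embeds as O(β) + 2mδ.
    -- This is the image of γ + mδ because γ has step 2.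
    obtain ⟨γ, hγ, h5, h6⟩ := exists_hasShift_two hv h1.1 h2
    have h7 : O .D n (γ + (m : ℤ) • delta .D n) = O .D n β + (2 * m : ℤ) • delta .D n := by
      rw [← h5]; exact h6.2 m
    have h8 : 0 ≤ O .D n (γ + (m : ℤ) • delta .D n) := by
      rw [h7]
      exact add_nonneg (orb_nonneg _ hβ.2) (smul_nonneg (by positivity) fun i => (h.pos i).le)
    have h9 : pairing (form .D n) (O .D n (γ + (m : ℤ) • delta .D n))
        (O .D n (γ + (m : ℤ) • delta .D n)) ≠ 0 := by
      rw [Ne, norm_O_add_smul_delta hv, h5]; exact h2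
    have h10 := (h.isRealRoot_add_delta γ m).2 hγ
    obtain ⟨z, hz, h11⟩ := O_mem_posRealRoots hv
      ⟨h10, h.nonneg_of_orb_nonneg h10 h8 h9⟩ h9
    convert mem_posRoots_of_mem_posRealRoots hz using 1
    apply iota_injective
    rw [h11, h7, h4, iota_add, iota_smul_udelta hv (N := 2 * (2 * m)) (by simp [nullFactor])]
    push_cast
    module
  · refine ⟨?_, k, 0, rfl, ?_, ?_⟩
    -- An even multiple of δ is a multiple of the embedded folded null root; an odd one is the
    -- exceptional alternative.
    · rcases Nat.even_or_odd' k with ⟨m, rfl | rfl⟩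
      · exact Or.inl ⟨_, smul_udelta_mem_posRoots (k := m) (by omega),
          h1.trans (iota_smul_udelta hv (by simp [nullFactor])).symm⟩
      · exact Or.inr ⟨_, ⟨m, rfl⟩, h1⟩
    · have h2 : iota .D n 0 = 0 := emb_zero _
      rw [h1, h2, add_zero]
    · rw [add_zero]; exact smul_udelta_mem_posRoots hk

end Bijections
end OrbitFolding

/-! ### The proposition in all four cases. -/

theorem proposition5p12 (c : FoldCase) (n : ℕ) (hn : 1 ≤ n) (hn2 : c ≠ FoldCase.D → 2 ≤ n) :
    -- (i) in the cases A, B, C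
    (c ≠ FoldCase.D → ∀ β ∈ posRoots (form c n) (delta c n),
      ∃ y ∈ posRoots (uform c n) (udelta c n), O c n β = iota c n y) ∧
    -- (i) in the case D (where the null root of the folded datum corresponds to `2 δ`):
    -- `O(β)` is a positive root or an odd multiple of `δ`; moreover `O(β) = k δ + b`, with `b` in
    -- the finite part, becomes a positive root when `δ` is read as the null root of the folded
    -- datum
    (c = FoldCase.D → ∀ β ∈ posRoots (form c n) (delta c n),
      ((∃ y ∈ posRoots (uform c n) (udelta c n), O c n β = iota c n y) ∨
        ∃ k : ℕ, Odd k ∧ O c n β = (k : ℤ) • delta c n) ∧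
      ∃ (k : ℕ) (b : FoldLat c n), b (toOrbit (sigma c n) 0) = 0 ∧
        O c n β = (k : ℤ) • delta c n + iota c n b ∧
        (k : ℤ) • udelta c n + b ∈ posRoots (uform c n) (udelta c n)) ∧
    -- (ii), (iii): the partition of the set of equivalence classes
    ((blockIndex c).PairwiseDisjoint (block c n) ∧
      ⋃ p ∈ blockIndex c, block c n p = Set.univ) ∧
    -- (ii): the bijection in the cases A, B, C
    (c ≠ FoldCase.D → ∃ f : Hat c n → FoldLat c n,
      (∀ β : Dom c n, iota c n (f (cls c n β)) = O c n β.1) ∧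
      Set.BijOn f Set.univ (posRealRoots (uform c n)) ∧
      (∀ (x : Kind) (m : ℕ), Occurs c x m →
        Set.BijOn f (HatSig c n x m) (USig c n x m)) ∧
      (∀ (x : Kind) (m : ℕ), 1 ≤ m → Occurs c x (-(m : ℤ)) →
        Set.BijOn f (HatSigNeg c n x m) (USigNeg c n x m))) ∧
    -- (iii): the bijection in the case D
    (c = FoldCase.D → ∃ f : Hat c n → FoldLat c n,
      (∀ β : Dom c n, ∃ m : ℕ, ∃ b ∈ foldFin c n,
        O c n β.1 = (2 * m : ℤ) • delta c n + iota c n b ∧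
        f (cls c n β) = (m : ℤ) • udelta c n + b) ∧
      (∀ β : Dom c n, iota c n (f (cls c n β)) = O c n β.1) ∧
      Set.BijOn f Set.univ (posRealRoots (uform c n)) ∧
      (∀ (x : Kind) (m : ℕ), Occurs c x (2 * m) →
        Set.BijOn f (HatSig c n x (2 * m)) (USig c n x m)) ∧
      (∀ m : ℕ, Set.BijOn f
        (HatSig c n Kind.l (2 * m) ∪ HatSig c n Kind.l2 (2 * m)) (USig c n Kind.l m)) ∧
      (∀ (x : Kind) (m : ℕ), 1 ≤ m → Occurs c x (-(2 * m : ℤ)) →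
        Set.BijOn f (HatSigNeg c n x (2 * m)) (USigNeg c n x m)) ∧
      (∀ m : ℕ, 1 ≤ m → Set.BijOn f
        (HatSigNeg c n Kind.l (2 * m) ∪ HatSigNeg c n Kind.l2 (2 * m))
        (USigNeg c n Kind.l m))) := by
  have hv : IsValid c n := ⟨hn, hn2⟩
  refine ⟨fun hD β hβ => exists_posRoot hv hD hβ, ?_,
    ⟨pairwiseDisjoint_block hv, iUnion_block hv⟩, ?_, ?_⟩
  · rintro rfl β hβ
    exact exists_posRoot_of_D hv hβ
  · intro hD
    have hnf : nullFactor c = 1 := by cases c <;> first | rfl | exact absurd rfl hD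
    obtain ⟨f, hf⟩ := exists_fold hv
    refine ⟨f, hf, fold_bijOn hv hf, fun x m hx => ?_, fun x m hm hx => ?_⟩
    · exact fold_bijOn_sig hv hf (by rw [hnf, one_mul]) hx
    · exact fold_bijOn_sigNeg hv hf (by rw [hnf, one_mul]) hm hx
  · rintro rfl
    obtain ⟨f, hf⟩ := exists_fold hv
    have hN : ∀ m : ℕ, ((2 * m : ℕ) : ℤ) = nullFactor .D * m := fun m => by simp [nullFactor]
    have hinj := fold_injective hf
    refine ⟨f, fun β => ?_, hf, fold_bijOn hv hf, fun x m hx => ?_, fun m => ?_,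
      fun x m hm hx => ?_, fun m hm => ?_⟩
    · obtain ⟨m, b, hb, h1⟩ := exists_eq_two_mul hv β
      refine ⟨m, b, hb, h1, iota_injective ?_⟩
      rw [hf, h1, iota_add, iota_smul_udelta hv (hN m)]
      push_cast
      rfl
    · exact fold_bijOn_sig hv hf (hN m) (by push_cast; exact hx)
    · refine ⟨(fold_mapsTo hv hf .l (hN m)).union (fold_mapsTo hv hf .l2 (hN m)), hinj.injOn, ?_⟩
      -- Only one of the two blocks occurs at level 2m, the type `l` for even m and `l2` for odd m,
      -- and it alone already covers the target.
      rcases Nat.even_or_odd m with ⟨j, hj⟩ | ⟨j, hj⟩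
      · refine (fold_surjOn hv hf (x := .l) (hN m) ?_).mono Set.subset_union_left subset_rfl
        simp only [Occurs, Int.ModEq]; omega
      · refine (fold_surjOn hv hf (x := .l2) (hN m) ?_).mono Set.subset_union_right subset_rfl
        simp only [Occurs, Int.ModEq]; omega
    · exact fold_bijOn_sigNeg hv hf (hN m) (by omega) (by push_cast; exact hx)
    · refine ⟨(fold_mapsTo_neg hv hf .l (hN m)).union (fold_mapsTo_neg hv hf .l2 (hN m)),
        hinj.injOn, ?_⟩
      rcases Nat.even_or_odd m with ⟨j, hj⟩ | ⟨j, hj⟩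
      · refine (fold_surjOn_neg hv hf (x := .l) (hN m) (by omega) ?_).mono
          Set.subset_union_left subset_rfl
        simp only [Occurs, Int.ModEq]; omega
      · refine (fold_surjOn_neg hv hf (x := .l2) (hN m) (by omega) ?_).mono
          Set.subset_union_right subset_rfl
        simp only [Occurs, Int.ModEq]; omega
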